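/- **Dynamical elliptic $q$-KZ equation for the elliptic conformal block of $\mathrm W_{q_{1,2}}(A_1)$.** *Notation.* Let $n\ge 1$, $k\ge 0$, $q_1,q_2,p,z\in\mathbb C^\times$ with $|q_2|>1$, $|p|<1$, and $K_\alpha,a_\alpha\in\mathbb C^\times$ $(1\le\alpha\le n)$. Put $q=q_2^{-1}$, $(x;q)_\infty=\prod_{m\ge0}(1-xq^m)$, $\theta(x)=(x;q)_\infty(q/x;q)_\infty$, $\Gamma(x)=\prod_{i,j\ge0}\frac{1-p^{i+1}q^{j+1}/x}{1-p^iq^jx}$ (elliptic gamma function), $x_{ij}=x_i/x_j$, $\rho_i=\frac{k+1}2-i$. For $\underline k=(k_1,\dots,k_n)\in\mathbb Z_{\ge0}^n$ with $\sum_\alpha k_\alpha=k$ let $c:\{1,\dots,k\}\to\{1,\dots,n\}$ be the weakly decreasing map with $|c^{-1}(\alpha)|=k_\alpha$, and put $K_i^c=\prod_{\alpha\le c(i)}K_\alpha$, $\kappa_\alpha=K_\alpha q_1^{-2k_\alpha}$, $\kappa_{\alpha+n}=\kappa_\alpha$, $\kappa^c_\alpha=\prod_{1\le\alpha'<\alpha}\kappa_{\alpha'}$.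 Define $$\mathsf c_{\underline k}(z)=\prod_{i=1}^k\frac{\theta(K_{c(i)})}{\theta(zq_1^{-2\rho_i}K_i^c)},\qquad \Phi(\underline x)=\prod_{i\ne j}\frac{\Gamma(q_1x_{ji})}{\Gamma(x_{ji})}\prod_{i,\alpha}\frac{\Gamma(a_\alpha/x_i)}{\Gamma(K_\alpha a_\alpha/x_i)},$$ and the off-shell elliptic stable envelope $\operatorname{Stab}_{\underline k}=\operatorname{Sym}_{\underline x}S_{\underline k}$ (sum over all permutations of the variables), where $$S_{\underline k}(\underline x;z)=\prod_{i<j}\frac{\theta(q_1x_{ji})}{\theta(x_{ji})}\prod_{i=1}^k\frac{\prod_{\alpha<c(i)}\theta(a_\alpha/x_i)\;\theta(zq_1^{-2\rho_i}K_i^ca_{c(i)}/x_i)\prod_{\alpha>c(i)}\theta(K_\alpha a_\alpha/x_i)}{\prod_{\alpha=1}^n\theta(K_\alpha a_\alpha/x_i)} .$$ *The block.* The elliptic conformal block in the chamber $\mathscr C_{1\dots n}$ (normalized trace of the ordered product of the $k_\alpha$-screened vertex operators) is the vector $\Psi=(\Psi^{\underline k})_{\underline k}$, $$\Psi^{\underline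 k}(\underline a;z)=\frac{\mathsf c_{\underline k}(z)}{k!}\oint\prod_{i=1}^k\frac{dx_i}{2\pi\mathrm i\,x_i}\,\Phi(\underline x)\operatorname{Stab}_{\underline k}(\underline x;z).$$ Here the summand $S_{\underline k}(x_{\sigma(1)},\dots,x_{\sigma(k)};z)$ of $\operatorname{Stab}_{\underline k}$ is integrated over the torus $|x_{\sigma(i)}|=r_i$, where the radii $r_i>0$ are admissible for $(\underline a,\underline k)$, i.e. in the domain of the radially ordered trace: $|q_1|r_i<r_j$ and $|pq_1|r_j<r_i$ for $i<j$; $|a_\alpha|<r_i$ for $\alpha\ge c(i)$; $|pa_\alpha|<r_i$ for $\alpha<c(i)$; $r_i<|q_2K_\alpha a_\alpha|$ for $\alpha\le c(i)$; $|p|r_i<|q_2K_\alpha a_\alpha|$ for $\alpha>c(i)$. (If the $r_i$ coincide, this is a single torus for the whole integrand.) *$R$-matrices.* Take two sites with parameters $(a_1,K_1),(a_2,K_2)$ and $m$ variables. Let $M_{12}(z)$ be the $(m+1)\times(m+1)$ matrix with the entries $\mathsf c_{\underline k}(z)\operatorname{Stab}_{\underline k}(\underline x^{(\underline\ell)};z)$,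 $k_1+k_2=\ell_1+\ell_2=m$, where $\underline x^{(\underline\ell)}$ consists of the points $a_\alpha q_1^{s}$, $0\le s<\ell_\alpha$, $\alpha=1,2$. Let $M_{21}(z)$ be the analogous matrix for the chamber $\mathscr C_{21}$ (defined with the order of the two sites reversed, with rows and columns labelled in the same way). Put $R^{(m)}(z)=M_{12}(z)M_{21}(z)^{-1}$; the common factors $\prod_{i,\alpha}\theta(K_\alpha a_\alpha/x_i^{(\underline\ell)})^{-1}$ of the columns cancel and are omitted from both matrices. For $n$ sites and $\beta\ne\alpha$, the matrix $R_{\beta,\alpha}(w)$ acts on the components $\underline k$ by changing only $(k_\alpha,k_\beta)$, through $R^{(m)}(w\,q_1^{k-m})$ for the pair of sites $(\alpha,\beta)$ in the roles of $(1,2)$, with $m=k_\alpha+k_\beta$. (The factor $q_1^{k-m}$ is due to the normalization of the dynamical parameter by $z\to zq_1^{k-1}$ for $k$ variables.) *Substitutions act componentwise.* The operation $z\to z\kappa_\alpha$ multiplies $z$ in the component $\underline k$ by the value of $\kappa_\alpha$ at $\underline k$. Accordingly, on functions $f=(f^{\underline k}(z))_{\underline k}$, the operator $R_{\beta,\alpha}(z\kappa^c_\beta)$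 is $$\big(R_{\beta,\alpha}(z\kappa^c_\beta)f\big)^{\underline k}(z)=\sum_{\underline k'}R_{\beta,\alpha}\big(z\kappa^c_\beta(\underline k)\big)_{\underline k,\underline k'}\;f^{\underline k'}(z')$$ with $z'=z$ if $\beta<\alpha$, and $z'=z\,\kappa_\alpha(\underline k)/\kappa_\alpha(\underline k')$ if $\beta>\alpha$. That is, for $\beta>\alpha$ it is the matrix $R_{\beta,\alpha}(z\prod_{\gamma<\beta,\gamma\ne\alpha}\kappa_\gamma)$ conjugated by the substitution $z\to z\kappa_\alpha$. **Theorem.** Assume the zero weight condition $K_1\cdots K_n=q_1^{2k}$ and that the parameters are generic: for all integers $s,t,u,e_\gamma$ and all $\alpha\neq\beta$, one has $q_1^s\ne q_2^t$ if $s\neq0$; $K_\gamma\ne q_2^t$ for all $\gamma$; $a_\alpha/a_\beta\ne q_1^sq_2^tp^u$; $K_\alpha a_\alpha/a_\beta\ne q_1^sq_2^tp^u$; $z\ne q_1^sq_2^t\prod_\gamma K_\gamma^{e_\gamma}$. Let $1\le\alpha\le n$ and suppose that, for every $\underline k$ of total $k$, there are admissible radii for $\underline a$ and for $\underline a$ with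 $a_\alpha$ replaced by $pa_\alpha$. Then, for every choice of such radii, $$\Psi\Big|_{\substack{z\to z\kappa_\alpha\\ a_\alpha\to pa_\alpha}}=R_{\alpha+1,\alpha}(z\kappa^c_{\alpha+1})\cdots R_{n,\alpha}(z\kappa^c_n)\Big|_{a_\alpha\to pa_\alpha}\;R_{1,\alpha}(z)\,R_{2,\alpha}(z\kappa^c_2)\cdots R_{\alpha-1,\alpha}(z\kappa^c_{\alpha-1})\,\Psi .$$ Moreover $\kappa^c_{\alpha+n}=\kappa^c_\alpha$ for all $\alpha\ge1$ and all $\underline k$ of total $k$. -/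

import Mathlib

/-!
The elliptic conformal block of screened vertex operators of the `q`-deformed W-algebra of type
`A₁`, the elliptic stable envelopes, and the dynamical elliptic `R`-matrices built from them.

Sites `1, …, n` are indexed by `Fin n`, integration variables `x₁, …, x_k` by `Fin k` (both from
`0`), and the components of the block by the `κ : Fin n → ℕ` of total `k`.
-/

namespace EllipticQKZ

noncomputable section

/-! ### Special functions -/

/-- `(z; q)_∞`. -/
def qPoch (z q : ℂ) : ℂ := ∏' m : ℕ, (1 - z * q ^ m)

/-- `(z; p, q)_∞`. -/
def qPoch₂ (z p q : ℂ) : ℂ := ∏' m : ℕ × ℕ, (1 - z * p ^ m.1 * q ^ m.2)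

/-- The theta function `θ(z; q) = (z; q)_∞ (q / z; q)_∞`. -/
def theta (z q : ℂ) : ℂ := qPoch z q * qPoch (q / z) q

/-- The elliptic gamma function `Γ(z; p, q) = (pq / z; p, q)_∞ / (z; p, q)_∞`. -/
def ellGamma (z p q : ℂ) : ℂ := qPoch₂ (p * q / z) p q / qPoch₂ z p q

/-! ### Components of the block and their weights -/

/-- The tuples `(k_1, …, k_n)` of natural numbers with sum `k`. -/
abbrev Comp (n k : ℕ) : Type := {κ : Fin n → ℕ // ∑ α, κ α = k}

instance (n k : ℕ) : Fintype (Comp n k) :=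
  Fintype.subtype (Finset.piAntidiag Finset.univ k) (by simp)

/-- `c(i) = γ` for the colouring function `c` of `κ`. It is the weakly decreasing one: the first
`κ n` variables have the last colour `n`, the next `κ (n - 1)` the colour `n - 1`, and so on. -/
def HasColour {n k : ℕ} (κ : Fin n → ℕ) (i : Fin k) (γ : Fin n) : Prop :=
  ∑ β ∈ Finset.Ioi γ, κ β ≤ (i : ℕ) ∧ (i : ℕ) < ∑ β ∈ Finset.Ici γ, κ β

instance {n k : ℕ} (κ : Fin n → ℕ) (i : Fin k) (γ : Fin n) : Decidable (HasColour κ i γ) :=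
  inferInstanceAs (Decidable (_ ∧ _))

/-- `q₁ ^ (-2 ρ_i)` for `ρ_i = (k + 1) / 2 - i`, `i = 1, …, k`. -/
def rhoFactor (q₁ : ℂ) {k : ℕ} (i : Fin k) : ℂ := q₁ ^ (2 * ((i : ℤ) + 1) - (k : ℤ) - 1)

/-- `K_1 ⋯ K_γ`, which is `K_i^c` for the variables of colour `γ`. -/
def KProd {n : ℕ} (K : Fin n → ℂ) (γ : Fin n) : ℂ := ∏ β ∈ Finset.Iic γ, K β

/-- The weight factor `κ_α = K_α q₁ ^ (-2 k_α)` of the site `α`. -/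
def kappa {n : ℕ} (q₁ : ℂ) (K : Fin n → ℂ) (κ : Fin n → ℕ) (α : Fin n) : ℂ :=
  K α * q₁ ^ (-2 * (κ α : ℤ))

/-- The product `κ^c` of the first `m` weight factors, the sites being repeated with period `n`. At
`m = (β : ℕ)` it is the product of the `κ_γ` over all sites `γ < β`. -/
def kappaC {n : ℕ} [NeZero n] (q₁ : ℂ) (K : Fin n → ℂ) (κ : Fin n → ℕ) (m : ℕ) : ℂ :=
  ∏ j ∈ Finset.range m, kappa q₁ K κ (Fin.ofNat n j)

/-! ### Elliptic stable envelopes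

The sites stand in the order `1, …, n`; the stable envelope of another chamber is obtained by
listing the `a_α`, `K_α`, `k_α` in the order of that chamber. -/

/-- The constant `∏_i θ(K_{c(i)}) / θ(z q₁^{-2ρ_i} K_i^c)`. -/
def stabConst {n : ℕ} (k : ℕ) (q₁ q₂ : ℂ) (K : Fin n → ℂ) (z : ℂ) (κ : Fin n → ℕ) : ℂ :=
  ∏ γ, ∏ i : Fin k with HasColour κ i γ,
    theta (K γ) q₂⁻¹ / theta (z * rhoFactor q₁ i * KProd K γ) q₂⁻¹

/-- The function that is symmetrized in the numerator of the elliptic stable envelope. -/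
def stabSummand {n k : ℕ} (q₁ q₂ : ℂ) (K a : Fin n → ℂ) (z : ℂ) (κ : Fin n → ℕ)
    (x : Fin k → ℂ) : ℂ :=
  (∏ i, ∏ j ∈ Finset.Ioi i, theta (q₁ * x j / x i) q₂⁻¹ / theta (x j / x i) q₂⁻¹) *
    ∏ γ, ∏ i : Fin k with HasColour κ i γ,
      ((∏ β ∈ Finset.Iio γ, theta (a β / x i) q₂⁻¹) *
        theta (z * rhoFactor q₁ i * KProd K γ * a γ / x i) q₂⁻¹ *
        ∏ β ∈ Finset.Ioi γ, theta (K β * a β / x i) q₂⁻¹)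

/-- The denominator `∏_i ∏_α θ(K_α a_α / x_i)` of the elliptic stable envelope; it is symmetric in
the variables and the same for all components and all chambers. -/
def stabDenom {n k : ℕ} (q₂ : ℂ) (K a : Fin n → ℂ) (x : Fin k → ℂ) : ℂ :=
  ∏ i, ∏ β, theta (K β * a β / x i) q₂⁻¹

/-- The numerator of the elliptic stable envelope, the sum over all permutations of the
variables. -/
def stabNum {n k : ℕ} (q₁ q₂ : ℂ) (K a : Fin n → ℂ) (z : ℂ) (κ : Fin n → ℕ)
    (x : Fin k → ℂ) : ℂ :=
  ∑ σ : Equiv.Perm (Fin k), stabSummand q₁ q₂ K a z κ (x ∘ σ)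

/-! ### The elliptic conformal block -/

/-- The principal part of the integrand. -/
def principalPart {n k : ℕ} (q₁ q₂ p : ℂ) (K a : Fin n → ℂ) (x : Fin k → ℂ) : ℂ :=
  (∏ i, ∏ j ∈ Finset.univ.erase i,
      ellGamma (q₁ * x j / x i) q₂⁻¹ p / ellGamma (x j / x i) q₂⁻¹ p) *
    ∏ i, ∏ β, ellGamma (a β / x i) q₂⁻¹ p / ellGamma (K β * a β / x i) q₂⁻¹ p

/-- `r` is a tuple of admissible radii for the component `κ`: the torus `|x_i| = r_i` lies in the
domain where the radially ordered trace of the vertex operators converges. Equivalently, it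
separates the poles of `principalPart * stabSummand / stabDenom` that accumulate at `0` (for
`x_i`: the points `q₂^{-s} p^t a_β`, and `q₁ q₂^{-s} p^t x_j` with `j < i`,
and `q₁ p q₂^{-s} p^t x_j` with `i < j`) from those that accumulate at `∞`. -/
structure Admissible {n k : ℕ} (q₁ q₂ p : ℂ) (K a : Fin n → ℂ) (κ : Fin n → ℕ)
    (r : Fin k → ℝ) : Prop where
  pos : ∀ i, 0 < r i
  pair : ∀ i j, i < j → ‖q₁‖ * r i < r j ∧ ‖p * q₁‖ * r j < r i
  lower : ∀ i γ, HasColour κ i γ → ∀ β, γ ≤ β → ‖a β‖ < r i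
  lower' : ∀ i γ, HasColour κ i γ → ∀ β, β < γ → ‖p * a β‖ < r i
  upper : ∀ i γ, HasColour κ i γ → ∀ β, β ≤ γ → r i < ‖q₂ * K β * a β‖
  upper' : ∀ i γ, HasColour κ i γ → ∀ β, γ < β → ‖p‖ * r i < ‖q₂ * K β * a β‖

/-- The elliptic conformal block in the chamber `1 … n`, as a function of the dynamical parameter
`z` and of the component. It is `c / k! ∮ ∏_i (dx_i / (2πi x_i)) Φ(x) Stab(x)`, where the summand
of the symmetrization that belongs to the permutation `σ` is integrated over the torus on which
the permuted variables `x ∘ σ` have the admissible radii `r`. If all the radii coincide, then this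
is one torus for all summands. By Cauchy's theorem admissible radii all give the same value. -/
def ellipticBlock {n k : ℕ} (q₁ q₂ p : ℂ) (K a : Fin n → ℂ) (r : Comp n k → Fin k → ℝ)
    (z : ℂ) (κ : Comp n k) : ℂ :=
  stabConst k q₁ q₂ K z κ.1 / (k.factorial : ℂ) *
    ∑ σ : Equiv.Perm (Fin k),
      torusIntegral
        (fun x : Fin k → ℂ =>
          (∏ i, (2 * (Real.pi : ℂ) * Complex.I * x i)⁻¹) *
            (principalPart q₁ q₂ p K a x *
              (stabSummand q₁ q₂ K a z κ.1 (x ∘ σ) / stabDenom q₂ K a x)))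
        0 (fun i => r κ (σ⁻¹ i))

/-! ### Elliptic `R`-matrices -/

/-- The fixed point with `l` variables at the first of two sites and `m - l` at the second: the
points are `a₁ q₁^s`, `s < l`, and `a₂ q₁^s`, `s < m - l`. -/
def fixedPoint (q₁ a₁ a₂ : ℂ) (m l : ℕ) (t : Fin m) : ℂ :=
  if (t : ℕ) < m - l then a₂ * q₁ ^ (t : ℕ) else a₁ * q₁ ^ ((t : ℕ) - (m - l))

/-- The on-shell stable envelope of two sites with `m` variables in the chamber `12`: row `j` is
the component `(j, m - j)`, column `l` the fixed point with `l` variables at the first site. The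
common denominator `stabDenom` is left out. It would multiply column `l` by a number that is the
same in both chambers, so that it cancels from the `R`-matrix. -/
def onShell (q₁ q₂ a₁ a₂ K₁ K₂ : ℂ) (m : ℕ) (z : ℂ) : Matrix (Fin (m + 1)) (Fin (m + 1)) ℂ :=
  Matrix.of fun j l =>
    stabConst m q₁ q₂ ![K₁, K₂] z ![(j : ℕ), m - (j : ℕ)] *
      stabNum q₁ q₂ ![K₁, K₂] ![a₁, a₂] z ![(j : ℕ), m - (j : ℕ)] (fixedPoint q₁ a₁ a₂ m l)

/-- The elliptic `R`-matrix `R_{21} = R_{21 → 12}` of two sites in the sector of `m` variables: the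
on-shell stable envelope of the chamber `12` times the inverse of that of the chamber `21`. Rows
and columns are indexed by the number of variables at the site `1`, which for the chamber `21` is
the second one (hence `Fin.rev`). -/
def twoSiteR (q₁ q₂ a₁ a₂ K₁ K₂ : ℂ) (m : ℕ) (z : ℂ) : Matrix (Fin (m + 1)) (Fin (m + 1)) ℂ :=
  onShell q₁ q₂ a₁ a₂ K₁ K₂ m z *
    ((onShell q₁ q₂ a₂ a₁ K₂ K₁ m z).submatrix Fin.rev Fin.rev)⁻¹

/-- `R_{β,α}(w)`, the `R`-matrix from the order `βα` to the order `αβ` of two neighbouring sites,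
acting on the components of an `n`-site block with `k` variables: it keeps the `k_γ` of the other
sites and acts through `twoSiteR` in the sector of `m = k_α + k_β` variables. The dynamical
parameter of the block with `k` variables is normalized by the shift by `q₁^{k-1}`, that of the
two-site stable envelope with `m` variables by the shift by `q₁^{m-1}`; the factor `q₁^{k-m}`
converts between the two. -/
def siteR {n k : ℕ} (q₁ q₂ : ℂ) (K a : Fin n → ℂ) (β α : Fin n) (w : ℂ) (κ κ' : Comp n k) : ℂ :=
  if ∀ γ, γ ≠ α → γ ≠ β → κ.1 γ = κ'.1 γ then
    twoSiteR q₁ q₂ (a α) (a β) (K α) (K β) (κ.1 α + κ.1 β)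
      (w * q₁ ^ ((k : ℤ) - ((κ.1 α + κ.1 β : ℕ) : ℤ)))
      (Fin.ofNat _ (κ.1 α)) (Fin.ofNat _ (κ'.1 α))
  else 0

/-- `R_{β,α}(z κ^c_β)` for `β < α`, acting on vector-valued functions of `z`. The factor `κ^c_β` is
the product of the weights of the sites before `β`, which the matrix does not change. -/
def RBefore {n k : ℕ} [NeZero n] (q₁ q₂ : ℂ) (K a : Fin n → ℂ) (β α : Fin n)
    (f : ℂ → Comp n k → ℂ) (z : ℂ) (κ : Comp n k) : ℂ :=
  ∑ κ' : Comp n k, siteR q₁ q₂ K a β α (z * kappaC q₁ K κ.1 β) κ κ' * f z κ'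

/-- `R_{β,α}(z κ^c_β)` for `α < β`, acting on vector-valued functions of `z`. Here `κ^c_β` contains
`κ_α`, which the matrix changes, so that this is a dynamical (difference) operator: it is the
conjugate `T R_{β,α}(z ∏_{γ < β, γ ≠ α} κ_γ) T⁻¹` of a multiplication by a matrix by the
substitution `T : z → z κ_α`, where `T` multiplies `z` in each component by the `κ_α` of that
component. -/
def RAfter {n k : ℕ} [NeZero n] (q₁ q₂ : ℂ) (K a : Fin n → ℂ) (β α : Fin n)
    (f : ℂ → Comp n k → ℂ) (z : ℂ) (κ : Comp n k) : ℂ :=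
  ∑ κ' : Comp n k, siteR q₁ q₂ K a β α (z * kappaC q₁ K κ.1 β) κ κ' *
    f (z * kappa q₁ K κ.1 α / kappa q₁ K κ'.1 α) κ'

/-- The shift `a_α → p a_α`. -/
def pShift {n : ℕ} (p : ℂ) (α : Fin n) (a : Fin n → ℂ) : Fin n → ℂ :=
  Function.update a α (p * a α)

/-- `R_{1,α}(z) R_{2,α}(z κ^c_2) ⋯ R_{α-1,α}(z κ^c_{α-1}) f`. -/
def RBeforeProd {n k : ℕ} [NeZero n] (q₁ q₂ : ℂ) (K a : Fin n → ℂ) (α : Fin n)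
    (f : ℂ → Comp n k → ℂ) : ℂ → Comp n k → ℂ :=
  ((List.finRange n).filter (· < α)).foldr (fun β g => RBefore q₁ q₂ K a β α g) f

/-- `R_{α+1,α}(z κ^c_{α+1}) ⋯ R_{n,α}(z κ^c_n) f`. -/
def RAfterProd {n k : ℕ} [NeZero n] (q₁ q₂ : ℂ) (K a : Fin n → ℂ) (α : Fin n)
    (f : ℂ → Comp n k → ℂ) : ℂ → Comp n k → ℂ :=
  ((List.finRange n).filter (α < ·)).foldr (fun β g => RAfter q₁ q₂ K a β α g) f

end

end EllipticQKZ

open EllipticQKZ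

/-!
# The dynamical elliptic `q`-KZ equation

The factors `Γ(a_α / x) / Γ(K_α a_α / x)` and `Γ(q₁ x_j / x_i) / Γ(x_j / x_i)` absorb the theta
functions of the stable envelope by the functional equation `Γ(p x) = θ(x) Γ(x)`. After that, each
of the `k!` summands of the block contributes the same integral, and the block is a constant times
one torus integral of a product `regIntegrand` which is holomorphic on the domain of admissible
radii (`ellipticBlock_eq`). By Cauchy's theorem this integral does not depend on the admissible
radii (`blockIntegral_eq_of_admissible`), because the admissible radii form a
logarithmically convex set. The block makes sense for every order of the sites, and the equation
compares the orders in which the site `α` stands in different places.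

*Exchange of neighbouring sites.* For two sites, the stable envelopes of both chambers become, after
antisymmetrization, holomorphic functions of `m` variables with the same multipliers under `x_i ↦
q₂⁻¹ x_i`. A theta function of degree `d` in one variable with `d` inequivalent zeros vanishes,
unless the product of these zeros has the exceptional value (`eq_zero_of_theta_zeros`). Inductively,
an antisymmetric function of the above kind is determined by its values at the `m + 1` fixed points,
which consist of two `q₁`-strings starting at the two sites (`eq_zero_of_vanishing`). At the fixed
points the stable envelopes are triangular with nonzero diagonal, so the relation that defines the
`R`-matrix there is meaningful, and it holds at all points (`GenericPair.antiNum_eq_sum`). If one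
torus is admissible for all components, then symmetrizing the integrand over the variables of the
two sites turns this into a relation between the blocks for the two orders
(`blockIntegral_exchange_of_common_radius`). In general there is no such torus, but the conditions
on the radii only weaken in the family `(t q₁, K / t)` as `t → 0`, and for small `t` all radii may
be equal; the identity theorem carries the relation to `t = 1` (`blockIntegral_exchange`,
`orderedBlock_exchange`).

*Cyclicity.* If `α` is the last site, at `p a_α`, then the change of variables `x_i ↦ p x_i` for the
variables of `α` turns the integrand into the one for the order with `α` in the first place, at
`a_α`. The zero weight condition makes the shift `z ↦ z κ_α` of the dynamical parameter match
(`orderedBlock_pShift_last`).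

*The equation.* Moving `α` from its place to the end in the shifted block produces the factors
`R_{β,α}` with `β > α`; cyclicity then puts `α` into the first place of the unshifted block; and
moving it from there back to its place produces the factors with `β < α` (`ellipticBlock_pShift`).
The intermediate orders have admissible radii: the existence of admissible radii for all components
amounts to explicit inequalities between the parameters (`radiiBounds_of_admissible`,
`RadiiBounds.exists_admissible`), and the inequalities for the unshifted and the shifted parameters
together imply those for the intermediate orders (`RadiiBounds.moveSite_of_le`,
`RadiiBounds.moveSite_of_ge`).
-/

namespace EllipticQKZ

open Filter Topology

/-! ### Infinite products and theta functions -/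

section InfiniteProducts

variable {ι : Type*} {c : ι → ℂ}

lemma differentiable_tprod_one_sub_mul (hc : Summable (fun i => ‖c i‖)) :
    Differentiable ℂ (fun z : ℂ => ∏' i, (1 - z * c i)) := by
  intro z
  have key := Summable.hasProdLocallyUniformlyOn_one_add (R := ℂ) (f := fun i z => -(z * c i))
    (u := fun i => (‖z‖ + 1) * ‖c i‖) (K := Metric.ball 0 (‖z‖ + 1)) Metric.isOpen_ball
    (hc.mul_left _) (Eventually.of_forall fun i w hw => by
      rw [norm_neg, norm_mul]
      gcongr
      simpa using (mem_ball_zero_iff.1 hw).le) (fun i => by fun_prop)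
  simp only [← sub_eq_add_neg] at key
  refine (key.differentiableOn (.of_forall fun s => ?_) Metric.isOpen_ball).differentiableAt
    (Metric.isOpen_ball.mem_nhds (by simp))
  simpa [Finset.prod_fn] using DifferentiableOn.finsetProd (fun _ _ ↦ by fun_prop)

lemma multipliable_one_sub_mul (hc : Summable (fun i => ‖c i‖)) (z : ℂ) :
    Multipliable (fun i => 1 - z * c i) := by
  simp only [sub_eq_add_neg]
  exact multipliable_one_add_of_summable (by simpa using hc.mul_left ‖z‖)

lemma tprod_one_sub_mul_ne_zero (hc : Summable (fun i => ‖c i‖)) {z : ℂ}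
    (h : ∀ i, z * c i ≠ 1) : ∏' i, (1 - z * c i) ≠ 0 := by
  simp only [sub_eq_add_neg]
  refine tprod_one_add_ne_zero_of_summable (fun i => ?_) (by simpa using hc.mul_left ‖z‖)
  rw [← sub_eq_add_neg, sub_ne_zero]
  exact (h i).symm

end InfiniteProducts

section QPochhammer

variable {q : ℂ}

lemma summable_norm_pow (hq : ‖q‖ < 1) : Summable (fun m : ℕ => ‖q ^ m‖) := by
  simpa using summable_geometric_of_lt_one (norm_nonneg q) hq

lemma differentiable_qPoch (hq : ‖q‖ < 1) : Differentiable ℂ (fun z => qPoch z q) :=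
  differentiable_tprod_one_sub_mul (summable_norm_pow hq)

lemma qPoch_ne_zero (hq : ‖q‖ < 1) {z : ℂ} (h : ∀ m : ℕ, z * q ^ m ≠ 1) : qPoch z q ≠ 0 :=
  tprod_one_sub_mul_ne_zero (summable_norm_pow hq) h

lemma qPoch_eq (hq : ‖q‖ < 1) (z : ℂ) : qPoch z q = (1 - z) * qPoch (q * z) q := by
  have h := (multipliable_one_sub_mul (summable_norm_pow hq) (q * z))
  rw [qPoch, tprod_eq_zero_mul' (f := fun m : ℕ => 1 - z * q ^ m)]
  · simp only [pow_zero, mul_one, qPoch]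
    congr 1
    exact tprod_congr fun m => by ring
  · exact h.congr fun m => by ring

lemma qPoch_one (hq : ‖q‖ < 1) : qPoch 1 q = 0 := by simp [qPoch_eq hq 1]

lemma differentiableAt_theta (hq : ‖q‖ < 1) {z : ℂ} (hz : z ≠ 0) :
    DifferentiableAt ℂ (fun z => theta z q) z := by
  have h := differentiable_qPoch hq
  unfold theta
  exact (h z).mul ((h (q / z)).comp z (f := fun z => q / z) (by fun_prop (disch := assumption)))

lemma theta_one (hq : ‖q‖ < 1) : theta 1 q = 0 := by simp [theta, qPoch_one hq]

/-- The functional equation `θ(1 / z) = -θ(z) / z`. -/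
lemma theta_inv (hq : ‖q‖ < 1) {z : ℂ} (hz : z ≠ 0) : theta z⁻¹ q = -z⁻¹ * theta z q := by
  unfold theta
  rw [qPoch_eq hq z, qPoch_eq hq z⁻¹]
  simp only [div_eq_mul_inv, inv_inv]
  field_simp
  ring

/-- The functional equation `θ(qz) = -θ(z) / z`. -/
lemma theta_mul (hq : ‖q‖ < 1) (hq0 : q ≠ 0) {z : ℂ} (hz : z ≠ 0) :
    theta (q * z) q = -z⁻¹ * theta z q := by
  have h : q / (q * z) = z⁻¹ := by field_simp
  have h2 : q * z⁻¹ = q / z := by field_simp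
  unfold theta
  rw [qPoch_eq hq z, h, qPoch_eq hq z⁻¹, h2]
  field_simp
  ring

lemma theta_mul_zpow_eq_zero_iff (hq : ‖q‖ < 1) (hq0 : q ≠ 0) {z : ℂ} (hz : z ≠ 0) (n : ℤ) :
    theta (q ^ n * z) q = 0 ↔ theta z q = 0 := by
  induction n with
  | zero => simp
  | succ i ih =>
    rw [add_comm, zpow_add₀ hq0, zpow_one, mul_assoc,
      theta_mul hq hq0 (mul_ne_zero (zpow_ne_zero _ hq0) hz), mul_eq_zero, ih]
    simp [hz, hq0]
  | pred i ih =>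
    have hz' := zpow_ne_zero (-(i : ℤ) - 1) hq0
    rw [← ih, show (-(i : ℤ)) = 1 + (-i - 1) by ring, zpow_add₀ hq0, zpow_one, mul_assoc,
      theta_mul hq hq0 (mul_ne_zero (zpow_ne_zero _ hq0) hz), mul_eq_zero,
      show (1 + (-(i : ℤ) - 1) - 1) = -i - 1 by ring]
    simp [hz, hz']

/-- The zeros of `θ` in the punctured plane are the powers of `q`. -/
lemma theta_eq_zero_iff (hq : ‖q‖ < 1) (hq0 : q ≠ 0) {z : ℂ} (hz : z ≠ 0) :
    theta z q = 0 ↔ ∃ n : ℤ, z = q ^ n := by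
  constructor
  · intro h
    by_contra! hne
    refine mul_ne_zero (qPoch_ne_zero hq fun m hm => ?_) (qPoch_ne_zero hq fun m hm => ?_) h
    · exact hne (-m) (by rw [zpow_neg, zpow_natCast]; exact eq_inv_of_mul_eq_one_left hm)
    · refine hne (m + 1) ?_
      rw [zpow_add₀ hq0, zpow_natCast, zpow_one]
      field_simp at hm
      rw [← hm]; ring
  · rintro ⟨n, rfl⟩
    have := (theta_mul_zpow_eq_zero_iff hq hq0 one_ne_zero n).2 (theta_one hq)
    simpa using this

end QPochhammer

section DoublePochhammer

variable {q p : ℂ}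

lemma summable_norm_pow_mul_pow (hq : ‖q‖ < 1) (hp : ‖p‖ < 1) :
    Summable (fun m : ℕ × ℕ => ‖q ^ m.1 * p ^ m.2‖) := by
  simp only [norm_mul]
  exact Summable.mul_of_nonneg (summable_norm_pow hq) (summable_norm_pow hp)
    (fun _ => norm_nonneg _) (fun _ => norm_nonneg _)

lemma qPoch₂_eq_tprod (z : ℂ) :
    qPoch₂ z q p = ∏' m : ℕ × ℕ, (1 - z * (q ^ m.1 * p ^ m.2)) := by
  simp only [qPoch₂, mul_assoc]

lemma differentiable_qPoch₂ (hq : ‖q‖ < 1) (hp : ‖p‖ < 1) :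
    Differentiable ℂ (fun z => qPoch₂ z q p) := by
  simp only [qPoch₂_eq_tprod]
  exact differentiable_tprod_one_sub_mul (summable_norm_pow_mul_pow hq hp)

lemma qPoch₂_ne_zero (hq : ‖q‖ < 1) (hp : ‖p‖ < 1) {z : ℂ}
    (h : ∀ s t : ℕ, z * (q ^ s * p ^ t) ≠ 1) : qPoch₂ z q p ≠ 0 := by
  rw [qPoch₂_eq_tprod]
  exact tprod_one_sub_mul_ne_zero (summable_norm_pow_mul_pow hq hp) fun i => h i.1 i.2

lemma qPoch₂_ne_zero_of_norm_lt (hq : ‖q‖ < 1) (hp : ‖p‖ < 1) {z : ℂ} (hz : ‖z‖ < 1) :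
    qPoch₂ z q p ≠ 0 := by
  refine qPoch₂_ne_zero hq hp fun s t h => ?_
  have h1 : ‖q‖ ^ s ≤ 1 := pow_le_one₀ (norm_nonneg _) hq.le
  have h2 : ‖p‖ ^ t ≤ 1 := pow_le_one₀ (norm_nonneg _) hp.le
  have h3 : ‖z * (q ^ s * p ^ t)‖ < 1 := by
    rw [norm_mul, norm_mul, norm_pow, norm_pow]
    calc ‖z‖ * (‖q‖ ^ s * ‖p‖ ^ t) ≤ ‖z‖ * (1 * 1) := by gcongr
      _ < 1 := by simpa
  rw [h] at h3
  simp at h3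

lemma qPoch₂_swap (z : ℂ) : qPoch₂ z p q = qPoch₂ z q p := by
  rw [qPoch₂, qPoch₂, ← (Equiv.prodComm ℕ ℕ).tprod_eq]
  exact tprod_congr fun m => by simp only [Equiv.prodComm_apply, Prod.fst_swap, Prod.snd_swap]; ring

lemma hasProd_qPoch (hq : ‖q‖ < 1) (hp : ‖p‖ < 1) (z : ℂ) :
    HasProd (fun m : ℕ => qPoch (z * p ^ m) q) (qPoch₂ z q p) := by
  rw [← qPoch₂_swap, qPoch₂_eq_tprod]
  refine (multipliable_one_sub_mul (summable_norm_pow_mul_pow hp hq) z).hasProd.prod_fiberwise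
    fun b => ?_
  have := (multipliable_one_sub_mul (summable_norm_pow hq) (z * p ^ b)).hasProd
  simpa only [mul_assoc, qPoch] using this

lemma qPoch₂_eq_snd (hq : ‖q‖ < 1) (hp : ‖p‖ < 1) (z : ℂ) :
    qPoch₂ z q p = qPoch z q * qPoch₂ (p * z) q p := by
  have h : ∀ m : ℕ, qPoch (p * z * p ^ m) q = qPoch (z * p ^ (m + 1)) q :=
    fun m => by rw [pow_succ']; ring_nf
  have h2 := (hasProd_qPoch hq hp (p * z)).congr_fun fun m => (h m).symm
  have h3 := h2.zero_mul (f := fun m => qPoch (z * p ^ m) q)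
  simp only [pow_zero, mul_one] at h3
  exact (hasProd_qPoch hq hp z).unique h3

lemma qPoch₂_eq_fst (hq : ‖q‖ < 1) (hp : ‖p‖ < 1) (z : ℂ) :
    qPoch₂ z q p = qPoch z p * qPoch₂ (q * z) q p := by
  rw [← qPoch₂_swap, qPoch₂_eq_snd hp hq, qPoch₂_swap]

/-- The functional equation `Γ(pz) = θ(z; q) Γ(z)`, away from the poles of `Γ(z)` which cancel
against zeros of the theta function. -/
lemma ellGamma_mul (hq : ‖q‖ < 1) (hp : ‖p‖ < 1) (hp0 : p ≠ 0) {z : ℂ} (hz : z ≠ 0)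
    (h : qPoch z q ≠ 0) : ellGamma (p * z) q p = theta z q * ellGamma z q p := by
  have h1 : q * p / (p * z) = q / z := by field_simp
  have h2 : q * p / z = p * (q / z) := by ring
  rw [ellGamma, ellGamma, theta, h1, h2, qPoch₂_eq_snd hq hp z, qPoch₂_eq_snd hq hp (q / z)]
  field_simp

lemma differentiableAt_ellGamma (hq : ‖q‖ < 1) (hp : ‖p‖ < 1) {z : ℂ} (hz : z ≠ 0)
    (h : qPoch₂ z q p ≠ 0) : DifferentiableAt ℂ (fun z => ellGamma z q p) z := by
  have hd := differentiable_qPoch₂ hq hp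
  unfold ellGamma
  exact ((hd (q * p / z)).comp z (f := fun z => q * p / z)
    (by fun_prop (disch := assumption))).div (hd z) h

lemma differentiableAt_inv_ellGamma (hq : ‖q‖ < 1) (hp : ‖p‖ < 1) {z : ℂ} (hz : z ≠ 0)
    (h : qPoch₂ (q * p / z) q p ≠ 0) :
    DifferentiableAt ℂ (fun z => (ellGamma z q p)⁻¹) z := by
  have hd := differentiable_qPoch₂ hq hp
  simp only [ellGamma, inv_div]
  exact (hd z).div ((hd (q * p / z)).comp z (f := fun z => q * p / z)
    (by fun_prop (disch := assumption))) h

/-- The reflection formula `1 / (Γ(pz) Γ(1/z)) = θ(1/z; p)`. -/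
lemma theta_eq_inv_ellGamma_mul (hq : ‖q‖ < 1) (hp : ‖p‖ < 1) (hq0 : q ≠ 0) (hp0 : p ≠ 0) {z : ℂ}
    (hz : z ≠ 0) (h1 : qPoch₂ (q / z) q p ≠ 0) (h2 : qPoch₂ (q * p * z) q p ≠ 0) :
    theta z⁻¹ p = (ellGamma (p * z) q p * ellGamma z⁻¹ q p)⁻¹ := by
  have e1 : q * p / (p * z) = q / z := by field_simp
  have e2 : q * p / z⁻¹ = q * p * z := by field_simp
  have e3 : p / z⁻¹ = p * z := by field_simp
  have e4 : q * z⁻¹ = q / z := by field_simp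
  have e5 : q * (p * z) = q * p * z := by ring
  rw [ellGamma, ellGamma, theta, e1, e2, e3, qPoch₂_eq_fst hq hp z⁻¹, qPoch₂_eq_fst hq hp (p * z),
    e4, e5]
  generalize qPoch₂ (q / z) q p = A at *
  generalize qPoch₂ (q * p * z) q p = B at *
  field_simp

end DoublePochhammer


/-! ### Theta functions of one variable are determined by their zeros -/

section OneVariable

variable {q : ℂ}

/-- A holomorphic function on the punctured plane that is multiplied by `μ` under `x ↦ q x` vanishes
unless `μ` is a power of `q`: composed with the exponential function and multiplied by a
suitable `exp (-σ u)`, it becomes bounded and entire. -/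
lemma eq_zero_of_mul_periodic (hq : ‖q‖ < 1) (hq0 : q ≠ 0) {g : ℂ → ℂ} {μ : ℂ}
    (hg : ∀ x ≠ 0, DifferentiableAt ℂ g x) (hper : ∀ x ≠ 0, g (q * x) = μ * g x)
    (hμ : ∀ n : ℤ, μ ≠ q ^ n) {x : ℂ} (hx : x ≠ 0) : g x = 0 := by
  rcases eq_or_ne μ 0 with rfl | hμ0
  · have := hper (q⁻¹ * x) (by simp [hq0, hx])
    simpa [hq0] using this
  have hqn : 0 < ‖q‖ := norm_pos_iff.2 hq0
  have hμn : 0 < ‖μ‖ := norm_pos_iff.2 hμ0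
  set σ : ℝ := Real.log ‖μ‖ / Real.log ‖q‖ with hσ
  have hlq : Real.log ‖q‖ < 0 := Real.log_neg hqn hq
  have hσμ : ‖q‖ ^ σ = ‖μ‖ := by
    rw [Real.rpow_def_of_pos hqn, hσ, mul_div_cancel₀ _ hlq.ne, Real.exp_log hμn]
  -- `|g x| |x| ^ (-σ)` is invariant under `x ↦ q x`, hence bounded by its values on an annulus
  set φ : ℂ → ℝ := fun x => ‖g x‖ * ‖x‖ ^ (-σ) with hφ
  have hφper : ∀ x ≠ 0, φ (q * x) = φ x := fun x hx => by
    simp only [hφ]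
    rw [hper x hx, norm_mul, norm_mul, Real.mul_rpow hqn.le (norm_nonneg _), Real.rpow_neg hqn.le,
      hσμ]
    field_simp
  have hφz : ∀ (n : ℤ), ∀ x ≠ 0, φ (q ^ n * x) = φ x := by
    intro n
    induction n with
    | zero => simp
    | succ i ih =>
      intro x hx
      rw [add_comm, zpow_add₀ hq0, zpow_one, mul_assoc,
        hφper _ (mul_ne_zero (zpow_ne_zero _ hq0) hx), ih x hx]
    | pred i ih =>
      intro x hx
      rw [← ih x hx, show (-(i : ℤ)) = 1 + (-i - 1) by ring, zpow_add₀ hq0, zpow_one, mul_assoc,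
        hφper _ (mul_ne_zero (zpow_ne_zero _ hq0) hx)]
      congr 2
      ring_nf
  obtain ⟨C, hC⟩ : ∃ C, ∀ x ≠ 0, φ x ≤ C := by
    set A : Set ℂ := Metric.closedBall 0 1 ∩ {x | ‖q‖ ≤ ‖x‖} with hA
    have hcpt : IsCompact A := (isCompact_closedBall _ _).inter_right
      (isClosed_le continuous_const continuous_norm)
    have hA0 : ∀ x ∈ A, x ≠ 0 := by
      rintro x ⟨-, h2⟩ rfl
      simp only [Set.mem_ofPred_eq, norm_zero] at h2
      linarith
    have hcont : ContinuousOn φ A := fun x hx => by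
      have h0 := hA0 x hx
      refine ContinuousAt.continuousWithinAt ?_
      exact ((hg x h0).continuousAt.norm).mul
        (continuous_norm.continuousAt.rpow_const (Or.inl (norm_ne_zero_iff.2 h0)))
    obtain ⟨C, hC⟩ := hcpt.bddAbove_image hcont
    refine ⟨C, fun x hx => ?_⟩
    obtain ⟨n, hn1, hn2⟩ := exists_mem_Ioc_zpow (norm_pos_iff.2 hx) ((one_lt_inv₀ hqn).2 hq)
    rw [← hφz (n + 1) x hx]
    refine hC ⟨_, ⟨?_, ?_⟩, rfl⟩
    · rw [mem_closedBall_zero_iff, norm_mul, norm_zpow]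
      calc ‖q‖ ^ (n + 1) * ‖x‖ ≤ ‖q‖ ^ (n + 1) * ‖q‖⁻¹ ^ (n + 1) := by gcongr
        _ = 1 := by rw [← mul_zpow, mul_inv_cancel₀ hqn.ne', one_zpow]
    · rw [Set.mem_ofPred_eq, norm_mul, norm_zpow]
      calc ‖q‖ = ‖q‖ ^ (n + 1) * ‖q‖⁻¹ ^ n := by
            rw [inv_zpow, ← zpow_neg, ← zpow_add₀ hqn.ne']; simp
        _ ≤ ‖q‖ ^ (n + 1) * ‖x‖ := by gcongr
  set H : ℂ → ℂ := fun u => g (Complex.exp u) * Complex.exp (-σ * u) with hH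
  have hHd : Differentiable ℂ H := fun u => by
    refine DifferentiableAt.mul ?_ (by fun_prop)
    exact (hg _ (Complex.exp_ne_zero u)).comp u (f := Complex.exp) (by fun_prop)
  have hHb : Bornology.IsBounded (Set.range H) := by
    refine (Metric.isBounded_closedBall (x := (0 : ℂ)) (r := C)).subset ?_
    rintro _ ⟨u, rfl⟩
    rw [mem_closedBall_zero_iff]
    refine le_trans (le_of_eq ?_) (hC _ (Complex.exp_ne_zero u))
    simp only [hH, hφ, norm_mul, Complex.norm_exp]
    rw [← Real.exp_mul]
    congr 2
    simp [mul_comm]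
  have hconst : ∀ u v, H u = H v := fun u v => hHd.apply_eq_apply_of_bounded hHb u v
  have hgH : ∀ u, g (Complex.exp u) = H 0 * Complex.exp (σ * u) := fun u => by
    rw [← hconst u 0]
    simp only [hH]
    rw [mul_assoc, ← Complex.exp_add]
    simp
  by_contra hne
  have hH0 : H 0 ≠ 0 := by
    intro h0
    have := hgH (Complex.log x)
    rw [Complex.exp_log hx, h0, zero_mul] at this
    exact hne this
  -- `2πi`-periodicity makes the exponent an integer, and then `μ` is a power of `q`
  have h1 := hgH (2 * Real.pi * Complex.I)
  have h2 := hgH 0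
  rw [Complex.exp_two_pi_mul_I] at h1
  rw [Complex.exp_zero, h1, mul_zero, Complex.exp_zero] at h2
  have h3 := mul_left_cancel₀ hH0 h2
  obtain ⟨n, hn⟩ := Complex.exp_eq_one_iff.1 h3
  have hσn : (σ : ℂ) = n := by
    have h4 : (2 * Real.pi * Complex.I : ℂ) ≠ 0 := Complex.two_pi_I_ne_zero
    exact mul_right_cancel₀ h4 hn
  have h5 := hgH (Complex.log q + 0)
  have h6 := hper 1 one_ne_zero
  have h7 := hgH 0
  rw [add_zero, Complex.exp_log hq0, hσn, Complex.exp_int_mul, Complex.exp_log hq0] at h5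
  rw [mul_one, h5] at h6
  rw [Complex.exp_zero, mul_zero, Complex.exp_zero, mul_one] at h7
  rw [h7] at h6
  exact hμ n (mul_right_cancel₀ hH0 (by rw [← h6]; ring))

/-- The zeros of the theta function are simple. -/
lemma deriv_theta_ne_zero (hq : ‖q‖ < 1) (hq0 : q ≠ 0) (n : ℤ) :
    deriv (fun z => theta z q) (q ^ n) ≠ 0 := by
  have hbase : deriv (fun z => theta z q) 1 ≠ 0 := by
    have h1 : (fun z => theta z q) = fun z => (1 - z) * (qPoch (q * z) q * qPoch (q / z) q) := by
      funext z
      rw [theta, qPoch_eq hq z, mul_assoc]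
    have hd := differentiable_qPoch hq
    have h2 : DifferentiableAt ℂ (fun z => qPoch (q * z) q * qPoch (q / z) q) 1 :=
      ((hd _).comp (1 : ℂ) (f := fun z => q * z) (by fun_prop)).mul
        ((hd _).comp (1 : ℂ) (f := fun z => q / z) (by fun_prop (disch := simp)))
    rw [h1, deriv_fun_mul (by fun_prop) h2]
    have h3 : qPoch q q ≠ 0 := qPoch_ne_zero hq fun m hm => by
      rw [← pow_succ'] at hm
      have := congrArg norm hm
      rw [norm_pow, norm_one] at this
      exact (pow_lt_one₀ (norm_nonneg _) hq (by simp)).ne this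
    simp [h3]
  have step : ∀ z : ℂ, z ≠ 0 → theta z q = 0 →
      q * deriv (fun z => theta z q) (q * z) = -z⁻¹ * deriv (fun z => theta z q) z := by
    intro z hz hz0
    have h1 : (fun w => theta (q * w) q) =ᶠ[𝓝 z] fun w => -w⁻¹ * theta w q := by
      filter_upwards [isOpen_ne.mem_nhds hz] with w hw
      exact theta_mul hq hq0 hw
    have h2 := h1.deriv_eq
    have h3 : deriv (fun w => theta (q * w) q) z = q * deriv (fun z => theta z q) (q * z) :=
      deriv_comp_mul_left q (fun z => theta z q) z
    rw [h3, deriv_fun_mul (by fun_prop (disch := assumption)) (differentiableAt_theta hq hz),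
      hz0] at h2
    simpa using h2
  have hzero : ∀ n : ℤ, theta (q ^ n) q = 0 := fun n =>
    (theta_eq_zero_iff hq hq0 (zpow_ne_zero _ hq0)).2 ⟨n, rfl⟩
  induction n with
  | zero => simpa using hbase
  | succ i ih =>
    have h := step (q ^ (i : ℤ)) (zpow_ne_zero _ hq0) (hzero _)
    rw [add_comm, zpow_add₀ hq0, zpow_one]
    intro h0
    rw [h0, mul_zero, eq_comm, mul_eq_zero] at h
    simp [hq0] at h
    exact ih (by simpa using h)
  | pred i ih =>
    have h := step (q ^ (-(i : ℤ) - 1)) (zpow_ne_zero _ hq0) (hzero _)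
    rw [show q * q ^ (-(i : ℤ) - 1) = q ^ (-(i : ℤ)) by
      rw [zpow_sub₀ hq0]; field_simp] at h
    intro h0
    rw [h0, mul_zero, mul_eq_zero] at h
    exact h.elim hq0 ih

/-- Division by a theta function at one of its zeros. -/
lemma exists_eq_theta_mul (hq : ‖q‖ < 1) (hq0 : q ≠ 0) {f : ℂ → ℂ} {u : ℂ} (hu : u ≠ 0)
    (hf : ∀ x ≠ 0, DifferentiableAt ℂ f x) (hz : ∀ n : ℤ, f (q ^ n * u) = 0) :
    ∃ g : ℂ → ℂ, (∀ x ≠ 0, DifferentiableAt ℂ g x) ∧ ∀ x ≠ 0, f x = theta (u / x) q * g x := by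
  classical
  set ϑ : ℂ → ℂ := fun x => theta (u / x) q with hϑ
  have hϑd : ∀ x ≠ 0, DifferentiableAt ℂ ϑ x := fun x hx =>
    (differentiableAt_theta hq (div_ne_zero hu hx)).comp x (f := fun x => u / x)
      (by fun_prop (disch := assumption))
  have hϑz : ∀ x ≠ 0, ϑ x = 0 → f x = 0 ∧ deriv ϑ x ≠ 0 := fun x hx h => by
    obtain ⟨n, hn⟩ := (theta_eq_zero_iff hq hq0 (div_ne_zero hu hx)).1 h
    have hxn : x = q ^ (-n) * u := by
      rw [zpow_neg, ← hn]; field_simp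
    refine ⟨by rw [hxn]; exact hz _, ?_⟩
    have h1 : deriv ϑ x = deriv (fun z => theta z q) (u / x) * deriv (fun x => u / x) x :=
      deriv_comp x (h₂ := fun z => theta z q) (h := fun x => u / x)
        (differentiableAt_theta hq (div_ne_zero hu hx)) (by fun_prop (disch := assumption))
    rw [h1, hn]
    refine mul_ne_zero (deriv_theta_ne_zero hq hq0 n) ?_
    simp [div_eq_mul_inv, hu, hx]
  refine ⟨fun x => if ϑ x = 0 then deriv f x / deriv ϑ x else f x / ϑ x, fun x hx => ?_,
    fun x hx => ?_⟩
  · by_cases h0 : ϑ x = 0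
    · obtain ⟨hfx, hdx⟩ := hϑz x hx h0
      have hev : ∀ {h : ℂ → ℂ}, (∀ y ≠ 0, DifferentiableAt ℂ h y) →
          DifferentiableAt ℂ (dslope h x) x := fun {h} hh =>
        ((Complex.differentiableOn_dslope (isOpen_ne.mem_nhds hx)).2
          (fun y hy => (hh y hy).differentiableWithinAt) : DifferentiableOn ℂ (dslope h x) {0}ᶜ)
            |>.differentiableAt (isOpen_ne.mem_nhds hx)
      have hd0 : dslope ϑ x x ≠ 0 := by rwa [dslope_same]
      refine ((hev hf).div (hev hϑd) hd0).congr_of_eventuallyEq ?_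
      filter_upwards [(hev hϑd).continuousAt.eventually_ne hd0] with y hy
      rcases eq_or_ne y x with rfl | hyx
      · simp [h0, dslope_same]
      · rw [dslope_of_ne _ hyx, slope_def_field, h0, sub_zero] at hy
        have hy0 : ϑ y ≠ 0 := fun h => hy (by simp [h])
        simp only [if_neg hy0, Pi.div_apply, dslope_of_ne _ hyx, slope_def_field, h0, hfx, sub_zero]
        have : y - x ≠ 0 := sub_ne_zero.2 hyx
        field_simp
    · refine ((hf x hx).div (hϑd x hx) h0).congr_of_eventuallyEq ?_
      filter_upwards [(hϑd x hx).continuousAt.eventually_ne h0] with y hy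
      simp [hy]
  · simp only
    split_ifs with h0
    · rw [(hϑz x hx h0).1]
      change (0 : ℂ) = ϑ x * _
      rw [h0, zero_mul]
    · change f x = ϑ x * _
      field_simp

/-- A theta function with as many inequivalent zeros as its degree, whose product is not the one
prescribed by its multiplier, vanishes identically. -/
theorem eq_zero_of_theta_zeros (hq : ‖q‖ < 1) (hq0 : q ≠ 0) (l : List ℂ) :
    ∀ {f : ℂ → ℂ} {μ : ℂ}, μ ≠ 0 → (∀ x ≠ 0, DifferentiableAt ℂ f x) →
    (∀ x ≠ 0, f (q * x) = μ * x⁻¹ ^ l.length * f x) → (∀ u ∈ l, u ≠ 0) → (∀ u ∈ l, f u = 0) →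
    l.Pairwise (fun u v => ∀ n : ℤ, u ≠ q ^ n * v) →
    (∀ n : ℤ, μ ≠ q ^ n * (l.map fun u => -u).prod) → ∀ {x : ℂ}, x ≠ 0 → f x = 0 := by
  induction l with
  | nil =>
    intro f μ _ hf hper _ _ _ hμ x hx
    exact eq_zero_of_mul_periodic hq hq0 hf (by simpa using hper) (by simpa using hμ) hx
  | cons u l ih =>
    intro f μ hμ0 hf hper hne hzero hpw hμ x hx
    rw [List.pairwise_cons] at hpw
    simp only [List.mem_cons, forall_eq_or_imp] at hne hzero
    simp only [List.length_cons, List.map_cons, List.prod_cons] at hper hμ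
    have hu := hne.1
    have horb : ∀ n : ℤ, f (q ^ n * u) = 0 := by
      intro n
      induction n with
      | zero => simpa using hzero.1
      | succ i ih =>
        rw [add_comm, zpow_add₀ hq0, zpow_one, mul_assoc,
          hper _ (mul_ne_zero (zpow_ne_zero _ hq0) hu), ih, mul_zero]
      | pred i ih =>
        have hx0 : q ^ (-(i : ℤ) - 1) * u ≠ 0 := mul_ne_zero (zpow_ne_zero _ hq0) hu
        have h := hper _ hx0
        rw [← mul_assoc, show q * q ^ (-(i : ℤ) - 1) = q ^ (-(i : ℤ)) by
          rw [zpow_sub₀ hq0]; field_simp, ih, eq_comm, mul_eq_zero, mul_eq_zero] at h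
        rcases h with (h | h) | h
        · exact absurd h hμ0
        · exact absurd h (pow_ne_zero _ (inv_ne_zero hx0))
        · exact h
    obtain ⟨g, hg, hfg⟩ := exists_eq_theta_mul hq hq0 hu hf horb
    rw [hfg x hx, ih (f := g) (μ := μ * (-(q / u)))
      (mul_ne_zero hμ0 (neg_ne_zero.2 (div_ne_zero hq0 hu))) hg ?_ hne.2 ?_ hpw.2 ?_ hx, mul_zero]
    · have hD : Dense {x : ℂ | theta (u / x) q = 0 ∧ x ≠ 0}ᶜ := by
        refine Set.Countable.dense_compl ℝ ((Set.countable_range fun n : ℤ => u / q ^ n).mono ?_)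
        rintro y ⟨hy, hy0⟩
        obtain ⟨n, hn⟩ := (theta_eq_zero_iff hq hq0 (div_ne_zero hu hy0)).1 hy
        exact ⟨n, by simp only [← hn]; field_simp⟩
      intro y hy
      -- the functional equation of `g` holds off the zeros of the theta function, hence everywhere
      have hcl : y ∈ closure ({x : ℂ | theta (u / x) q = 0 ∧ x ≠ 0}ᶜ ∩ {x | x ≠ 0}) :=
        Set.inter_comm _ _ ▸ hD.open_subset_closure_inter isOpen_ne hy
      rw [mem_closure_iff_nhdsWithin_neBot] at hcl
      refine tendsto_nhds_unique_of_eventuallyEq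
        (l := 𝓝[{x : ℂ | theta (u / x) q = 0 ∧ x ≠ 0}ᶜ ∩ {x | x ≠ 0}] y) (f := fun x => g (q * x))
        (g := fun x => μ * (-(q / u)) * x⁻¹ ^ l.length * g x)
        (ContinuousAt.tendsto ?_ |>.mono_left nhdsWithin_le_nhds)
        (ContinuousAt.tendsto ?_ |>.mono_left nhdsWithin_le_nhds)
        (eventually_mem_nhdsWithin.mono ?_)
      · exact ((hg _ (mul_ne_zero hq0 hy)).comp y (f := fun y => q * y) (by fun_prop)).continuousAt
      · refine ContinuousAt.mul ?_ (hg y hy).continuousAt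
        fun_prop (disch := assumption)
      · rintro w ⟨hw1, hw0⟩
        have hw0 : w ≠ 0 := hw0
        have hw2 : theta (u / w) q ≠ 0 := fun h => hw1 ⟨h, hw0⟩
        have h1 := hper w hw0
        rw [hfg _ (mul_ne_zero hq0 hw0), hfg w hw0] at h1
        have h2 := theta_mul hq hq0 (z := u / (q * w)) (by simp [hu, hq0, hw0])
        rw [show q * (u / (q * w)) = u / w by field_simp] at h2
        rw [h2] at h1 hw2
        have h3 : theta (u / (q * w)) q ≠ 0 := right_ne_zero_of_mul hw2
        refine mul_left_cancel₀ h3 ?_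
        rw [h1, pow_succ]
        field_simp
    · intro v hv
      have h1 := hzero.2 v hv
      have hv0 := hne.2 v hv
      rw [hfg v hv0, mul_eq_zero] at h1
      refine h1.resolve_left fun h => ?_
      obtain ⟨n, hn⟩ := (theta_eq_zero_iff hq hq0 (div_ne_zero hu hv0)).1 h
      exact hpw.1 v hv n (by rw [← hn]; field_simp)
    · intro n h
      refine hμ (n - 1) ?_
      rw [zpow_sub₀ hq0, zpow_one]
      have : μ = (μ * -(q / u)) * (-(u / q)) := by field_simp
      rw [this, h]
      field_simp

end OneVariable


/-! ### The colouring function -/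

section Colour

variable {n k : ℕ} {κ : Fin n → ℕ}

/-- The colouring function exists: the colour of `i` is the last site `γ` for which the sites from
`γ` on carry more than `i` variables. -/
lemma exists_colour (hκ : ∑ γ, κ γ = k) :
    ∃ c : Fin k → Fin n, ∀ i γ, HasColour κ i γ ↔ γ = c i := by
  have huniq : ∀ (i : Fin k) (γ γ' : Fin n), γ < γ' → HasColour κ i γ → HasColour κ i γ' →
      False := by
    intro i γ γ' hlt h h'
    have : ∑ β ∈ Finset.Ici γ', κ β ≤ ∑ β ∈ Finset.Ioi γ, κ β :=
      Finset.sum_le_sum_of_subset fun β hβ =>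
        Finset.mem_Ioi.2 (hlt.trans_le (Finset.mem_Ici.1 hβ))
    exact absurd (h'.2.trans_le (this.trans h.1)) (lt_irrefl _)
  have hex : ∀ i : Fin k, ∃ γ, HasColour κ i γ := by
    intro i
    have hn : 0 < n := by
      rcases Nat.eq_zero_or_pos n with rfl | h
      · have := i.2
        simp at hκ
        omega
      · exact h
    have : NeZero n := ⟨hn.ne'⟩
    set S : Finset (Fin n) := Finset.univ.filter fun γ => (i : ℕ) < ∑ β ∈ Finset.Ici γ, κ β with hS
    have hne : S.Nonempty := ⟨0, by
      have : Finset.Ici (0 : Fin n) = Finset.univ := by ext; simp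
      simp [hS, this, hκ]⟩
    refine ⟨S.max' hne, ?_, (Finset.mem_filter.1 (S.max'_mem hne)).2⟩
    by_contra! hlt
    have hpos : 0 < ∑ β ∈ Finset.Ioi (S.max' hne), κ β := by omega
    obtain ⟨δ, hδ, -⟩ := Finset.exists_ne_zero_of_sum_ne_zero hpos.ne'
    rw [Finset.mem_Ioi] at hδ
    have hsucc : Finset.Ici (Order.succ (S.max' hne)) = Finset.Ioi (S.max' hne) := by
      ext β
      rw [Finset.mem_Ici, Finset.mem_Ioi, Order.succ_le_iff_of_not_isMax
        (fun h => absurd (h hδ.le) (not_le.2 hδ))]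
    have hmem : Order.succ (S.max' hne) ∈ S := by
      simp only [hS, Finset.mem_filter, Finset.mem_univ, true_and]
      rw [hsucc]
      exact hlt
    exact absurd (S.le_max' _ hmem)
      (not_le.2 (Order.lt_succ_of_not_isMax fun h => absurd (h hδ.le) (not_le.2 hδ)))
  choose c hc using hex
  refine ⟨c, fun i γ => ⟨fun h => ?_, fun h => h ▸ hc i⟩⟩
  rcases lt_trichotomy γ (c i) with hlt | heq | hlt
  · exact (huniq i _ _ hlt h (hc i)).elim
  · exact heq
  · exact (huniq i _ _ hlt (hc i) h).elim

lemma prod_prod_hasColour {M : Type*} [CommMonoid M] {c : Fin k → Fin n}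
    (hc : ∀ i γ, HasColour κ i γ ↔ γ = c i) (h : Fin n → Fin k → M) :
    ∏ γ, ∏ i : Fin k with HasColour κ i γ, h γ i = ∏ i, h (c i) i := by
  simp_rw [Finset.prod_filter, hc]
  rw [Finset.prod_comm]
  simp

lemma prod_Iio_mul_prod_Ioi {M : Type*} [CommMonoid M] (f : Fin n → M) (γ : Fin n) :
    ∏ β, f β = (∏ β ∈ Finset.Iio γ, f β) * f γ * ∏ β ∈ Finset.Ioi γ, f β := by
  rw [mul_assoc, ← Finset.Ici_erase, Finset.mul_prod_erase _ _ (Finset.mem_Ici.2 le_rfl),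
    ← Finset.prod_union]
  · congr 1
    ext β
    simp [lt_or_ge]
  · exact Finset.disjoint_left.2 fun β h1 h2 =>
      absurd (Finset.mem_Iio.1 h1) (not_lt.2 (Finset.mem_Ici.1 h2))

end Colour

/-! ### The antisymmetric form of the stable envelope -/

section Envelope

variable {n k : ℕ}

/-- The antisymmetric function `∏_{i < j} x_i θ(x_j / x_i)`. -/
noncomputable def thetaVandermonde (q : ℂ) (x : Fin k → ℂ) : ℂ :=
  ∏ i, ∏ j ∈ Finset.Ioi i, x i * theta (x j / x i) q

/-- The contribution of one variable `w` of colour `γ` in the position `i` to the numerator of the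
stable envelope. -/
noncomputable def envFactor (q₁ q₂ : ℂ) (K a : Fin n → ℂ) (z : ℂ) (γ : Fin n) (i : Fin k)
    (w : ℂ) : ℂ :=
  (∏ β ∈ Finset.Iio γ, theta (a β / w) q₂⁻¹) *
    theta (z * rhoFactor q₁ i * KProd K γ * a γ / w) q₂⁻¹ *
    ∏ β ∈ Finset.Ioi γ, theta (K β * a β / w) q₂⁻¹

/-- The product of `stabSummand` and `thetaVandermonde`, written without a denominator. -/
noncomputable def envNum (q₁ q₂ : ℂ) (K a : Fin n → ℂ) (z : ℂ) (κ : Fin n → ℕ)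
    (x : Fin k → ℂ) : ℂ :=
  (∏ i, ∏ j ∈ Finset.Ioi i, x i * theta (q₁ * x j / x i) q₂⁻¹) *
    ∏ γ, ∏ i : Fin k with HasColour κ i γ, envFactor q₁ q₂ K a z γ i (x i)

/-- The antisymmetrization of `envNum`, a holomorphic multiple of the stable envelope. -/
noncomputable def antiNum (q₁ q₂ : ℂ) (K a : Fin n → ℂ) (z : ℂ) (κ : Fin n → ℕ)
    (x : Fin k → ℂ) : ℂ :=
  ∑ σ : Equiv.Perm (Fin k), (σ.sign : ℂ) * envNum q₁ q₂ K a z κ (x ∘ σ)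

lemma stabSummand_eq_mul (q₁ q₂ : ℂ) (K a : Fin n → ℂ) (z : ℂ) (κ : Fin n → ℕ) (x : Fin k → ℂ) :
    stabSummand q₁ q₂ K a z κ x =
      (∏ i, ∏ j ∈ Finset.Ioi i, theta (q₁ * x j / x i) q₂⁻¹ / theta (x j / x i) q₂⁻¹) *
      ∏ γ, ∏ i : Fin k with HasColour κ i γ, envFactor q₁ q₂ K a z γ i (x i) := rfl

variable {q : ℂ}

/-- The points whose coordinates are nonzero and inequivalent modulo powers of `q`. -/
def Inequivalent (q : ℂ) (x : Fin k → ℂ) : Prop :=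
  (∀ i, x i ≠ 0) ∧ ∀ i j, i ≠ j → ∀ s : ℤ, x i ≠ q ^ s * x j

lemma Inequivalent.comp {x : Fin k → ℂ} (h : Inequivalent q x) (σ : Equiv.Perm (Fin k)) :
    Inequivalent q (x ∘ σ) :=
  ⟨fun _ => h.1 _, fun _ _ hij => h.2 _ _ (σ.injective.ne hij)⟩

lemma Inequivalent.theta_ne_zero (hq : ‖q‖ < 1) (hq0 : q ≠ 0) {x : Fin k → ℂ}
    (h : Inequivalent q x) {i j : Fin k} (hij : i ≠ j) : theta (x i / x j) q ≠ 0 := by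
  intro h0
  obtain ⟨s, hs⟩ := (theta_eq_zero_iff hq hq0 (div_ne_zero (h.1 i) (h.1 j))).1 h0
  exact h.2 i j hij s ((div_eq_iff (h.1 j)).1 hs)

lemma thetaVandermonde_ne_zero (hq : ‖q‖ < 1) (hq0 : q ≠ 0) {x : Fin k → ℂ}
    (h : Inequivalent q x) : thetaVandermonde q x ≠ 0 := by
  refine Finset.prod_ne_zero_iff.2 fun i _ => Finset.prod_ne_zero_iff.2 fun j hj => ?_
  exact mul_ne_zero (h.1 i) (h.theta_ne_zero hq hq0 (Finset.mem_Ioi.1 hj).ne')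

lemma thetaVandermonde_comp (hq : ‖q‖ < 1) {x : Fin k → ℂ} (hx : ∀ i, x i ≠ 0)
    (σ : Equiv.Perm (Fin k)) :
    thetaVandermonde q (x ∘ σ) = σ.sign * thetaVandermonde q x := by
  -- on the diagonal `theta 1 q = 0`, so that the factor is antisymmetric there as well
  refine σ.prod_Ioi_comp_eq_sign_mul_prod (f := fun i j => x i * theta (x j / x i) q) fun i j => ?_
  have hi := hx i
  have hj := hx j
  have h := theta_inv hq (div_ne_zero hi hj)
  rw [inv_div] at h
  rw [h]
  field_simp

lemma sign_mul_self (σ : Equiv.Perm (Fin k)) : ((σ.sign : ℤ) : ℂ) * ((σ.sign : ℤ) : ℂ) = 1 := by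
  rw [← Int.cast_mul, ← Units.val_mul, Int.units_mul_self]
  simp

variable {q₁ q₂ z : ℂ} {K a : Fin n → ℂ} {κ : Fin n → ℕ}

lemma stabSummand_mul_thetaVandermonde (hq : ‖q₂⁻¹‖ < 1) (hq0 : q₂⁻¹ ≠ 0) {x : Fin k → ℂ}
    (h : Inequivalent q₂⁻¹ x) :
    stabSummand q₁ q₂ K a z κ x * thetaVandermonde q₂⁻¹ x = envNum q₁ q₂ K a z κ x := by
  rw [stabSummand_eq_mul, envNum, thetaVandermonde, mul_right_comm]
  congr 1
  simp_rw [← Finset.prod_mul_distrib]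
  refine Finset.prod_congr rfl fun i _ => Finset.prod_congr rfl fun j hj => ?_
  rw [mul_left_comm, div_mul_cancel₀ _ (h.theta_ne_zero hq hq0 (Finset.mem_Ioi.1 hj).ne')]

lemma stabNum_mul_thetaVandermonde (hq : ‖q₂⁻¹‖ < 1) (hq0 : q₂⁻¹ ≠ 0) {x : Fin k → ℂ}
    (h : Inequivalent q₂⁻¹ x) :
    stabNum q₁ q₂ K a z κ x * thetaVandermonde q₂⁻¹ x = antiNum q₁ q₂ K a z κ x := by
  rw [stabNum, antiNum, Finset.sum_mul]
  refine Finset.sum_congr rfl fun σ _ => ?_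
  rw [← stabSummand_mul_thetaVandermonde hq hq0 (h.comp σ), thetaVandermonde_comp hq h.1,
    mul_left_comm, ← mul_assoc (σ.sign : ℂ), sign_mul_self, one_mul]

lemma stabNum_comp (x : Fin k → ℂ) (σ : Equiv.Perm (Fin k)) :
    stabNum q₁ q₂ K a z κ (x ∘ σ) = stabNum q₁ q₂ K a z κ x := by
  rw [stabNum, stabNum, ← Equiv.sum_comp (Equiv.mulLeft σ)
    (fun τ : Equiv.Perm (Fin k) => stabSummand q₁ q₂ K a z κ (x ∘ τ))]
  rfl

lemma antiNum_comp (x : Fin k → ℂ) (σ : Equiv.Perm (Fin k)) :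
    antiNum q₁ q₂ K a z κ (x ∘ σ) = σ.sign * antiNum q₁ q₂ K a z κ x := by
  rw [antiNum, antiNum, ← Equiv.sum_comp (Equiv.mulLeft σ)
    (fun τ : Equiv.Perm (Fin k) => (τ.sign : ℂ) * envNum q₁ q₂ K a z κ (x ∘ τ)), Finset.mul_sum]
  refine Finset.sum_congr rfl fun τ _ => ?_
  simp only [Equiv.coe_mulLeft, Equiv.Perm.sign_mul, Units.val_mul, Int.cast_mul]
  rw [← mul_assoc, ← mul_assoc, sign_mul_self, one_mul]
  rfl

end Envelope

/-! ### Holomorphy of the stable envelope -/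

section Differentiability

variable {n k : ℕ} {E : Type*} [NormedAddCommGroup E] [NormedSpace ℂ E] {e : E}

lemma differentiableAt_prod {ι : Type*} {s : Finset ι} {f : ι → E → ℂ}
    (hf : ∀ i ∈ s, DifferentiableAt ℂ (f i) e) :
    DifferentiableAt ℂ (fun e => ∏ i ∈ s, f i e) e := by
  classical
  induction s using Finset.induction_on with
  | empty => simp
  | insert i s hi ih =>
    simp_rw [Finset.prod_insert hi]
    exact (hf i (by simp)).mul (ih fun j hj => hf j (by simp [hj]))

lemma differentiableAt_div {f g : E → ℂ} (hf : DifferentiableAt ℂ f e)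
    (hg : DifferentiableAt ℂ g e) (h0 : g e ≠ 0) : DifferentiableAt ℂ (fun e => f e / g e) e := by
  simp_rw [div_eq_mul_inv]
  exact hf.mul (hg.inv h0)

lemma DifferentiableAt.theta_comp {q : ℂ} (hq : ‖q‖ < 1) {f : E → ℂ} (hf : DifferentiableAt ℂ f e)
    (h0 : f e ≠ 0) : DifferentiableAt ℂ (fun e => theta (f e) q) e :=
  (differentiableAt_theta hq h0).comp e hf

variable {q₂ : ℂ} {a : Fin n → ℂ} {κ : Fin n → ℕ} {Q Z : E → ℂ} {L : E → Fin n → ℂ}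

lemma differentiableAt_dynamicalArg (hZ : DifferentiableAt ℂ Z e) (hQ : DifferentiableAt ℂ Q e)
    (hL : ∀ β, DifferentiableAt ℂ (fun e => L e β) e) {W : E → ℂ} (hW : DifferentiableAt ℂ W e)
    (hQ0 : Q e ≠ 0) (hW0 : W e ≠ 0) (γ : Fin n) (i : Fin k) :
    DifferentiableAt ℂ (fun e => Z e * rhoFactor (Q e) i * KProd (L e) γ * a γ / W e) e := by
  have h1 : DifferentiableAt ℂ (fun e => rhoFactor (Q e) i) e := hQ.zpow (Or.inl hQ0)
  have h2 : DifferentiableAt ℂ (fun e => KProd (L e) γ) e :=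
    differentiableAt_prod fun β _ => hL β
  exact differentiableAt_div (((hZ.mul h1).mul h2).mul_const (a γ)) hW hW0

lemma dynamicalArg_ne_zero {q₁ z : ℂ} {K : Fin n → ℂ} (hq₁ : q₁ ≠ 0) (hK : ∀ β, K β ≠ 0)
    (hz : z ≠ 0)
    (ha : ∀ β, a β ≠ 0) {w : ℂ} (hw : w ≠ 0) (γ : Fin n) (i : Fin k) :
    z * rhoFactor q₁ i * KProd K γ * a γ / w ≠ 0 := by
  have h1 : rhoFactor q₁ i ≠ 0 := zpow_ne_zero _ hq₁
  have h2 : KProd K γ ≠ 0 := Finset.prod_ne_zero_iff.2 fun β _ => hK β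
  have := ha γ
  positivity

lemma differentiableAt_envNum (hq : ‖q₂⁻¹‖ < 1) (hz : Z e ≠ 0) (ha : ∀ β, a β ≠ 0)
    (hZ : DifferentiableAt ℂ Z e) (hQ : DifferentiableAt ℂ Q e)
    (hL : ∀ β, DifferentiableAt ℂ (fun e => L e β) e)
    {X : E → Fin k → ℂ} (hX : ∀ i, DifferentiableAt ℂ (fun e => X e i) e)
    (hQ0 : Q e ≠ 0) (hL0 : ∀ β, L e β ≠ 0) (hX0 : ∀ i, X e i ≠ 0) :
    DifferentiableAt ℂ (fun e => envNum (Q e) q₂ (L e) a (Z e) κ (X e)) e := by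
  unfold envNum envFactor
  refine DifferentiableAt.mul ?_ ?_
  · refine differentiableAt_prod fun i _ => differentiableAt_prod fun j _ => ?_
    refine (hX i).mul (DifferentiableAt.theta_comp hq
      (differentiableAt_div (hQ.mul (hX j)) (hX i) (hX0 i)) ?_)
    exact div_ne_zero (mul_ne_zero hQ0 (hX0 j)) (hX0 i)
  · refine differentiableAt_prod fun γ _ => differentiableAt_prod fun i _ => ?_
    refine DifferentiableAt.mul (DifferentiableAt.mul ?_ ?_) ?_
    · exact differentiableAt_prod fun β _ => DifferentiableAt.theta_comp hq
        (differentiableAt_div (differentiableAt_const _) (hX i) (hX0 i))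
        (div_ne_zero (ha β) (hX0 i))
    · exact DifferentiableAt.theta_comp hq
        (differentiableAt_dynamicalArg hZ hQ hL (hX i) hQ0 (hX0 i) γ i)
        (dynamicalArg_ne_zero hQ0 hL0 hz ha (hX0 i) γ i)
    · exact differentiableAt_prod fun β _ => DifferentiableAt.theta_comp hq
        (differentiableAt_div ((hL β).mul_const _) (hX i) (hX0 i))
        (div_ne_zero (mul_ne_zero (hL0 β) (ha β)) (hX0 i))

lemma differentiableAt_antiNum (hq : ‖q₂⁻¹‖ < 1) (hz : Z e ≠ 0) (ha : ∀ β, a β ≠ 0)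
    (hZ : DifferentiableAt ℂ Z e) (hQ : DifferentiableAt ℂ Q e)
    (hL : ∀ β, DifferentiableAt ℂ (fun e => L e β) e)
    {X : E → Fin k → ℂ} (hX : ∀ i, DifferentiableAt ℂ (fun e => X e i) e)
    (hQ0 : Q e ≠ 0) (hL0 : ∀ β, L e β ≠ 0) (hX0 : ∀ i, X e i ≠ 0) :
    DifferentiableAt ℂ (fun e => antiNum (Q e) q₂ (L e) a (Z e) κ (X e)) e :=
  DifferentiableAt.fun_sum fun σ _ => (differentiableAt_const _).mul
    (differentiableAt_envNum hq hz ha hZ hQ hL (X := fun e => X e ∘ σ) (fun _ => hX _) hQ0 hL0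
      fun _ => hX0 _)

end Differentiability


/-! ### Quasi-periodicity of the stable envelope -/

section QuasiPeriodicity

variable {n k : ℕ}

lemma prod_prod_Ioi_ite {M : Type*} [CommMonoid M] (i : Fin k) (A B : Fin k → M) :
    ∏ i', ∏ j' ∈ Finset.Ioi i', (if i' = i then A j' else if j' = i then B i' else 1) =
      (∏ j ∈ Finset.Ioi i, A j) * ∏ j ∈ Finset.Iio i, B j := by
  have h : ∀ i', ∀ j' ∈ Finset.Ioi i', (if i' = i then A j' else if j' = i then B i' else 1) =
      (if i' = i then A j' else 1) * (if j' = i then B i' else 1) := by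
    intro i' j' hj
    rw [Finset.mem_Ioi] at hj
    by_cases h1 : i' = i
    · simp [h1, (h1 ▸ hj).ne']
    · simp [h1]
  rw [Finset.prod_congr rfl fun i' _ => Finset.prod_congr rfl (h i')]
  simp_rw [Finset.prod_mul_distrib]
  congr 1
  · rw [Finset.prod_eq_single i (fun b _ hb => by simp [hb]) (by simp)]
    simp
  · rw [Finset.prod_comm' (t' := Finset.univ) (s' := fun j => Finset.Iio j) (by simp),
      Finset.prod_eq_single i (fun b _ hb => by simp [hb]) (by simp)]
    simp

variable {q₁ q₂ z : ℂ} {K a : Fin n → ℂ} {κ : Fin n → ℕ}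

/-- The multiplier of `envFactor` under `w ↦ q₂⁻¹ w` does not depend on the site `γ`. This is why
all summands of the stable envelope, for all components, have the same multipliers. -/
lemma envFactor_mul (hq : ‖q₂⁻¹‖ < 1) (hq0 : q₂⁻¹ ≠ 0) (hq₁ : q₁ ≠ 0) (hz : z ≠ 0)
    (hK : ∀ β, K β ≠ 0) (ha : ∀ β, a β ≠ 0) {w : ℂ} (hw : w ≠ 0) (γ : Fin n) (i : Fin k) :
    envFactor q₁ q₂ K a z γ i (q₂⁻¹ * w) =
      z * rhoFactor q₁ i * (∏ β, K β * a β) * (-(q₂⁻¹ * w)⁻¹) ^ n *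
        envFactor q₁ q₂ K a z γ i w := by
  have hq20 : q₂ ≠ 0 := by simpa using hq0
  have hth : ∀ u : ℂ, u ≠ 0 → theta (u / (q₂⁻¹ * w)) q₂⁻¹ =
      u * (-(q₂⁻¹ * w)⁻¹) * theta (u / w) q₂⁻¹ := by
    intro u hu
    have h1 := theta_mul hq hq0 (z := u / (q₂⁻¹ * w)) (div_ne_zero hu (mul_ne_zero hq0 hw))
    rw [show q₂⁻¹ * (u / (q₂⁻¹ * w)) = u / w by field_simp] at h1
    rw [h1]
    generalize theta (u / (q₂⁻¹ * w)) q₂⁻¹ = T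
    field_simp
  have hr : rhoFactor q₁ i ≠ 0 := zpow_ne_zero _ hq₁
  have hKP : KProd K γ ≠ 0 := Finset.prod_ne_zero_iff.2 fun β _ => hK β
  unfold envFactor
  rw [Finset.prod_congr rfl fun β _ => hth _ (ha β),
    Finset.prod_congr rfl fun β _ => hth _ (mul_ne_zero (hK β) (ha β)),
    hth _ (mul_ne_zero (mul_ne_zero (mul_ne_zero hz hr) hKP) (ha γ))]
  simp_rw [Finset.prod_mul_distrib, Finset.prod_const]
  set c := -(q₂⁻¹ * w)⁻¹ with hc
  have hcard : c ^ n = c ^ (Finset.Iio γ).card * c * c ^ (Finset.Ioi γ).card := by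
    rw [← pow_succ, ← pow_add]
    congr 1
    simp only [Fin.card_Iio, Fin.card_Ioi]
    omega
  have hKP' : KProd K γ = (∏ β ∈ Finset.Iio γ, K β) * K γ := by
    rw [KProd, ← Finset.Iic_erase, Finset.prod_erase_mul _ _ (Finset.mem_Iic.2 le_rfl)]
  rw [hcard, prod_Iio_mul_prod_Ioi K γ, prod_Iio_mul_prod_Ioi a γ]
  generalize (∏ β ∈ Finset.Iio γ, theta (a β / w) q₂⁻¹) = T1
  generalize (∏ β ∈ Finset.Ioi γ, theta (K β * a β / w) q₂⁻¹) = T2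
  generalize theta (z * rhoFactor q₁ i * KProd K γ * a γ / w) q₂⁻¹ = T3
  rw [hKP']
  ring

/-- The multiplier does not depend on the component, nor on the order of the sites. -/
lemma envNum_update (hκ : ∑ γ, κ γ = k) (hq : ‖q₂⁻¹‖ < 1) (hq0 : q₂⁻¹ ≠ 0) (hq₁ : q₁ ≠ 0)
    (hz : z ≠ 0) (hK : ∀ β, K β ≠ 0) (ha : ∀ β, a β ≠ 0) {x : Fin k → ℂ} (hx : ∀ i, x i ≠ 0)
    (i : Fin k) :
    envNum q₁ q₂ K a z κ (Function.update x i (q₂⁻¹ * x i)) =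
      z * (∏ β, K β * a β) * (-(q₂⁻¹ * x i)⁻¹) ^ n * (∏ l ∈ Finset.univ.erase i, -(x l / x i)) *
        envNum q₁ q₂ K a z κ x := by
  obtain ⟨c, hc⟩ := exists_colour hκ
  set x' := Function.update x i (q₂⁻¹ * x i) with hx'
  have hx'i : x' i = q₂⁻¹ * x i := by simp [hx']
  have hx'j : ∀ j, j ≠ i → x' j = x j := fun j hj => by simp [hx', hj]
  have hq20 : q₂ ≠ 0 := by simpa using hq0
  have hpair : ∏ i', ∏ j' ∈ Finset.Ioi i', x' i' * theta (q₁ * x' j' / x' i') q₂⁻¹ =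
      ((∏ j ∈ Finset.Ioi i, q₁ * -(x j / x i)) * ∏ j ∈ Finset.Iio i, q₁⁻¹ * -(x j / x i)) *
      ∏ i', ∏ j' ∈ Finset.Ioi i', x i' * theta (q₁ * x j' / x i') q₂⁻¹ := by
    rw [← prod_prod_Ioi_ite i (fun j => q₁ * -(x j / x i)) (fun j => q₁⁻¹ * -(x j / x i))]
    simp_rw [← Finset.prod_mul_distrib]
    refine Finset.prod_congr rfl fun i' _ => Finset.prod_congr rfl fun j' hj => ?_
    rw [Finset.mem_Ioi] at hj
    have hxi := hx i
    by_cases h1 : i' = i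
    · subst h1
      rw [if_pos rfl, hx'i, hx'j _ hj.ne']
      have hxj := hx j'
      have h := theta_mul hq hq0 (z := q₁ * x j' / (q₂⁻¹ * x i'))
        (div_ne_zero (mul_ne_zero hq₁ hxj) (mul_ne_zero hq0 hxi))
      rw [show q₂⁻¹ * (q₁ * x j' / (q₂⁻¹ * x i')) = q₁ * x j' / x i' by field_simp] at h
      rw [h]
      generalize theta (q₁ * x j' / (q₂⁻¹ * x i')) q₂⁻¹ = T
      field_simp
    · rw [if_neg h1, hx'j _ h1]
      by_cases h2 : j' = i
      · subst h2
        have hxj := hx i'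
        rw [if_pos rfl, hx'i, show q₁ * (q₂⁻¹ * x j') / x i' = q₂⁻¹ * (q₁ * x j' / x i') by ring,
          theta_mul hq hq0 (div_ne_zero (mul_ne_zero hq₁ hxi) hxj)]
        field_simp
      · rw [if_neg h2, hx'j _ h2, one_mul]
  have hone : ∏ i', envFactor q₁ q₂ K a z (c i') i' (x' i') =
      (z * rhoFactor q₁ i * (∏ β, K β * a β) * (-(q₂⁻¹ * x i)⁻¹) ^ n) *
      ∏ i', envFactor q₁ q₂ K a z (c i') i' (x i') := by
    rw [← Finset.mul_prod_erase Finset.univ _ (Finset.mem_univ i), hx'i,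
      envFactor_mul hq hq0 hq₁ hz hK ha (hx i),
      ← Finset.mul_prod_erase Finset.univ (fun i' => envFactor q₁ q₂ K a z (c i') i' (x i'))
        (Finset.mem_univ i), mul_assoc (z * rhoFactor q₁ i * _ * _)]
    congr 2
    exact Finset.prod_congr rfl fun j hj => by rw [hx'j _ (Finset.ne_of_mem_erase hj)]
  have hsplit : ∏ l ∈ Finset.univ.erase i, -(x l / x i) =
      (∏ j ∈ Finset.Ioi i, -(x j / x i)) * ∏ j ∈ Finset.Iio i, -(x j / x i) := by
    rw [← Finset.prod_union]
    · congr 1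
      ext j
      simp only [Finset.mem_erase, Finset.mem_univ, and_true, Finset.mem_union, Finset.mem_Ioi,
        Finset.mem_Iio]
      exact ⟨fun h => (lt_or_gt_of_ne h).symm, fun h => h.elim (fun h => h.ne') fun h => h.ne⟩
    · exact Finset.disjoint_left.2 fun j h1 h2 =>
        absurd (Finset.mem_Iio.1 h2) (not_lt.2 (Finset.mem_Ioi.1 h1).le)
  have hrho : rhoFactor q₁ i * (q₁ ^ (Finset.Ioi i).card * q₁⁻¹ ^ (Finset.Iio i).card) = 1 := by
    simp only [rhoFactor, Fin.card_Ioi, Fin.card_Iio]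
    rw [inv_pow, ← zpow_natCast, ← zpow_natCast, ← zpow_neg, ← zpow_add₀ hq₁, ← zpow_add₀ hq₁]
    rw [show (2 * ((i : ℤ) + 1) - (k : ℤ) - 1 +
      (((k - 1 - (i : ℕ) : ℕ) : ℤ) + -((i : ℕ) : ℤ))) = 0 by
      have := i.2
      omega]
    simp
  unfold envNum
  rw [hpair, prod_prod_hasColour hc, prod_prod_hasColour hc, hone, hsplit,
    Finset.prod_mul_distrib, Finset.prod_mul_distrib, Finset.prod_const, Finset.prod_const]
  generalize (∏ i', ∏ j' ∈ Finset.Ioi i', x i' * theta (q₁ * x j' / x i') q₂⁻¹) = T1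
  generalize (∏ i', envFactor q₁ q₂ K a z (c i') i' (x i')) = T2
  generalize (∏ j ∈ Finset.Ioi i, -(x j / x i)) = T3
  generalize (∏ j ∈ Finset.Iio i, -(x j / x i)) = T4
  generalize (-(q₂⁻¹ * x i)⁻¹) ^ n = T5
  generalize (∏ β, K β * a β) = T6
  linear_combination (z * T1 * T2 * T3 * T4 * T5 * T6) * hrho

lemma antiNum_update (hκ : ∑ γ, κ γ = k) (hq : ‖q₂⁻¹‖ < 1) (hq0 : q₂⁻¹ ≠ 0) (hq₁ : q₁ ≠ 0)
    (hz : z ≠ 0) (hK : ∀ β, K β ≠ 0) (ha : ∀ β, a β ≠ 0) {x : Fin k → ℂ} (hx : ∀ i, x i ≠ 0)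
    (i : Fin k) :
    antiNum q₁ q₂ K a z κ (Function.update x i (q₂⁻¹ * x i)) =
      z * (∏ β, K β * a β) * (-(q₂⁻¹ * x i)⁻¹) ^ n * (∏ l ∈ Finset.univ.erase i, -(x l / x i)) *
        antiNum q₁ q₂ K a z κ x := by
  rw [antiNum, antiNum, Finset.mul_sum]
  refine Finset.sum_congr rfl fun σ _ => ?_
  have h1 : Function.update x i (q₂⁻¹ * x i) ∘ σ =
      Function.update (x ∘ σ) (σ.symm i) (q₂⁻¹ * (x ∘ σ) (σ.symm i)) := by
    funext j
    rcases eq_or_ne j (σ.symm i) with rfl | hj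
    · simp
    · have : σ j ≠ i := fun h => hj (by rw [← h]; simp)
      simp [hj, this]
  have h2 : ∏ l ∈ Finset.univ.erase (σ.symm i), -((x ∘ σ) l / (x ∘ σ) (σ.symm i)) =
      ∏ l ∈ Finset.univ.erase i, -(x l / x i) := by
    refine Finset.prod_equiv σ (fun l => ?_) (fun l _ => by simp)
    simp [Equiv.eq_symm_apply]
  rw [h1, envNum_update hκ hq hq0 hq₁ hz hK ha (x := x ∘ σ) (fun _ => hx _), h2]
  simp only [Function.comp_apply, Equiv.apply_symm_apply]
  ring

end QuasiPeriodicity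

/-! ### Antisymmetric theta functions that vanish at the fixed points -/

section Vanishing

variable {q : ℂ} {m : ℕ} {f : (Fin m → ℂ) → ℂ} {C : ℂ} {A B : ℕ → ℂ}

/-- An antisymmetric holomorphic function of `m` variables that is a theta function of degree `m +
1` in each of them vanishes if it vanishes at the points which consist of an initial segment of the
sequence `A` and an initial segment of the sequence `B`. Indeed, if `s + t < m` and the function
vanishes at all points that contain `A 0, …, A s, B 0, …, B (t-1)` or `A 0, …, A (s-1), B 0, …, B
t`, then at a point that contains `A 0, …, A (s-1), B 0, …, B (t-1)`, as a function of one of the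
remaining variables, it has the zeros `A s`, `B t` and the `m - 1` values of the other variables. -/
theorem eq_zero_of_vanishing (hq : ‖q‖ < 1) (hq0 : q ≠ 0)
    (hA0 : ∀ i, A i ≠ 0) (hB0 : ∀ i, B i ≠ 0)
    (hAA : ∀ i j, i ≠ j → ∀ s : ℤ, A i ≠ q ^ s * A j)
    (hBB : ∀ i j, i ≠ j → ∀ s : ℤ, B i ≠ q ^ s * B j)
    (hAB : ∀ i j, ∀ s : ℤ, A i ≠ q ^ s * B j)
    (hC0 : C ≠ 0) (hC : ∀ i j, ∀ s : ℤ, C ≠ q ^ s * (A i * B j))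
    (hd : ∀ x : Fin m → ℂ, (∀ i, x i ≠ 0) → ∀ i, ∀ w ≠ 0,
      DifferentiableAt ℂ (fun w => f (Function.update x i w)) w)
    (hper : ∀ x : Fin m → ℂ, (∀ i, x i ≠ 0) → ∀ i, f (Function.update x i (q * x i)) =
      C * (x i)⁻¹ ^ 2 * (∏ l ∈ Finset.univ.erase i, -(x l / x i)) * f x)
    (hanti : ∀ (x : Fin m → ℂ) (σ : Equiv.Perm (Fin m)), f (x ∘ σ) = σ.sign * f x)
    (hbase : ∀ s t, s + t = m → ∀ x : Fin m → ℂ, (∀ i, x i ≠ 0) → (∀ i < s, A i ∈ Set.range x) →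
      (∀ i < t, B i ∈ Set.range x) → f x = 0)
    (x : Fin m → ℂ) (hx : ∀ i, x i ≠ 0) : f x = 0 := by
  have hupd : ∀ x : Fin m → ℂ, (∀ i, x i ≠ 0) → ∀ i, ∀ w ≠ 0, ∀ j, Function.update x i w j ≠ 0 := by
    intro x hx i w hw j
    rcases eq_or_ne j i with rfl | h
    · simpa
    · simpa [h] using hx j
  -- the zero set is invariant under multiplication of a coordinate by a power of `q`
  have hstep : ∀ x : Fin m → ℂ, (∀ i, x i ≠ 0) → ∀ i, ∀ w ≠ 0,
      (f (Function.update x i (q * w)) = 0 ↔ f (Function.update x i w) = 0) := by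
    intro x hx i w hw
    have h := hper (Function.update x i w) (hupd x hx i w hw) i
    simp only [Function.update_idem, Function.update_self] at h
    rw [h, mul_eq_zero, or_iff_right]
    refine mul_ne_zero (mul_ne_zero hC0 (pow_ne_zero _ (inv_ne_zero hw))) ?_
    exact Finset.prod_ne_zero_iff.2 fun l _ =>
      neg_ne_zero.2 (div_ne_zero (hupd x hx i w hw l) hw)
  have hzpow : ∀ x : Fin m → ℂ, (∀ i, x i ≠ 0) → ∀ i, ∀ w ≠ 0, ∀ s : ℤ,
      (f (Function.update x i (q ^ s * w)) = 0 ↔ f (Function.update x i w) = 0) := by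
    intro x hx i w hw s
    induction s with
    | zero => simp
    | succ j ih =>
      rw [add_comm, zpow_add₀ hq0, zpow_one, mul_assoc,
        hstep x hx i _ (mul_ne_zero (zpow_ne_zero _ hq0) hw), ih]
    | pred j ih =>
      rw [← ih, ← hstep x hx i _ (mul_ne_zero (zpow_ne_zero _ hq0) hw), ← mul_assoc]
      rw [show q * q ^ (-(j : ℤ) - 1) = q ^ (-(j : ℤ)) by rw [zpow_sub₀ hq0]; field_simp]
  have hdiag : ∀ x : Fin m → ℂ, (∀ i, x i ≠ 0) → ∀ i j, i ≠ j → ∀ s : ℤ, x i = q ^ s * x j →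
      f x = 0 := by
    intro x hx i j hij s h
    rw [← Function.update_eq_self i x, h, hzpow x hx i _ (hx j)]
    have h1 := hanti (Function.update x i (x j)) (Equiv.swap i j)
    have h2 : Function.update x i (x j) ∘ Equiv.swap i j = Function.update x i (x j) := by
      funext l
      simp only [Function.comp_apply]
      rcases eq_or_ne l i with rfl | hli
      · simp [hij.symm]
      rcases eq_or_ne l j with rfl | hlj
      · simp [hli]
      rw [Equiv.swap_apply_of_ne_of_ne hli hlj]
    rw [h2, Equiv.Perm.sign_swap hij] at h1
    simp only [Units.val_neg, Units.val_one, Int.cast_neg, Int.cast_one, neg_mul, one_mul] at h1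
    exact self_eq_neg.1 h1
  have main : ∀ d s t, s + t + d = m → ∀ x : Fin m → ℂ, (∀ i, x i ≠ 0) →
      (∀ i < s, A i ∈ Set.range x) → (∀ i < t, B i ∈ Set.range x) → f x = 0 := by
    intro d
    induction d with
    | zero => exact fun s t hst => hbase s t (by omega)
    | succ d ih =>
      intro s t hst x hx hAx hBx
      -- a coordinate that is not needed for the prescribed values
      obtain ⟨i, hiA, hiB⟩ : ∃ i, (∀ j < s, ∃ l, l ≠ i ∧ x l = A j) ∧
          (∀ j < t, ∃ l, l ≠ i ∧ x l = B j) := by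
        have : Nonempty (Fin m) := ⟨⟨0, by omega⟩⟩
        choose! pA hpA using hAx
        choose! pB hpB using hBx
        set S : Finset (Fin m) := (Finset.range s).image pA ∪ (Finset.range t).image pB with hS
        have hcard : S.card < m := by
          calc S.card ≤ _ := Finset.card_union_le _ _
            _ ≤ s + t := by
              gcongr
              · exact Finset.card_image_le.trans (by simp)
              · exact Finset.card_image_le.trans (by simp)
            _ < m := by omega
        obtain ⟨i, hi⟩ : ∃ i, i ∉ S := by
          by_contra! h
          have : S = Finset.univ := Finset.eq_univ_of_forall h
          simp [this] at hcard
        refine ⟨i, fun j hj => ⟨pA j, ?_, hpA j hj⟩, fun j hj => ⟨pB j, ?_, hpB j hj⟩⟩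
        · rintro rfl
          exact hi (Finset.mem_union_left _ (Finset.mem_image_of_mem _ (Finset.mem_range.2 hj)))
        · rintro rfl
          exact hi (Finset.mem_union_right _ (Finset.mem_image_of_mem _ (Finset.mem_range.2 hj)))
      have hAs : ∀ (y : Fin m → ℂ) (j : Fin m), (∀ l, y l ≠ 0) → (∀ i < s, ∃ l, l ≠ j ∧ y l = A i) →
          (∀ i < t, ∃ l, l ≠ j ∧ y l = B i) → f (Function.update y j (A s)) = 0 := by
        intro y j hy h1 h2
        refine ih (s + 1) t (by omega) _ (hupd y hy j _ (hA0 s)) (fun i hi => ?_) (fun i hi => ?_)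
        · rcases Nat.lt_succ_iff_lt_or_eq.1 hi with h | rfl
          · obtain ⟨l, hl, hl'⟩ := h1 i h
            exact ⟨l, by simp [hl, hl']⟩
          · exact ⟨j, by simp⟩
        · obtain ⟨l, hl, hl'⟩ := h2 i hi
          exact ⟨l, by simp [hl, hl']⟩
      have hBt : ∀ (y : Fin m → ℂ) (j : Fin m), (∀ l, y l ≠ 0) → (∀ i < s, ∃ l, l ≠ j ∧ y l = A i) →
          (∀ i < t, ∃ l, l ≠ j ∧ y l = B i) → f (Function.update y j (B t)) = 0 := by
        intro y j hy h1 h2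
        refine ih s (t + 1) (by omega) _ (hupd y hy j _ (hB0 t)) (fun i hi => ?_) (fun i hi => ?_)
        · obtain ⟨l, hl, hl'⟩ := h1 i hi
          exact ⟨l, by simp [hl, hl']⟩
        · rcases Nat.lt_succ_iff_lt_or_eq.1 hi with h | rfl
          · obtain ⟨l, hl, hl'⟩ := h2 i h
            exact ⟨l, by simp [hl, hl']⟩
          · exact ⟨j, by simp⟩
      by_cases hdist : ∃ j l, j ≠ l ∧ ∃ s : ℤ, x j = q ^ s * x l
      · obtain ⟨j, l, hjl, s', h⟩ := hdist
        exact hdiag x hx j l hjl s' h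
      push Not at hdist
      by_cases hA : ∃ j, ∃ s' : ℤ, x j = q ^ s' * A s
      · obtain ⟨j, s', h⟩ := hA
        rw [← Function.update_eq_self j x, h, hzpow x hx j _ (hA0 s)]
        refine hAs x j hx (fun i' hi' => ?_) (fun i' hi' => ?_)
        · obtain ⟨l, -, hl⟩ := hiA i' hi'
          refine ⟨l, ?_, hl⟩
          rintro rfl
          exact hAA i' s (by omega) s' (by rw [← hl, h])
        · obtain ⟨l, -, hl⟩ := hiB i' hi'
          refine ⟨l, ?_, hl⟩
          rintro rfl
          refine hAB s i' (-s') ?_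
          rw [← hl, h, ← mul_assoc, ← zpow_add₀ hq0]
          simp
      by_cases hB : ∃ j, ∃ s' : ℤ, x j = q ^ s' * B t
      · obtain ⟨j, s', h⟩ := hB
        rw [← Function.update_eq_self j x, h, hzpow x hx j _ (hB0 t)]
        refine hBt x j hx (fun i' hi' => ?_) (fun i' hi' => ?_)
        · obtain ⟨l, -, hl⟩ := hiA i' hi'
          refine ⟨l, ?_, hl⟩
          rintro rfl
          exact hAB i' t s' (by rw [← hl, h])
        · obtain ⟨l, -, hl⟩ := hiB i' hi'
          refine ⟨l, ?_, hl⟩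
          rintro rfl
          exact hBB i' t (by omega) s' (by rw [← hl, h])
      push Not at hA hB
      set others : List ℂ := (Finset.univ.erase i).toList.map x with hothers
      have hlen : others.length = m - 1 := by simp [hothers]
      have hmem : ∀ u ∈ others, ∃ l, l ≠ i ∧ x l = u := by
        intro u hu
        simp only [hothers, List.mem_map, Finset.mem_toList, Finset.mem_erase, Finset.mem_univ,
          and_true] at hu
        exact hu
      have hfun : f (Function.update x i (x i)) = 0 := by
        refine eq_zero_of_theta_zeros hq hq0 (A s :: B t :: others)
          (f := fun w => f (Function.update x i w))
          (μ := C * ∏ l ∈ Finset.univ.erase i, -x l) ?_ (hd x hx i) ?_ ?_ ?_ ?_ ?_ (hx i)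
        · exact mul_ne_zero hC0 (Finset.prod_ne_zero_iff.2 fun l _ => neg_ne_zero.2 (hx l))
        · intro w hw
          have h := hper (Function.update x i w) (hupd x hx i w hw) i
          simp only [Function.update_idem, Function.update_self] at h
          rw [h]
          have h1 : ∏ l ∈ Finset.univ.erase i, -(Function.update x i w l / w) =
              w⁻¹ ^ (m - 1) * ∏ l ∈ Finset.univ.erase i, -x l := by
            have h2 : ∀ l ∈ Finset.univ.erase i, -(Function.update x i w l / w) = w⁻¹ * -x l := by
              intro l hl
              rw [Function.update_of_ne (Finset.ne_of_mem_erase hl)]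
              ring
            rw [Finset.prod_congr rfl h2, Finset.prod_mul_distrib, Finset.prod_const]
            simp
          rw [h1]
          simp only [List.length_cons, hlen]
          ring
        · simp only [List.mem_cons, forall_eq_or_imp]
          refine ⟨hA0 s, hB0 t, fun u hu => ?_⟩
          obtain ⟨l, -, rfl⟩ := hmem u hu
          exact hx l
        · simp only [List.mem_cons, forall_eq_or_imp]
          refine ⟨hAs x i hx hiA hiB, hBt x i hx hiA hiB, fun u hu => ?_⟩
          obtain ⟨l, hl, rfl⟩ := hmem u hu
          exact hdiag _ (hupd x hx i _ (hx l)) i l hl.symm 0 (by simp [hl])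
        · simp only [List.pairwise_cons, List.mem_cons, forall_eq_or_imp]
          refine ⟨⟨fun s' => hAB s t s', fun u hu s' h => ?_⟩, fun u hu s' h => ?_, ?_⟩
          · obtain ⟨l, -, rfl⟩ := hmem u hu
            refine hA l (-s') ?_
            rw [h, ← mul_assoc, ← zpow_add₀ hq0]
            simp
          · obtain ⟨l, -, rfl⟩ := hmem u hu
            refine hB l (-s') ?_
            rw [h, ← mul_assoc, ← zpow_add₀ hq0]
            simp
          · rw [hothers, List.pairwise_map]
            exact (Finset.nodup_toList _).imp fun {j l} hjl s' => hdist j l hjl s'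
        · intro s' h
          simp only [List.map_cons, List.prod_cons, hothers, List.map_map] at h
          have h1 : (List.map ((fun u => -u) ∘ x) (Finset.univ.erase i).toList).prod =
              ∏ l ∈ Finset.univ.erase i, -x l := Finset.prod_map_toList _ _
          rw [h1] at h
          have h2 : ∏ l ∈ Finset.univ.erase i, -x l ≠ 0 :=
            Finset.prod_ne_zero_iff.2 fun l _ => neg_ne_zero.2 (hx l)
          refine hC s t s' (mul_right_cancel₀ h2 ?_)
          rw [h]
          ring
      rwa [Function.update_eq_self] at hfun
  exact main m 0 0 (by omega) x hx (by simp) (by simp)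

end Vanishing


/-! ### Two sites: triangularity at the fixed points and the off-shell relation -/

section TwoSites

/-- Genericity of the parameters of two sites. -/
structure GenericPair (q₁ q₂ a₁ a₂ K₁ K₂ z : ℂ) : Prop where
  one_lt : 1 < ‖q₂‖
  q₁_ne : q₁ ≠ 0
  a₁_ne : a₁ ≠ 0
  a₂_ne : a₂ ≠ 0
  K₁_ne : K₁ ≠ 0
  K₂_ne : K₂ ≠ 0
  z_ne : z ≠ 0
  pow_ne : ∀ s t : ℤ, s ≠ 0 → q₁ ^ s ≠ q₂ ^ t
  a_ne : ∀ s t : ℤ, a₁ / a₂ ≠ q₁ ^ s * q₂ ^ t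
  Ka_ne : ∀ s t : ℤ, K₁ * a₁ / a₂ ≠ q₁ ^ s * q₂ ^ t
  Ka_ne' : ∀ s t : ℤ, K₂ * a₂ / a₁ ≠ q₁ ^ s * q₂ ^ t
  zK_ne : ∀ s t e₁ e₂ : ℤ, z ≠ q₁ ^ s * q₂ ^ t * (K₁ ^ e₁ * K₂ ^ e₂)

variable {q₁ q₂ a₁ a₂ K₁ K₂ z : ℂ} {m : ℕ}

lemma GenericPair.q₂_ne (h : GenericPair q₁ q₂ a₁ a₂ K₁ K₂ z) : q₂ ≠ 0 := by
  rintro rfl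
  have := h.one_lt
  norm_num at this

lemma norm_inv_lt_one_of_one_lt (h : 1 < ‖q₂‖) : ‖q₂⁻¹‖ < 1 := by
  rw [norm_inv]
  exact inv_lt_one_of_one_lt₀ h

lemma GenericPair.symm (h : GenericPair q₁ q₂ a₁ a₂ K₁ K₂ z) : GenericPair q₁ q₂ a₂ a₁ K₂ K₁ z where
  one_lt := h.one_lt
  q₁_ne := h.q₁_ne
  a₁_ne := h.a₂_ne
  a₂_ne := h.a₁_ne
  K₁_ne := h.K₂_ne
  K₂_ne := h.K₁_ne
  z_ne := h.z_ne
  pow_ne := h.pow_ne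
  a_ne s t e := h.a_ne (-s) (-t) (by
    rw [← inv_div, e, mul_inv, zpow_neg, zpow_neg])
  Ka_ne := h.Ka_ne'
  Ka_ne' := h.Ka_ne
  zK_ne s t e₁ e₂ e := h.zK_ne s t e₂ e₁ (by rw [e]; ring)

/-- The theta function in base `q₂⁻¹` does not vanish off the powers of `q₂`. -/
lemma theta_ne_zero_of_ne_zpow (hq₂ : 1 < ‖q₂‖) {w : ℂ} (hw : w ≠ 0) (h : ∀ t : ℤ, w ≠ q₂ ^ t) :
    theta w q₂⁻¹ ≠ 0 := by
  have hq20 : q₂ ≠ 0 := by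
    rintro rfl
    norm_num at hq₂
  intro h0
  obtain ⟨t, ht⟩ := (theta_eq_zero_iff (norm_inv_lt_one_of_one_lt hq₂) (inv_ne_zero hq20) hw).1 h0
  exact h (-t) (by rw [ht, inv_zpow, zpow_neg])

lemma hasColour_two_one (j : ℕ) (i : Fin m) : HasColour ![j, m - j] i 1 ↔ (i : ℕ) < m - j := by
  have h1 : Finset.Ioi (1 : Fin 2) = ∅ := rfl
  have h2 : Finset.Ici (1 : Fin 2) = {1} := rfl
  simp [HasColour, h1, h2]

lemma hasColour_two_zero {j : ℕ} (hj : j ≤ m) (i : Fin m) :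
    HasColour ![j, m - j] i 0 ↔ m - j ≤ (i : ℕ) := by
  have h1 : Finset.Ioi (0 : Fin 2) = {1} := rfl
  have h2 : Finset.Ici (0 : Fin 2) = {0, 1} := rfl
  simp only [HasColour, h1, h2, Finset.sum_singleton, Matrix.cons_val_one, Matrix.cons_val_fin_one,
    Finset.mem_singleton, zero_ne_one, not_false_eq_true, Finset.sum_insert, Matrix.cons_val_zero,
    and_iff_left_iff_imp]
  have := i.2
  omega

lemma envFactor_two_one (i : Fin m) (w : ℂ) :
    envFactor q₁ q₂ ![K₁, K₂] ![a₁, a₂] z 1 i w =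
      theta (a₁ / w) q₂⁻¹ * theta (z * rhoFactor q₁ i * (K₁ * K₂) * a₂ / w) q₂⁻¹ := by
  have h1 : Finset.Iio (1 : Fin 2) = {0} := rfl
  have h2 : Finset.Ioi (1 : Fin 2) = ∅ := rfl
  have h3 : Finset.Iic (1 : Fin 2) = {0, 1} := rfl
  simp [envFactor, KProd, h1, h2, h3]

lemma envFactor_two_zero (i : Fin m) (w : ℂ) :
    envFactor q₁ q₂ ![K₁, K₂] ![a₁, a₂] z 0 i w =
      theta (z * rhoFactor q₁ i * K₁ * a₁ / w) q₂⁻¹ * theta (K₂ * a₂ / w) q₂⁻¹ := by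
  have h1 : Finset.Iio (0 : Fin 2) = ∅ := rfl
  have h2 : Finset.Ioi (0 : Fin 2) = {1} := rfl
  have h3 : Finset.Iic (0 : Fin 2) = {0} := rfl
  simp [envFactor, KProd, h1, h2, h3]

lemma fixedPoint_of_lt {l : ℕ} {t : Fin m} (h : (t : ℕ) < m - l) :
    fixedPoint q₁ a₁ a₂ m l t = a₂ * q₁ ^ (t : ℕ) := if_pos h

lemma fixedPoint_of_le {l : ℕ} {t : Fin m} (h : m - l ≤ (t : ℕ)) :
    fixedPoint q₁ a₁ a₂ m l t = a₁ * q₁ ^ ((t : ℕ) - (m - l)) := if_neg (not_lt.2 h)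

lemma fixedPoint_ne_zero (hq₁ : q₁ ≠ 0) (h₁ : a₁ ≠ 0) (h₂ : a₂ ≠ 0) (l : ℕ) (t : Fin m) :
    fixedPoint q₁ a₁ a₂ m l t ≠ 0 := by
  unfold fixedPoint
  split_ifs <;> positivity

lemma GenericPair.mul_pow_ne (h : GenericPair q₁ q₂ a₁ a₂ K₁ K₂ z) {b : ℂ} (hb : b ≠ 0) (s t : ℕ)
    (hst : s ≠ t) (r : ℤ) : b * q₁ ^ s ≠ q₂⁻¹ ^ r * (b * q₁ ^ t) := by
  intro e
  refine h.pow_ne ((s : ℤ) - t) (-r) (by omega) ?_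
  have h1 := h.q₁_ne
  rw [zpow_sub₀ h1, zpow_natCast, zpow_natCast, div_eq_iff (pow_ne_zero _ h1), zpow_neg, ← inv_zpow]
  refine mul_left_cancel₀ hb ?_
  rw [e]
  ring

lemma GenericPair.mul_pow_ne_mul_pow (h : GenericPair q₁ q₂ a₁ a₂ K₁ K₂ z) (s t : ℕ) (r : ℤ) :
    a₁ * q₁ ^ s ≠ q₂⁻¹ ^ r * (a₂ * q₁ ^ t) := by
  intro e
  refine h.a_ne ((t : ℤ) - s) (-r) ?_
  have h1 := h.q₁_ne
  have h2 := h.a₂_ne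
  rw [zpow_sub₀ h1, zpow_natCast, zpow_natCast, zpow_neg, ← inv_zpow]
  generalize q₂⁻¹ ^ r = T at e ⊢
  field_simp
  rw [e]
  ring

lemma GenericPair.inequivalent_fixedPoint (h : GenericPair q₁ q₂ a₁ a₂ K₁ K₂ z) (l : ℕ) :
    Inequivalent q₂⁻¹ (fixedPoint q₁ a₁ a₂ m l) := by
  refine ⟨fixedPoint_ne_zero h.q₁_ne h.a₁_ne h.a₂_ne l, fun i j hij s => ?_⟩
  have hij' : (i : ℕ) ≠ j := fun e => hij (Fin.ext e)
  rcases lt_or_ge (i : ℕ) (m - l) with hi | hi <;> rcases lt_or_ge (j : ℕ) (m - l) with hj | hj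
  · rw [fixedPoint_of_lt hi, fixedPoint_of_lt hj]
    exact h.mul_pow_ne h.a₂_ne _ _ hij' s
  · rw [fixedPoint_of_lt hi, fixedPoint_of_le hj]
    exact h.symm.mul_pow_ne_mul_pow _ _ s
  · rw [fixedPoint_of_le hi, fixedPoint_of_lt hj]
    exact h.mul_pow_ne_mul_pow _ _ s
  · rw [fixedPoint_of_le hi, fixedPoint_of_le hj]
    exact h.mul_pow_ne h.a₁_ne _ _ (by omega) s

lemma Inequivalent.injective {q : ℂ} {k : ℕ} {x : Fin k → ℂ} (h : Inequivalent q x) :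
    Function.Injective x := by
  intro i j e
  by_contra hij
  exact h.2 i j hij 0 (by simpa using e)

lemma exists_comp_perm_eq {k : ℕ} {x y : Fin k → ℂ} (hy : Function.Injective y)
    (h : ∀ i, y i ∈ Set.range x) : ∃ σ : Equiv.Perm (Fin k), y = x ∘ σ := by
  choose σ hσ using h
  have hinj : Function.Injective σ := fun i j e => hy (by rw [← hσ i, ← hσ j, e])
  exact ⟨Equiv.ofBijective σ (Finite.injective_iff_bijective.1 hinj), funext fun i => (hσ i).symm⟩

lemma perm_eq_one_of_le (τ : Equiv.Perm (Fin m)) (h : ∀ t, t ≤ τ t) : τ = 1 := by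
  have hsum : ∑ t, ((τ t : Fin m) : ℕ) = ∑ t : Fin m, (t : ℕ) :=
    Equiv.sum_comp τ fun t : Fin m => (t : ℕ)
  have h1 := (Finset.sum_eq_sum_iff_of_le (fun t (_ : t ∈ Finset.univ) => Fin.le_def.1 (h t))).1
    hsum.symm
  ext t
  exact (h1 t (Finset.mem_univ t)).symm

/-- A permutation with a nonzero contribution to the stable envelope at a fixed point keeps the
order of each of the two strings of points, and moves the string of the first site to the positions
of the first colour. -/
lemma le_of_envNum_fixedPoint_ne_zero (hq : 1 < ‖q₂‖) (hq₁ : q₁ ≠ 0) (h₁ : a₁ ≠ 0) (h₂ : a₂ ≠ 0)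
    {j l : ℕ} (σ : Equiv.Perm (Fin m))
    (h : envNum q₁ q₂ ![K₁, K₂] ![a₁, a₂] z ![j, m - j] (fixedPoint q₁ a₁ a₂ m l ∘ σ) ≠ 0) :
    (∀ t : Fin m, (t : ℕ) < m - l → (t : ℕ) ≤ σ.symm t) ∧
      ∀ t : Fin m, m - l ≤ (t : ℕ) → m - j + ((t : ℕ) - (m - l)) ≤ σ.symm t := by
  have hq' := norm_inv_lt_one_of_one_lt hq
  set x := fixedPoint q₁ a₁ a₂ m l with hx
  have hx0 : ∀ t, x t ≠ 0 := fixedPoint_ne_zero hq₁ h₁ h₂ l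
  rw [envNum, mul_ne_zero_iff, Finset.prod_ne_zero_iff, Finset.prod_ne_zero_iff] at h
  obtain ⟨hpair, hone⟩ := h
  have horder : ∀ t t' : Fin m, x t' = q₁ * x t → t ≠ t' → σ.symm t < σ.symm t' := by
    intro t t' e hne
    by_contra! hle
    have hlt : σ.symm t' < σ.symm t := lt_of_le_of_ne hle (σ.symm.injective.ne hne.symm)
    have h1 := Finset.prod_ne_zero_iff.1 (hpair (σ.symm t') (Finset.mem_univ _)) (σ.symm t)
      (Finset.mem_Ioi.2 hlt)
    refine right_ne_zero_of_mul h1 ?_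
    simp only [Function.comp_apply, Equiv.apply_symm_apply]
    rw [← e, div_self (hx0 t'), theta_one hq']
  have hcol : ∀ t : Fin m, x t = a₁ → m - j ≤ σ.symm t := by
    intro t e
    by_contra! hlt
    have h1 := Finset.prod_ne_zero_iff.1 (hone 1 (Finset.mem_univ _)) (σ.symm t)
      (Finset.mem_filter.2 ⟨Finset.mem_univ _, (hasColour_two_one j _).2 hlt⟩)
    rw [envFactor_two_one] at h1
    refine left_ne_zero_of_mul h1 ?_
    simp only [Function.comp_apply, Equiv.apply_symm_apply]
    rw [e, div_self h₁, theta_one hq']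
  constructor
  · have key : ∀ s : ℕ, ∀ t : Fin m, (t : ℕ) = s → (t : ℕ) < m - l → (t : ℕ) ≤ σ.symm t := by
      intro s
      induction s with
      | zero => intro t ht _; omega
      | succ s ih =>
        intro t ht htl
        have hs : s < m := by have := t.2; omega
        have h1 := ih ⟨s, hs⟩ rfl (by simp only; omega)
        have h2 := horder ⟨s, hs⟩ t (by
          rw [hx, fixedPoint_of_lt htl, fixedPoint_of_lt (by simp only; omega), ht, pow_succ]
          ring) (fun e => by rw [← e] at ht; simp at ht)
        rw [Fin.lt_def] at h2
        simp only at h1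
        omega
    exact fun t => key t t rfl
  · have key : ∀ s : ℕ, ∀ t : Fin m, (t : ℕ) = m - l + s → m - j + s ≤ σ.symm t := by
      intro s
      induction s with
      | zero =>
        intro t ht
        refine hcol t ?_
        rw [hx, fixedPoint_of_le (by omega), ht]
        simp
      | succ s ih =>
        intro t ht
        have hs : m - l + s < m := by have := t.2; omega
        have h1 := ih ⟨m - l + s, hs⟩ rfl
        have h2 := horder ⟨m - l + s, hs⟩ t (by
          rw [hx, fixedPoint_of_le (by omega), fixedPoint_of_le (by simp only; omega), ht]
          simp only [Nat.add_sub_cancel_left, pow_succ]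
          ring) (fun e => by rw [← e] at ht; simp at ht)
        rw [Fin.lt_def] at h2
        omega
    exact fun t ht => key _ t (by omega)

/-- The triangularity of the stable envelope: it vanishes at the fixed point with `l` variables at
the first site if its component has fewer than `l` of them, since no permutation contributes. -/
lemma antiNum_fixedPoint_eq_zero (hq : 1 < ‖q₂‖) (hq₁ : q₁ ≠ 0) (h₁ : a₁ ≠ 0) (h₂ : a₂ ≠ 0)
    {j l : ℕ} (hl : l ≤ m) (hjl : j < l) :
    antiNum q₁ q₂ ![K₁, K₂] ![a₁, a₂] z ![j, m - j] (fixedPoint q₁ a₁ a₂ m l) = 0 := by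
  refine Finset.sum_eq_zero fun σ _ => ?_
  by_contra hne
  have h := (le_of_envNum_fixedPoint_ne_zero hq hq₁ h₁ h₂ σ (right_ne_zero_of_mul hne)).2
    ⟨m - 1, by omega⟩ (by simp only; omega)
  have h2 := (σ.symm ⟨m - 1, by omega⟩).2
  simp only at h
  omega

/-- At its own fixed point the stable envelope has only the contribution of the identity
permutation, whose factors are nonzero by genericity. -/
lemma GenericPair.antiNum_fixedPoint_ne_zero (h : GenericPair q₁ q₂ a₁ a₂ K₁ K₂ z)
    {j : ℕ} (hj : j ≤ m) :
    antiNum q₁ q₂ ![K₁, K₂] ![a₁, a₂] z ![j, m - j] (fixedPoint q₁ a₁ a₂ m j) ≠ 0 := by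
  have hq₁ := h.q₁_ne
  have h₁ := h.a₁_ne
  have h₂ := h.a₂_ne
  have hK₁ := h.K₁_ne
  have hK₂ := h.K₂_ne
  have hz := h.z_ne
  have hx0 := fixedPoint_ne_zero (m := m) hq₁ h₁ h₂ j
  rw [antiNum, Finset.sum_eq_single 1]
  · simp only [Equiv.Perm.sign_one, Units.val_one, Int.cast_one, one_mul, Equiv.Perm.coe_one,
      Function.comp_id]
    rw [envNum, mul_ne_zero_iff]
    constructor
    · refine Finset.prod_ne_zero_iff.2 fun i _ => Finset.prod_ne_zero_iff.2 fun i' hi' => ?_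
      rw [Finset.mem_Ioi, Fin.lt_def] at hi'
      refine mul_ne_zero (hx0 i) (theta_ne_zero_of_ne_zpow h.one_lt
        (div_ne_zero (mul_ne_zero hq₁ (hx0 i')) (hx0 i)) fun t e => ?_)
      rw [div_eq_iff (hx0 i)] at e
      rcases lt_or_ge (i : ℕ) (m - j) with hi | hi <;>
        rcases lt_or_ge (i' : ℕ) (m - j) with hi2 | hi2
      · rw [fixedPoint_of_lt hi, fixedPoint_of_lt hi2] at e
        refine h.mul_pow_ne h₂ (i' + 1) i (by omega) (-t) ?_
        rw [inv_zpow, zpow_neg, inv_inv, ← e]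
        ring
      · rw [fixedPoint_of_lt hi, fixedPoint_of_le hi2] at e
        refine h.mul_pow_ne_mul_pow (i' - (m - j) + 1) i (-t) ?_
        rw [inv_zpow, zpow_neg, inv_inv, ← e]
        ring
      · omega
      · rw [fixedPoint_of_le hi, fixedPoint_of_le hi2] at e
        refine h.mul_pow_ne h₁ (i' - (m - j) + 1) (i - (m - j)) (by omega) (-t) ?_
        rw [inv_zpow, zpow_neg, inv_inv, ← e]
        ring
    · refine Finset.prod_ne_zero_iff.2 fun γ _ => Finset.prod_ne_zero_iff.2 fun i hi => ?_
      rw [Finset.mem_filter] at hi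
      have hr : rhoFactor q₁ i ≠ 0 := zpow_ne_zero _ hq₁
      fin_cases γ
      · have hi' := (hasColour_two_zero hj i).1 hi.2
        simp only [Fin.zero_eta]
        rw [envFactor_two_zero, fixedPoint_of_le hi']
        refine mul_ne_zero (theta_ne_zero_of_ne_zpow h.one_lt (by positivity) fun t e => ?_)
          (theta_ne_zero_of_ne_zpow h.one_lt (by positivity) fun t e => ?_)
        · refine h.zK_ne (((i - (m - j) : ℕ) : ℤ) - (2 * ((i : ℤ) + 1) - (m : ℤ) - 1)) t (-1) 0 ?_
          rw [zpow_sub₀ hq₁, zpow_natCast, ← e]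
          change _ = _ / rhoFactor q₁ i * _ * _
          rw [zpow_neg_one, zpow_zero]
          field_simp
        · refine h.Ka_ne' ((i - (m - j) : ℕ) : ℤ) t ?_
          rw [← e, zpow_natCast]
          field_simp
      · have hi' := (hasColour_two_one j i).1 hi.2
        simp only [Fin.mk_one]
        rw [envFactor_two_one, fixedPoint_of_lt hi']
        refine mul_ne_zero (theta_ne_zero_of_ne_zpow h.one_lt (by positivity) fun t e => ?_)
          (theta_ne_zero_of_ne_zpow h.one_lt (by positivity) fun t e => ?_)
        · refine h.a_ne (i : ℕ) t ?_
          rw [← e, zpow_natCast]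
          field_simp
        · refine h.zK_ne ((i : ℤ) - (2 * ((i : ℤ) + 1) - (m : ℤ) - 1)) t (-1) (-1) ?_
          rw [zpow_sub₀ hq₁, zpow_natCast, ← e]
          change _ = _ / rhoFactor q₁ i * _ * _
          rw [zpow_neg_one, zpow_neg_one]
          field_simp
  · intro σ _ hσ
    by_contra hne
    refine hσ ?_
    have h' := le_of_envNum_fixedPoint_ne_zero h.one_lt hq₁ h₁ h₂ σ (right_ne_zero_of_mul hne)
    have h1 : σ.symm = 1 := perm_eq_one_of_le _ fun t => by
      rw [Fin.le_def]
      rcases lt_or_ge (t : ℕ) (m - j) with ht | ht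
      · exact h'.1 t ht
      · have := h'.2 t ht
        omega
    rw [← inv_inv σ]
    change (σ.symm)⁻¹ = 1
    rw [h1, inv_one]
  · simp

variable (q₁ q₂ a₁ a₂ K₁ K₂ z m)

/-- The values of the antisymmetrized stable envelopes of the chamber `12` at the fixed points. -/
noncomputable def antiMatrix : Matrix (Fin (m + 1)) (Fin (m + 1)) ℂ :=
  Matrix.of fun j l =>
    antiNum q₁ q₂ ![K₁, K₂] ![a₁, a₂] z ![(j : ℕ), m - (j : ℕ)] (fixedPoint q₁ a₁ a₂ m l)

/-- The values of the antisymmetrized stable envelopes of the chamber `21` at the fixed points. Rows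
and columns are indexed by the number of variables at the site `1`. -/
noncomputable def antiMatrixRev : Matrix (Fin (m + 1)) (Fin (m + 1)) ℂ :=
  Matrix.of fun j l =>
    antiNum q₁ q₂ ![K₂, K₁] ![a₂, a₁] z ![m - (j : ℕ), (j : ℕ)] (fixedPoint q₁ a₁ a₂ m l)

variable {q₁ q₂ a₁ a₂ K₁ K₂ z m}

/-- The fixed points of the two chambers are the same up to the order of the variables. -/
lemma GenericPair.exists_fixedPoint_eq (h : GenericPair q₁ q₂ a₁ a₂ K₁ K₂ z) {l : ℕ} (hl : l ≤ m) :
    ∃ σ : Equiv.Perm (Fin m),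
      fixedPoint q₁ a₁ a₂ m l = fixedPoint q₁ a₂ a₁ m (m - l) ∘ σ := by
  refine exists_comp_perm_eq (h.inequivalent_fixedPoint l).injective fun t => ?_
  rcases lt_or_ge (t : ℕ) (m - l) with ht | ht
  · refine ⟨⟨l + t, by omega⟩, ?_⟩
    rw [fixedPoint_of_lt ht, fixedPoint_of_le (by simp only; omega)]
    congr 2
    simp only
    omega
  · have := t.2
    refine ⟨⟨t - (m - l), by omega⟩, ?_⟩
    rw [fixedPoint_of_le ht, fixedPoint_of_lt (by simp only; omega)]

/-- The on-shell matrix of the chamber `21` is invertible, because it is triangular up to signs of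
its columns. -/
lemma GenericPair.det_antiMatrixRev_ne_zero (h : GenericPair q₁ q₂ a₁ a₂ K₁ K₂ z) :
    (antiMatrixRev q₁ q₂ a₁ a₂ K₁ K₂ z m).det ≠ 0 := by
  have hrow : ∀ j l : Fin (m + 1), ∃ c : ℂ, c ≠ 0 ∧ antiMatrixRev q₁ q₂ a₁ a₂ K₁ K₂ z m j l =
      c * antiNum q₁ q₂ ![K₂, K₁] ![a₂, a₁] z ![m - (j : ℕ), m - (m - (j : ℕ))]
        (fixedPoint q₁ a₂ a₁ m (m - l)) := by
    intro j l
    obtain ⟨σ, hσ⟩ := h.exists_fixedPoint_eq (m := m) (l := l) (by omega)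
    refine ⟨σ.sign, by simp, ?_⟩
    rw [antiMatrixRev, Matrix.of_apply, hσ, antiNum_comp, show m - (m - (j : ℕ)) = j by omega]
  rw [Matrix.det_of_isUpperTriangular]
  · refine Finset.prod_ne_zero_iff.2 fun j _ => ?_
    obtain ⟨c, hc, e⟩ := hrow j j
    rw [e]
    exact mul_ne_zero hc (h.symm.antiNum_fixedPoint_ne_zero (by omega))
  · intro j l hlj
    obtain ⟨c, -, e⟩ := hrow j l
    have hlj' : (l : ℕ) < j := hlj
    rw [e, antiNum_fixedPoint_eq_zero h.one_lt h.q₁_ne h.a₂_ne h.a₁_ne (by omega) (by omega),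
      mul_zero]

/-- The relation between the stable envelopes of the two chambers, which defines the `R`-matrix by
its values at the fixed points, holds at all points. -/
theorem GenericPair.antiNum_eq_sum (h : GenericPair q₁ q₂ a₁ a₂ K₁ K₂ z) (j : Fin (m + 1))
    {x : Fin m → ℂ} (hx : ∀ i, x i ≠ 0) :
    antiNum q₁ q₂ ![K₁, K₂] ![a₁, a₂] z ![(j : ℕ), m - (j : ℕ)] x =
      ∑ l, (antiMatrix q₁ q₂ a₁ a₂ K₁ K₂ z m * (antiMatrixRev q₁ q₂ a₁ a₂ K₁ K₂ z m)⁻¹) j l *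
        antiNum q₁ q₂ ![K₂, K₁] ![a₂, a₁] z ![m - (l : ℕ), (l : ℕ)] x := by
  set R := antiMatrix q₁ q₂ a₁ a₂ K₁ K₂ z m * (antiMatrixRev q₁ q₂ a₁ a₂ K₁ K₂ z m)⁻¹ with hR
  have hq := norm_inv_lt_one_of_one_lt h.one_lt
  have hq0 : q₂⁻¹ ≠ 0 := inv_ne_zero h.q₂_ne
  have hq20 := h.q₂_ne
  have hq₁ := h.q₁_ne
  have h₁ := h.a₁_ne
  have h₂ := h.a₂_ne
  have hK₁ := h.K₁_ne
  have hK₂ := h.K₂_ne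
  have hz := h.z_ne
  have two_ne : ∀ {b c : ℂ}, b ≠ 0 → c ≠ 0 → ∀ β : Fin 2, ![b, c] β ≠ 0 := by
    intro b c hb hc β
    fin_cases β <;> simpa
  have hK := two_ne hK₁ hK₂
  have hK' := two_ne hK₂ hK₁
  have ha := two_ne h₁ h₂
  have ha' := two_ne h₂ h₁
  have hsum : ∀ j : Fin (m + 1), ∑ γ, ![(j : ℕ), m - (j : ℕ)] γ = m := by
    intro j
    simp only [Fin.sum_univ_two, Matrix.cons_val_zero, Matrix.cons_val_one, Matrix.cons_val_fin_one]
    omega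
  have hsum' : ∀ j : Fin (m + 1), ∑ γ, ![m - (j : ℕ), (j : ℕ)] γ = m := by
    intro j
    simp only [Fin.sum_univ_two, Matrix.cons_val_zero, Matrix.cons_val_one, Matrix.cons_val_fin_one]
    omega
  have hdu : ∀ (x : Fin m → ℂ), (∀ i, x i ≠ 0) → ∀ i, ∀ w ≠ 0,
      (∀ l, DifferentiableAt ℂ (fun w => Function.update x i w l) w) ∧
        ∀ l, Function.update x i w l ≠ 0 := by
    intro x hx i w hw
    refine ⟨fun l => ?_, fun l => ?_⟩
    · rcases eq_or_ne l i with rfl | hl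
      · simp only [Function.update_self]
        fun_prop
      · simp only [Function.update_of_ne hl]
        fun_prop
    · rcases eq_or_ne l i with rfl | hl
      · simpa
      · simpa [hl] using hx l
  rw [← sub_eq_zero]
  refine eq_zero_of_vanishing hq hq0 (m := m) (A := fun i => a₁ * q₁ ^ i)
    (B := fun i => a₂ * q₁ ^ i)
    (C := z * (K₁ * a₁ * (K₂ * a₂)) * q₂ ^ 2)
    (f := fun x => antiNum q₁ q₂ ![K₁, K₂] ![a₁, a₂] z ![(j : ℕ), m - (j : ℕ)] x -
      ∑ l, R j l * antiNum q₁ q₂ ![K₂, K₁] ![a₂, a₁] z ![m - (l : ℕ), (l : ℕ)] x)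
    (fun i => by positivity) (fun i => by positivity)
    (fun i j hij s => h.mul_pow_ne h₁ i j hij s) (fun i j hij s => h.mul_pow_ne h₂ i j hij s)
    (fun i j s => h.mul_pow_ne_mul_pow i j s) (by positivity) ?_ ?_ ?_ ?_ ?_ x hx
  · intro i i' s e
    refine h.zK_ne ((i : ℤ) + i') (-s - 2) (-1) (-1) ?_
    rw [zpow_add₀ hq₁, zpow_natCast, zpow_natCast, zpow_sub₀ hq20, zpow_neg, ← inv_zpow,
      zpow_neg_one, zpow_neg_one, zpow_ofNat]
    refine mul_right_cancel₀ (b := K₁ * a₁ * (K₂ * a₂) * q₂ ^ 2) (by positivity) ?_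
    rw [← mul_assoc, e]
    generalize q₂⁻¹ ^ s = T
    field_simp
  · intro x hx i w hw
    obtain ⟨hd1, hd2⟩ := hdu x hx i w hw
    refine DifferentiableAt.sub ?_ (DifferentiableAt.fun_sum fun l _ => ?_)
    · exact differentiableAt_antiNum (Z := fun _ => z) (Q := fun _ => q₁)
        (L := fun _ => ![K₁, K₂]) hq hz ha (differentiableAt_const _) (by fun_prop)
        (fun β => by fun_prop) hd1 hq₁ hK hd2
    · exact (differentiableAt_antiNum (Z := fun _ => z) (Q := fun _ => q₁)
        (L := fun _ => ![K₂, K₁]) hq hz ha' (differentiableAt_const _) (by fun_prop)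
        (fun β => by fun_prop) hd1 hq₁ hK' hd2).const_mul _
  · intro x hx i
    rw [antiNum_update (hsum j) hq hq0 hq₁ hz hK ha hx i, mul_sub, Finset.mul_sum]
    congr 1
    · simp only [Fin.prod_univ_two, Matrix.cons_val_zero, Matrix.cons_val_one,
        Matrix.cons_val_fin_one, mul_inv, inv_inv]
      ring
    · refine Finset.sum_congr rfl fun l _ => ?_
      rw [antiNum_update (hsum' l) hq hq0 hq₁ hz hK' ha' hx i]
      simp only [Fin.prod_univ_two, Matrix.cons_val_zero, Matrix.cons_val_one,
        Matrix.cons_val_fin_one, mul_inv, inv_inv]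
      ring
  · intro x σ
    simp only [antiNum_comp]
    rw [mul_sub, Finset.mul_sum]
    congr 1
    exact Finset.sum_congr rfl fun l _ => by ring
  · intro s t hst x hx hA hB
    obtain ⟨σ, hσ⟩ : ∃ σ : Equiv.Perm (Fin m), fixedPoint q₁ a₁ a₂ m s = x ∘ σ := by
      refine exists_comp_perm_eq (h.inequivalent_fixedPoint s).injective fun i => ?_
      rcases lt_or_ge (i : ℕ) (m - s) with hi | hi
      · rw [fixedPoint_of_lt hi]
        exact hB _ (by omega)
      · rw [fixedPoint_of_le hi]
        exact hA _ (by have := i.2; omega)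
    have h3 : R * antiMatrixRev q₁ q₂ a₁ a₂ K₁ K₂ z m = antiMatrix q₁ q₂ a₁ a₂ K₁ K₂ z m := by
      rw [hR, Matrix.mul_assoc, Matrix.nonsing_inv_mul _ (isUnit_iff_ne_zero.2
        h.det_antiMatrixRev_ne_zero), Matrix.mul_one]
    have h4 := congrFun (congrFun h3 j) ⟨s, by omega⟩
    rw [Matrix.mul_apply] at h4
    simp only [antiMatrix, antiMatrixRev, Matrix.of_apply, hσ, antiNum_comp] at h4
    have h5 : ((σ.sign : ℤ) : ℂ) ≠ 0 := by simp
    refine mul_left_cancel₀ h5 ?_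
    rw [mul_zero, mul_sub, ← h4, Finset.mul_sum, sub_eq_zero]
    exact Finset.sum_congr rfl fun l _ => by ring

/-- The `R`-matrix in terms of the antisymmetrized stable envelopes. -/
lemma GenericPair.twoSiteR_mul_stabConst (h : GenericPair q₁ q₂ a₁ a₂ K₁ K₂ z)
    (hK₁ : ∀ t : ℤ, K₁ ≠ q₂ ^ t) (hK₂ : ∀ t : ℤ, K₂ ≠ q₂ ^ t) (j l : Fin (m + 1)) :
    twoSiteR q₁ q₂ a₁ a₂ K₁ K₂ m z j l *
        stabConst m q₁ q₂ ![K₂, K₁] z ![m - (l : ℕ), (l : ℕ)] =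
      stabConst m q₁ q₂ ![K₁, K₂] z ![(j : ℕ), m - (j : ℕ)] *
        (antiMatrix q₁ q₂ a₁ a₂ K₁ K₂ z m * (antiMatrixRev q₁ q₂ a₁ a₂ K₁ K₂ z m)⁻¹) j l := by
  have hq := norm_inv_lt_one_of_one_lt h.one_lt
  have hq0 : q₂⁻¹ ≠ 0 := inv_ne_zero h.q₂_ne
  set v : Fin (m + 1) → ℂ := fun l => (thetaVandermonde q₂⁻¹ (fixedPoint q₁ a₁ a₂ m l))⁻¹ with hv
  have hv0 : ∀ l, v l ≠ 0 := fun l =>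
    inv_ne_zero (thetaVandermonde_ne_zero hq hq0 (h.inequivalent_fixedPoint l))
  set c := fun j : Fin (m + 1) => stabConst m q₁ q₂ ![K₁, K₂] z ![(j : ℕ), m - (j : ℕ)] with hc
  set c' := fun j : Fin (m + 1) => stabConst m q₁ q₂ ![K₂, K₁] z ![m - (j : ℕ), (j : ℕ)] with hc'
  have hc0 : ∀ j, c' j ≠ 0 := by
    intro j
    refine Finset.prod_ne_zero_iff.2 fun γ _ => Finset.prod_ne_zero_iff.2 fun i _ =>
      div_ne_zero ?_ ?_
    · fin_cases γ
      · exact theta_ne_zero_of_ne_zpow h.one_lt h.K₂_ne hK₂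
      · exact theta_ne_zero_of_ne_zpow h.one_lt h.K₁_ne hK₁
    · have hr : rhoFactor q₁ i ≠ 0 := zpow_ne_zero _ h.q₁_ne
      have hz := h.z_ne
      have h1 := h.K₁_ne
      have h2 := h.K₂_ne
      have hd : ∀ e₁ e₂ : ℤ, theta (z * rhoFactor q₁ i * (K₁ ^ e₁ * K₂ ^ e₂)) q₂⁻¹ ≠ 0 := by
        intro e₁ e₂
        have h3 := zpow_ne_zero e₁ h1
        have h4 := zpow_ne_zero e₂ h2
        refine theta_ne_zero_of_ne_zpow h.one_lt (by positivity) fun t e => ?_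
        refine h.zK_ne (-(2 * ((i : ℤ) + 1) - (m : ℤ) - 1)) t (-e₁) (-e₂) ?_
        rw [zpow_neg, ← e, zpow_neg, zpow_neg]
        change _ = (rhoFactor q₁ i)⁻¹ * _ * _
        field_simp
      have h1 : Finset.Iic (1 : Fin 2) = {0, 1} := rfl
      have h3 : Finset.Iic (0 : Fin 2) = {0} := rfl
      fin_cases γ
      · simpa [KProd, h3] using hd 0 1
      · simpa [KProd, h1, mul_comm K₁] using hd 1 1
  have hM : onShell q₁ q₂ a₁ a₂ K₁ K₂ m z =
      Matrix.diagonal c * antiMatrix q₁ q₂ a₁ a₂ K₁ K₂ z m * Matrix.diagonal v := by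
    ext j l
    rw [Matrix.mul_diagonal, Matrix.diagonal_mul, onShell, antiMatrix, Matrix.of_apply,
      Matrix.of_apply, ← stabNum_mul_thetaVandermonde hq hq0 (h.inequivalent_fixedPoint l)]
    have := thetaVandermonde_ne_zero hq hq0 (h.inequivalent_fixedPoint (m := m) l)
    simp only [hv]
    rw [← mul_assoc, mul_assoc _ _ (_)⁻¹, mul_inv_cancel₀ this, mul_one]
  have hM' : (onShell q₁ q₂ a₂ a₁ K₂ K₁ m z).submatrix Fin.rev Fin.rev =
      Matrix.diagonal c' * antiMatrixRev q₁ q₂ a₁ a₂ K₁ K₂ z m * Matrix.diagonal v := by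
    ext j l
    have hj : ((Fin.rev j : Fin (m + 1)) : ℕ) = m - j := by rw [Fin.val_rev]; omega
    have hl : ((Fin.rev l : Fin (m + 1)) : ℕ) = m - l := by rw [Fin.val_rev]; omega
    have hj' : m - (m - (j : ℕ)) = j := by omega
    obtain ⟨σ, hσ⟩ := h.exists_fixedPoint_eq (m := m) (l := l) (by omega)
    have := thetaVandermonde_ne_zero hq hq0 (h.inequivalent_fixedPoint (m := m) l)
    rw [Matrix.mul_diagonal, Matrix.diagonal_mul, Matrix.submatrix_apply, onShell, antiMatrixRev,
      Matrix.of_apply, Matrix.of_apply, hj, hl, hj',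
      ← stabNum_mul_thetaVandermonde hq hq0 (h.inequivalent_fixedPoint l)]
    simp only [hv]
    rw [← mul_assoc, mul_assoc _ _ (_)⁻¹, mul_inv_cancel₀ this, mul_one, hσ, stabNum_comp]
  have hdu : ∀ {w : Fin (m + 1) → ℂ}, (∀ l, w l ≠ 0) → IsUnit (Matrix.diagonal w).det := by
    intro w hw
    rw [Matrix.det_diagonal, isUnit_iff_ne_zero]
    exact Finset.prod_ne_zero_iff.2 fun l _ => hw l
  have key : twoSiteR q₁ q₂ a₁ a₂ K₁ K₂ m z * Matrix.diagonal c' = Matrix.diagonal c *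
      (antiMatrix q₁ q₂ a₁ a₂ K₁ K₂ z m * (antiMatrixRev q₁ q₂ a₁ a₂ K₁ K₂ z m)⁻¹) := by
    rw [twoSiteR, hM, hM', Matrix.mul_inv_rev, Matrix.mul_inv_rev]
    simp only [Matrix.mul_assoc]
    rw [Matrix.nonsing_inv_mul _ (hdu hc0), Matrix.mul_one, ← Matrix.mul_assoc (Matrix.diagonal v),
      Matrix.mul_nonsing_inv _ (hdu hv0), Matrix.one_mul]
  have := congrFun (congrFun key j) l
  rwa [Matrix.mul_diagonal, Matrix.diagonal_mul] at this

end TwoSites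


/-! ### The integrand of the block without removable singularities -/

section RegularIntegrand

variable {n k : ℕ}

/-- The factor of the integrand that belongs to a pair of positions `i < j` with the values `x`
and `y` of the variables. -/
noncomputable def regPair (q₁ q₂ p x y : ℂ) : ℂ :=
  theta (x / y) p * ellGamma (p * (q₁ * y / x)) q₂⁻¹ p * ellGamma (q₁ * x / y) q₂⁻¹ p

/-- The factor of the integrand that belongs to a variable of colour `γ` in the position `i` with
the value `w`. -/
noncomputable def regSite (q₁ q₂ p : ℂ) (K a : Fin n → ℂ) (z : ℂ) (γ : Fin n) (i : Fin k)
    (w : ℂ) : ℂ :=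
  (∏ β ∈ Finset.Iio γ,
      ellGamma (p * (a β / w)) q₂⁻¹ p * (ellGamma (p * (K β * a β / w)) q₂⁻¹ p)⁻¹) *
    (theta (z * rhoFactor q₁ i * KProd K γ * a γ / w) q₂⁻¹ * ellGamma (a γ / w) q₂⁻¹ p *
      (ellGamma (p * (K γ * a γ / w)) q₂⁻¹ p)⁻¹) *
    ∏ β ∈ Finset.Ioi γ, ellGamma (a β / w) q₂⁻¹ p * (ellGamma (K β * a β / w) q₂⁻¹ p)⁻¹

/-- The summand `Φ S` of the integrand of the block, with the removable singularities removed: it is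
holomorphic on the tori with admissible radii. -/
noncomputable def regIntegrand (q₁ q₂ p : ℂ) (K a : Fin n → ℂ) (z : ℂ) (κ : Fin n → ℕ)
    (x : Fin k → ℂ) : ℂ :=
  (∏ i, ∏ j ∈ Finset.Ioi i, regPair q₁ q₂ p (x i) (x j)) *
    ∏ γ, ∏ i : Fin k with HasColour κ i γ, regSite q₁ q₂ p K a z γ i (x i)

/-- `w` is not of the form `0` or `q^s p^t`. -/
def OffLattice (q p w : ℂ) : Prop := w ≠ 0 ∧ ∀ s t : ℤ, w ≠ q ^ s * p ^ t

section OffLattice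

variable {q p w : ℂ}

lemma OffLattice.mul (h : OffLattice q p w) (hq0 : q ≠ 0) (hp0 : p ≠ 0) (s t : ℤ) :
    OffLattice q p (q ^ s * p ^ t * w) := by
  refine ⟨mul_ne_zero (mul_ne_zero (zpow_ne_zero _ hq0) (zpow_ne_zero _ hp0)) h.1,
    fun s' t' e => h.2 (s' - s) (t' - t) ?_⟩
  rw [zpow_sub₀ hq0, zpow_sub₀ hp0]
  have := zpow_ne_zero s hq0
  have := zpow_ne_zero t hp0
  field_simp
  linear_combination e

lemma OffLattice.inv (h : OffLattice q p w) : OffLattice q p w⁻¹ :=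
  ⟨inv_ne_zero h.1, fun s t e => h.2 (-s) (-t) (by
    rw [← inv_inv w, e, mul_inv, zpow_neg, zpow_neg])⟩

lemma OffLattice.qPoch_ne_zero (h : OffLattice q p w) (hq : ‖q‖ < 1) : qPoch w q ≠ 0 := by
  refine EllipticQKZ.qPoch_ne_zero hq fun m e => h.2 (-m) 0 ?_
  rw [zpow_neg, zpow_natCast, zpow_zero, mul_one]
  exact eq_inv_of_mul_eq_one_left e

lemma OffLattice.qPoch₂_ne_zero (h : OffLattice q p w) (hq : ‖q‖ < 1) (hp : ‖p‖ < 1) :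
    qPoch₂ w q p ≠ 0 := by
  refine EllipticQKZ.qPoch₂_ne_zero hq hp fun s t e => h.2 (-s) (-t) ?_
  rw [zpow_neg, zpow_natCast, zpow_neg, zpow_natCast, ← mul_inv]
  exact eq_inv_of_mul_eq_one_left e

lemma OffLattice.theta_ne_zero (h : OffLattice q p w) (hq : ‖q‖ < 1) (hq0 : q ≠ 0) :
    theta w q ≠ 0 := by
  intro h0
  obtain ⟨s, hs⟩ := (theta_eq_zero_iff hq hq0 h.1).1 h0
  exact h.2 s 0 (by simpa using hs)

lemma OffLattice.ellGamma_mul (h : OffLattice q p w) (hq : ‖q‖ < 1) (hp : ‖p‖ < 1) (hp0 : p ≠ 0) :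
    ellGamma (p * w) q p = theta w q * ellGamma w q p :=
  EllipticQKZ.ellGamma_mul hq hp hp0 h.1 (h.qPoch_ne_zero hq)

lemma OffLattice.theta_eq (h : OffLattice q p w) (hq : ‖q‖ < 1) (hp : ‖p‖ < 1) (hq0 : q ≠ 0)
    (hp0 : p ≠ 0) :
    theta w⁻¹ p = (ellGamma (p * w) q p * ellGamma w⁻¹ q p)⁻¹ := by
  refine theta_eq_inv_ellGamma_mul hq hp hq0 hp0 h.1 ?_ ?_
  · have := (h.inv.mul hq0 hp0 1 0).qPoch₂_ne_zero hq hp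
    simpa [div_eq_mul_inv] using this
  · have := (h.mul hq0 hp0 1 1).qPoch₂_ne_zero hq hp
    simpa using this

end OffLattice

/-- The points at which none of the special functions in the integrand has a zero or a pole. -/
structure GenericPoint (q₁ q₂ p : ℂ) (K a : Fin n → ℂ) (x : Fin k → ℂ) : Prop where
  ratio : ∀ i j, i ≠ j → OffLattice q₂⁻¹ p (x j / x i)
  ratio' : ∀ i j, i ≠ j → OffLattice q₂⁻¹ p (q₁ * x j / x i)
  site : ∀ i β, OffLattice q₂⁻¹ p (a β / x i)
  site' : ∀ i β, OffLattice q₂⁻¹ p (K β * a β / x i)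

lemma GenericPoint.comp {q₁ q₂ p : ℂ} {K a : Fin n → ℂ} {x : Fin k → ℂ}
    (h : GenericPoint q₁ q₂ p K a x) (σ : Equiv.Perm (Fin k)) :
    GenericPoint q₁ q₂ p K a (x ∘ σ) where
  ratio _ _ hij := h.ratio _ _ (σ.injective.ne hij)
  ratio' _ _ hij := h.ratio' _ _ (σ.injective.ne hij)
  site _ := h.site _
  site' _ := h.site' _

variable {q₁ q₂ p z : ℂ} {K a : Fin n → ℂ} {κ : Fin n → ℕ}

lemma principalPart_comp (x : Fin k → ℂ) (σ : Equiv.Perm (Fin k)) :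
    principalPart q₁ q₂ p K a (x ∘ σ) = principalPart q₁ q₂ p K a x := by
  unfold principalPart
  congr 1
  · rw [← Equiv.prod_comp σ (fun i => ∏ j ∈ Finset.univ.erase i,
      ellGamma (q₁ * x j / x i) q₂⁻¹ p / ellGamma (x j / x i) q₂⁻¹ p)]
    refine Finset.prod_congr rfl fun i _ => Finset.prod_equiv σ (fun j => ?_) fun j _ => rfl
    simp
  · exact Equiv.prod_comp σ (fun i => ∏ β, ellGamma (a β / x i) q₂⁻¹ p /
      ellGamma (K β * a β / x i) q₂⁻¹ p)

lemma stabDenom_comp (x : Fin k → ℂ) (σ : Equiv.Perm (Fin k)) :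
    stabDenom q₂ K a (x ∘ σ) = stabDenom q₂ K a x :=
  Equiv.prod_comp σ (fun i => ∏ β, theta (K β * a β / x i) q₂⁻¹)

/-- At generic points, the principal part times one summand of the stable envelope is
`regIntegrand`: the theta functions are absorbed by `Γ(p w) = θ(w) Γ(w)`. -/
lemma regIntegrand_eq (hκ : ∑ γ, κ γ = k) (hq : ‖q₂⁻¹‖ < 1) (hq0 : q₂⁻¹ ≠ 0) (hp : ‖p‖ < 1)
    (hp0 : p ≠ 0) {x : Fin k → ℂ} (h : GenericPoint q₁ q₂ p K a x) :
    principalPart q₁ q₂ p K a x * (stabSummand q₁ q₂ K a z κ x / stabDenom q₂ K a x) =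
      regIntegrand q₁ q₂ p K a z κ x := by
  obtain ⟨c, hc⟩ := exists_colour hκ
  have hpair : (∏ i, ∏ j ∈ Finset.univ.erase i,
        ellGamma (q₁ * x j / x i) q₂⁻¹ p / ellGamma (x j / x i) q₂⁻¹ p) *
      (∏ i, ∏ j ∈ Finset.Ioi i, theta (q₁ * x j / x i) q₂⁻¹ / theta (x j / x i) q₂⁻¹) =
      ∏ i, ∏ j ∈ Finset.Ioi i, regPair q₁ q₂ p (x i) (x j) := by
    have h1 := Finset.prod_prod_Ioi_mul_eq_prod_prod_off_diag (fun j i : Fin k =>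
      ellGamma (q₁ * x j / x i) q₂⁻¹ p / ellGamma (x j / x i) q₂⁻¹ p)
    simp_rw [← Finset.compl_singleton, ← h1, ← Finset.prod_mul_distrib]
    refine Finset.prod_congr rfl fun i _ => Finset.prod_congr rfl fun j hj => ?_
    have hij := (Finset.mem_Ioi.1 hj).ne
    have e := (h.ratio i j hij).theta_eq hq hp hq0 hp0
    rw [inv_div] at e
    rw [regPair, e, (h.ratio i j hij).ellGamma_mul hq hp hp0,
      (h.ratio' i j hij).ellGamma_mul hq hp hp0]
    simp only [div_eq_mul_inv, mul_inv]
    ring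
  have hsite : ∀ i, (∏ β, ellGamma (a β / x i) q₂⁻¹ p / ellGamma (K β * a β / x i) q₂⁻¹ p) *
      (envFactor q₁ q₂ K a z (c i) i (x i) / ∏ β, theta (K β * a β / x i) q₂⁻¹) =
      regSite q₁ q₂ p K a z (c i) i (x i) := by
    intro i
    have e1 : ∀ β, ellGamma (p * (a β / x i)) q₂⁻¹ p * (ellGamma (p * (K β * a β / x i)) q₂⁻¹ p)⁻¹ =
        (ellGamma (a β / x i) q₂⁻¹ p / ellGamma (K β * a β / x i) q₂⁻¹ p) *
          (theta (a β / x i) q₂⁻¹ * (theta (K β * a β / x i) q₂⁻¹)⁻¹) := by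
      intro β
      rw [(h.site i β).ellGamma_mul hq hp hp0, (h.site' i β).ellGamma_mul hq hp hp0, mul_inv,
        div_eq_mul_inv]
      ring
    have e2 : ∀ β, ellGamma (a β / x i) q₂⁻¹ p * (ellGamma (K β * a β / x i) q₂⁻¹ p)⁻¹ =
        (ellGamma (a β / x i) q₂⁻¹ p / ellGamma (K β * a β / x i) q₂⁻¹ p) *
          (theta (K β * a β / x i) q₂⁻¹ * (theta (K β * a β / x i) q₂⁻¹)⁻¹) := by
      intro β
      rw [mul_inv_cancel₀ ((h.site' i β).theta_ne_zero hq hq0), mul_one]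
      exact (div_eq_mul_inv _ _).symm
    rw [regSite, Finset.prod_congr rfl fun β _ => e1 β, Finset.prod_congr rfl fun β _ => e2 β,
      (h.site' i (c i)).ellGamma_mul hq hp hp0, envFactor, prod_Iio_mul_prod_Ioi _ (c i),
      prod_Iio_mul_prod_Ioi (fun β => theta (K β * a β / x i) q₂⁻¹) (c i)]
    simp only [Finset.prod_mul_distrib, div_eq_mul_inv, mul_inv, Finset.prod_inv_distrib]
    ring
  rw [principalPart, stabSummand_eq_mul, stabDenom, regIntegrand, ← hpair, prod_prod_hasColour hc,
    prod_prod_hasColour hc, ← Finset.prod_congr rfl fun i _ => hsite i, Finset.prod_mul_distrib,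
    Finset.prod_div_distrib]
  ring

variable {E : Type*} [NormedAddCommGroup E] [NormedSpace ℂ E] {e : E}

lemma DifferentiableAt.ellGamma_comp {q : ℂ} (hq : ‖q‖ < 1) (hp : ‖p‖ < 1) {f : E → ℂ}
    (hf : DifferentiableAt ℂ f e) (h0 : f e ≠ 0) (h1 : ‖f e‖ < 1) :
    DifferentiableAt ℂ (fun e => ellGamma (f e) q p) e :=
  (differentiableAt_ellGamma hq hp h0 (qPoch₂_ne_zero_of_norm_lt hq hp h1)).comp e hf

lemma DifferentiableAt.inv_ellGamma_comp {q : ℂ} (hq : ‖q‖ < 1) (hp : ‖p‖ < 1) {f : E → ℂ}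
    (hf : DifferentiableAt ℂ f e) (h0 : f e ≠ 0) (h1 : ‖q * p / f e‖ < 1) :
    DifferentiableAt ℂ (fun e => (ellGamma (f e) q p)⁻¹) e :=
  (differentiableAt_inv_ellGamma hq hp h0 (qPoch₂_ne_zero_of_norm_lt hq hp h1)).comp e hf

/-- The integrand is holomorphic, jointly in the variables and the parameters `q₁`, `K`, where the
absolute values of the variables are admissible. -/
lemma differentiableAt_regIntegrand {Q : E → ℂ} {L : E → Fin n → ℂ} {X : E → Fin k → ℂ}
    (hq : ‖q₂⁻¹‖ < 1) (hq0 : q₂⁻¹ ≠ 0) (hp : ‖p‖ < 1)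
    (hp0 : p ≠ 0) (hz : z ≠ 0) (ha : ∀ β, a β ≠ 0)
    (hQ : DifferentiableAt ℂ Q e) (hL : ∀ β, DifferentiableAt ℂ (fun e => L e β) e)
    (hX : ∀ i, DifferentiableAt ℂ (fun e => X e i) e)
    (hQ0 : Q e ≠ 0) (hL0 : ∀ β, L e β ≠ 0)
    (hadm : Admissible (Q e) q₂ p (L e) a κ (fun i => ‖X e i‖)) :
    DifferentiableAt ℂ (fun e => regIntegrand (Q e) q₂ p (L e) a z κ (X e)) e := by
  have hX0 : ∀ i, X e i ≠ 0 := fun i => norm_pos_iff.1 (hadm.pos i)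
  have hq20 : q₂ ≠ 0 := by simpa using hq0
  unfold regIntegrand regPair regSite
  refine DifferentiableAt.mul ?_ ?_
  · refine differentiableAt_prod fun i _ => differentiableAt_prod fun j hj => ?_
    obtain ⟨h1, h2⟩ := hadm.pair i j (Finset.mem_Ioi.1 hj)
    refine DifferentiableAt.mul (DifferentiableAt.mul ?_ ?_) ?_
    · exact DifferentiableAt.theta_comp hp (differentiableAt_div (hX i) (hX j) (hX0 j))
        (div_ne_zero (hX0 i) (hX0 j))
    · refine DifferentiableAt.ellGamma_comp hq hp
        ((differentiableAt_div (hQ.mul (hX j)) (hX i) (hX0 i)).const_mul p) ?_ ?_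
      · exact mul_ne_zero hp0 (div_ne_zero (mul_ne_zero hQ0 (hX0 j)) (hX0 i))
      · rw [← mul_div_assoc, norm_div, div_lt_one (hadm.pos i), ← mul_assoc, norm_mul]
        exact h2
    · refine DifferentiableAt.ellGamma_comp hq hp
        (differentiableAt_div (hQ.mul (hX i)) (hX j) (hX0 j)) ?_ ?_
      · exact div_ne_zero (mul_ne_zero hQ0 (hX0 i)) (hX0 j)
      · rw [norm_div, div_lt_one (hadm.pos j), norm_mul]
        exact h1
  · refine differentiableAt_prod fun γ _ => differentiableAt_prod fun i hi => ?_
    have hcol := (Finset.mem_filter.1 hi).2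
    have da : ∀ β, DifferentiableAt ℂ (fun e => a β / X e i) e := fun β =>
      differentiableAt_div (differentiableAt_const _) (hX i) (hX0 i)
    have dK : ∀ β, DifferentiableAt ℂ (fun e => L e β * a β / X e i) e := fun β =>
      differentiableAt_div ((hL β).mul_const _) (hX i) (hX0 i)
    have na : ∀ β, a β / X e i ≠ 0 := fun β => div_ne_zero (ha β) (hX0 i)
    have nK : ∀ β, L e β * a β / X e i ≠ 0 := fun β =>
      div_ne_zero (mul_ne_zero (hL0 β) (ha β)) (hX0 i)
    have iK : ∀ β, ‖X e i‖ < ‖q₂ * L e β * a β‖ →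
        DifferentiableAt ℂ (fun e => (ellGamma (p * (L e β * a β / X e i)) q₂⁻¹ p)⁻¹) e := by
      intro β hβ
      refine DifferentiableAt.inv_ellGamma_comp hq hp ((dK β).const_mul p)
        (mul_ne_zero hp0 (nK β)) ?_
      have h1 := hX0 i
      have h2 := hL0 β
      have h3 := ha β
      rw [show q₂⁻¹ * p / (p * (L e β * a β / X e i)) = X e i / (q₂ * L e β * a β) by field_simp,
        norm_div, div_lt_one (norm_pos_iff.2 (mul_ne_zero (mul_ne_zero hq20 h2) h3))]
      exact hβ
    refine DifferentiableAt.mul (DifferentiableAt.mul ?_ ?_) ?_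
    · refine differentiableAt_prod fun β hβ => DifferentiableAt.mul ?_ ?_
      · refine DifferentiableAt.ellGamma_comp hq hp ((da β).const_mul p)
          (mul_ne_zero hp0 (na β)) ?_
        rw [← mul_div_assoc, norm_div, div_lt_one (hadm.pos i)]
        exact hadm.lower' i γ hcol β (Finset.mem_Iio.1 hβ)
      · exact iK β (hadm.upper i γ hcol β (Finset.mem_Iio.1 hβ).le)
    · refine DifferentiableAt.mul (DifferentiableAt.mul ?_ ?_) ?_
      · exact DifferentiableAt.theta_comp hq
          (differentiableAt_dynamicalArg (Z := fun _ => z) (differentiableAt_const _) hQ hL (hX i)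
            hQ0 (hX0 i) γ i)
          (dynamicalArg_ne_zero hQ0 hL0 hz ha (hX0 i) γ i)
      · refine DifferentiableAt.ellGamma_comp hq hp (da γ) (na γ) ?_
        rw [norm_div, div_lt_one (hadm.pos i)]
        exact hadm.lower i γ hcol γ le_rfl
      · exact iK γ (hadm.upper i γ hcol γ le_rfl)
    · refine differentiableAt_prod fun β hβ => DifferentiableAt.mul ?_ ?_
      · refine DifferentiableAt.ellGamma_comp hq hp (da β) (na β) ?_
        rw [norm_div, div_lt_one (hadm.pos i)]
        exact hadm.lower i γ hcol β (Finset.mem_Ioi.1 hβ).le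
      · refine DifferentiableAt.inv_ellGamma_comp hq hp (dK β) (nK β) ?_
        have h1 := hX0 i
        have h2 := hL0 β
        have h3 := ha β
        rw [show q₂⁻¹ * p / (L e β * a β / X e i) = p * X e i / (q₂ * L e β * a β) by field_simp,
          norm_div, div_lt_one (norm_pos_iff.2 (mul_ne_zero (mul_ne_zero hq20 h2) h3)), norm_mul]
        exact hadm.upper' i γ hcol β (Finset.mem_Ioi.1 hβ)

end RegularIntegrand

open scoped Pointwise

/-! ### Integration over tori -/

section Torus

open MeasureTheory

variable {n k : ℕ}

/-- The normalized Haar measure of the torus `(ℝ / ℤ)^k`. -/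
noncomputable abbrev torusMeasure (k : ℕ) : Measure (Fin k → UnitAddCircle) :=
  Measure.pi fun _ => AddCircle.haarAddCircle

/-- The point with the arguments `2 π u_i` on the torus with radii `r_i`. -/
noncomputable def torusPt (r : Fin k → ℝ) (u : Fin k → UnitAddCircle) (i : Fin k) : ℂ :=
  r i * (AddCircle.toCircle (u i) : ℂ)

lemma continuous_torusPt (r : Fin k → ℝ) (i : Fin k) : Continuous fun u => torusPt r u i := by
  unfold torusPt
  exact continuous_const.mul (continuous_subtype_val.comp
    (AddCircle.continuous_toCircle.comp (continuous_apply i)))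

lemma norm_torusPt {r : Fin k → ℝ} (hr : ∀ i, 0 < r i) (u : Fin k → UnitAddCircle) (i : Fin k) :
    ‖torusPt r u i‖ = r i := by
  rw [torusPt, norm_mul, Circle.norm_coe, mul_one, Complex.norm_of_nonneg (hr i).le]

lemma integral_torus_comp_perm (F : (Fin k → UnitAddCircle) → ℂ) (σ : Equiv.Perm (Fin k)) :
    ∫ u, F (u ∘ σ) ∂torusMeasure k = ∫ u, F u ∂torusMeasure k := by
  have h := measurePreserving_piCongrLeft
    (fun _ : Fin k => (AddCircle.haarAddCircle : Measure UnitAddCircle)) σ.symm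
  rw [← h.integral_comp' F]
  refine integral_congr_ae (.of_forall fun u => ?_)
  dsimp only
  congr 1
  ext i
  have := MeasurableEquiv.piCongrLeft_apply_apply σ.symm (β := fun _ => UnitAddCircle) u (σ i)
  simpa using this.symm

/-- The contour integral against `∏ dx_i / (2πi x_i)` is the average over the torus. -/
lemma torusIntegral_eq_integral {r : Fin k → ℝ} (hr : ∀ i, 0 < r i) (F : (Fin k → ℂ) → ℂ) :
    torusIntegral (fun x : Fin k → ℂ => (∏ i, (2 * (Real.pi : ℂ) * Complex.I * x i)⁻¹) * F x) 0 r =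
      ∫ u, F (torusPt r u) ∂torusMeasure k := by
  have hpi : (0 : ℝ) < 2 * Real.pi := by positivity
  have h1 : ∫ u, F (torusPt r u) ∂torusMeasure k =
      ∫ y in {y : Fin k → ℝ | ∀ i, y i ∈ Set.Ioc (0 : ℝ) (0 + 1)},
        F (torusPt r fun i => (y i : UnitAddCircle)) :=
    UnitAddTorus.integral_preimage (fun u => F (torusPt r u)) 0
  have h2 : ∀ y : Fin k → ℝ, F (torusPt r fun i => (y i : UnitAddCircle)) =
      F (torusMap 0 r ((2 * Real.pi) • y)) := by
    intro y
    congr 1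
    ext i
    simp [torusPt, torusMap, AddCircle.toCircle_apply_mk, Circle.coe_exp]
  have hset : (2 * Real.pi) • {y : Fin k → ℝ | ∀ i, y i ∈ Set.Ioc (0 : ℝ) (0 + 1)} =
      Set.univ.pi fun _ => Set.Ioc (0 : ℝ) (2 * Real.pi) := by
    ext y
    rw [Set.mem_smul_set_iff_inv_smul_mem₀ hpi.ne']
    simp only [Set.mem_ofPred_eq, Set.mem_univ_pi, Pi.smul_apply, smul_eq_mul, Set.mem_Ioc,
      zero_add]
    refine forall_congr' fun i => and_congr ?_ ?_
    · rw [inv_mul_eq_div, lt_div_iff₀ hpi, zero_mul]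
    · rw [inv_mul_eq_div, div_le_one hpi]
  have hae : (Set.univ.pi fun _ : Fin k => Set.Ioc (0 : ℝ) (2 * Real.pi)) =ᵐ[volume]
      Set.Icc (0 : Fin k → ℝ) fun _ => 2 * Real.pi := by
    rw [volume_pi]
    exact Measure.univ_pi_Ioc_ae_eq_Icc
  rw [h1]
  simp_rw [h2]
  rw [Measure.setIntegral_comp_smul_of_pos volume (fun θ => F (torusMap 0 r θ)) _ hpi, hset,
    setIntegral_congr_set hae, ← integral_smul]
  unfold torusIntegral
  refine integral_congr_ae (.of_forall fun θ => ?_)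
  simp only [smul_eq_mul, Module.finrank_fin_fun, Complex.real_smul]
  rw [← mul_assoc, ← Finset.prod_mul_distrib]
  congr 1
  rw [Finset.prod_congr rfl (g := fun _ => (2 * (Real.pi : ℂ))⁻¹)]
  · simp only [Finset.prod_const, Finset.card_univ, Fintype.card_fin, inv_pow]
    push_cast
    rfl
  · intro i _
    have h0 : (r i : ℂ) ≠ 0 := by exact_mod_cast (hr i).ne'
    have h3 : (Real.pi : ℂ) ≠ 0 := by exact_mod_cast Real.pi_ne_zero
    have h4 := Complex.exp_ne_zero (θ i * Complex.I)
    have h5 := Complex.I_ne_zero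
    simp only [torusMap, Pi.zero_apply, zero_add]
    field_simp

/-- The Haar measure of the circle has no atoms, since the circle is not discrete. -/
instance : NullSingletonClass (AddCircle.haarAddCircle : Measure UnitAddCircle) := by
  have : Nontrivial UnitAddCircle := by
    refine ⟨0, ((1 / 2 : ℝ) : UnitAddCircle), fun h => ?_⟩
    have h1 := congrArg (fun x => (AddCircle.toCircle x : ℂ)) h
    simp only [AddCircle.toCircle_zero, AddCircle.toCircle_apply_mk, Circle.coe_exp,
      Circle.coe_one] at h1
    rw [show ((2 * Real.pi / 1 * (1 / 2) : ℝ) : ℂ) = Real.pi by push_cast; ring,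
      Complex.exp_pi_mul_I] at h1
    norm_num at h1
  have := ConnectedSpace.neBot_nhdsWithin_compl_of_nontrivial_of_t1space (0 : UnitAddCircle)
  infer_instance

lemma ae_toCircle_ne (c : ℂ) :
    ∀ᵐ u ∂(AddCircle.haarAddCircle : Measure UnitAddCircle), (AddCircle.toCircle u : ℂ) ≠ c := by
  rw [ae_iff]
  refine Set.Subsingleton.measure_zero (fun u hu v hv => ?_) _
  simp only [ne_eq, not_not, Set.mem_ofPred_eq] at hu hv
  exact AddCircle.injective_toCircle one_ne_zero (Subtype.ext (hu.trans hv.symm))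

lemma ae_torusPt_ne {r : Fin k → ℝ} (hr : ∀ i, 0 < r i) (i : Fin k) (c : ℂ) :
    ∀ᵐ u ∂torusMeasure k, torusPt r u i ≠ c := by
  have h := (measurePreserving_eval
    (fun _ : Fin k => (AddCircle.haarAddCircle : Measure UnitAddCircle))
    i).quasiMeasurePreserving.ae
    (ae_toCircle_ne (c / r i))
  filter_upwards [h] with u hu e
  exact hu (by rw [← e, torusPt, mul_div_cancel_left₀ _ (by exact_mod_cast (hr i).ne')])

lemma ae_torusPt_ne_mul {r : Fin k → ℝ} (hr : ∀ i, 0 < r i) {i j : Fin k} (hij : i ≠ j) (c : ℂ) :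
    ∀ᵐ u ∂torusMeasure k, torusPt r u j ≠ c * torusPt r u i := by
  let f : (Fin k → UnitAddCircle) →+ UnitAddCircle :=
    (Pi.evalAddMonoidHom (fun _ : Fin k => UnitAddCircle) j) -
      (Pi.evalAddMonoidHom (fun _ : Fin k => UnitAddCircle) i)
  have hf : MeasurePreserving f (torusMeasure k)
      (AddCircle.haarAddCircle : Measure UnitAddCircle) := by
    refine AddMonoidHom.measurePreserving ?_ ?_ ?_
    · exact (continuous_apply j).sub (continuous_apply i)
    · intro v
      exact ⟨Pi.single j v, by simp [f, hij]⟩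
    · simp
  filter_upwards [hf.quasiMeasurePreserving.ae (ae_toCircle_ne (c * r i / r j))] with u hu e
  refine hu ?_
  have h1 : (AddCircle.toCircle (u i) : ℂ) ≠ 0 := Circle.coe_ne_zero _
  have h2 : (r j : ℂ) ≠ 0 := by exact_mod_cast (hr j).ne'
  have h3 : (AddCircle.toCircle (f u) : ℂ) * AddCircle.toCircle (u i) =
      AddCircle.toCircle (u j) := by
    rw [← Circle.coe_mul, ← AddCircle.toCircle_add]
    simp [f]
  simp only [torusPt] at e
  rw [eq_div_iff h2]
  apply mul_right_cancel₀ h1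
  rw [mul_right_comm, h3]
  linear_combination e

/-- Almost all points of a torus are generic, for arbitrary radii. So the junk values of the
integrand at its removable singularities do not matter. -/
lemma ae_genericPoint {q₁ q₂ p : ℂ} {K a : Fin n → ℂ} (hq₁ : q₁ ≠ 0) (hq₂ : q₂ ≠ 0) (hp : p ≠ 0)
    (hK : ∀ β, K β ≠ 0) (ha : ∀ β, a β ≠ 0) {r : Fin k → ℝ} (hr : ∀ i, 0 < r i) :
    ∀ᵐ u ∂torusMeasure k, GenericPoint q₁ q₂ p K a (torusPt r u) := by
  have hx : ∀ u i, torusPt r u i ≠ 0 := fun u i =>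
    norm_pos_iff.1 (by rw [norm_torusPt hr]; exact hr i)
  have hlat : ∀ s t : ℤ, q₂⁻¹ ^ s * p ^ t ≠ 0 := fun s t =>
    mul_ne_zero (zpow_ne_zero _ (inv_ne_zero hq₂)) (zpow_ne_zero _ hp)
  have hsite : ∀ b : ℂ, b ≠ 0 → ∀ i, ∀ᵐ u ∂torusMeasure k,
      OffLattice q₂⁻¹ p (b / torusPt r u i) := by
    intro b hb i
    have : ∀ᵐ u ∂torusMeasure k, ∀ s t : ℤ, torusPt r u i ≠ b / (q₂⁻¹ ^ s * p ^ t) :=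
      ae_all_iff.2 fun s => ae_all_iff.2 fun t => ae_torusPt_ne hr i _
    filter_upwards [this] with u hu
    refine ⟨div_ne_zero hb (hx u i), fun s t e => hu s t ?_⟩
    rw [eq_div_iff (hlat s t), mul_comm, ← e, div_mul_cancel₀ _ (hx u i)]
  have hratio : ∀ b : ℂ, b ≠ 0 → ∀ i j, ∀ᵐ u ∂torusMeasure k, i ≠ j →
      OffLattice q₂⁻¹ p (b * torusPt r u j / torusPt r u i) := by
    intro b hb i j
    by_cases hij : i = j
    · exact .of_forall fun u h => absurd hij h
    have : ∀ᵐ u ∂torusMeasure k, ∀ s t : ℤ,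
        torusPt r u j ≠ (q₂⁻¹ ^ s * p ^ t / b) * torusPt r u i :=
      ae_all_iff.2 fun s => ae_all_iff.2 fun t => ae_torusPt_ne_mul hr hij _
    filter_upwards [this] with u hu _
    refine ⟨div_ne_zero (mul_ne_zero hb (hx u j)) (hx u i), fun s t e => hu s t ?_⟩
    rw [← e]
    have := hx u i
    field_simp
  have h1 : ∀ᵐ u ∂torusMeasure k, ∀ i j, i ≠ j →
      OffLattice q₂⁻¹ p (1 * torusPt r u j / torusPt r u i) :=
    ae_all_iff.2 fun i => ae_all_iff.2 fun j => hratio 1 one_ne_zero i j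
  have h2 : ∀ᵐ u ∂torusMeasure k, ∀ i j, i ≠ j →
      OffLattice q₂⁻¹ p (q₁ * torusPt r u j / torusPt r u i) :=
    ae_all_iff.2 fun i => ae_all_iff.2 fun j => hratio q₁ hq₁ i j
  have h3 : ∀ᵐ u ∂torusMeasure k, ∀ i β, OffLattice q₂⁻¹ p (a β / torusPt r u i) :=
    ae_all_iff.2 fun i => ae_all_iff.2 fun β => hsite _ (ha β) i
  have h4 : ∀ᵐ u ∂torusMeasure k, ∀ i β, OffLattice q₂⁻¹ p (K β * a β / torusPt r u i) :=
    ae_all_iff.2 fun i => ae_all_iff.2 fun β => hsite _ (mul_ne_zero (hK β) (ha β)) i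
  filter_upwards [h1, h2, h3, h4] with u h1 h2 h3 h4
  exact ⟨by simpa using h1, h2, h3, h4⟩

/-- The integral of the summand of the block that belongs to the identity permutation. -/
noncomputable def blockIntegral (q₁ q₂ p : ℂ) (K a : Fin n → ℂ) (z : ℂ) (κ : Fin n → ℕ)
    (r : Fin k → ℝ) : ℂ :=
  ∫ u, regIntegrand q₁ q₂ p K a z κ (torusPt r u) ∂torusMeasure k

/-- All `k!` summands of the block give the same integral. -/
lemma ellipticBlock_eq {q₁ q₂ p z : ℂ} {K a : Fin n → ℂ} (hq₁ : q₁ ≠ 0) (hq₂ : 1 < ‖q₂‖)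
    (hp : p ≠ 0) (hp1 : ‖p‖ < 1) (hK : ∀ β, K β ≠ 0) (ha : ∀ β, a β ≠ 0)
    {r : Comp n k → Fin k → ℝ} (κ : Comp n k) (hr : ∀ i, 0 < r κ i) :
    ellipticBlock q₁ q₂ p K a r z κ =
      stabConst k q₁ q₂ K z κ.1 * blockIntegral q₁ q₂ p K a z κ.1 (r κ) := by
  have hq20 : q₂ ≠ 0 := norm_pos_iff.1 (one_pos.trans hq₂)
  have hterm : ∀ σ : Equiv.Perm (Fin k), torusIntegral
        (fun x : Fin k → ℂ =>
          (∏ i, (2 * (Real.pi : ℂ) * Complex.I * x i)⁻¹) *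
            (principalPart q₁ q₂ p K a x *
              (stabSummand q₁ q₂ K a z κ.1 (x ∘ σ) / stabDenom q₂ K a x)))
        0 (fun i => r κ (σ⁻¹ i)) = blockIntegral q₁ q₂ p K a z κ.1 (r κ) := by
    intro σ
    have hr' : ∀ i, 0 < r κ (σ⁻¹ i) := fun i => hr _
    rw [torusIntegral_eq_integral hr', blockIntegral,
      ← integral_torus_comp_perm (fun u => regIntegrand q₁ q₂ p K a z κ.1 (torusPt (r κ) u)) σ]
    refine integral_congr_ae ?_
    filter_upwards [ae_genericPoint hq₁ hq20 hp hK ha hr'] with u hu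
    rw [← principalPart_comp _ σ, ← stabDenom_comp _ σ,
      regIntegrand_eq κ.2 (norm_inv_lt_one_of_one_lt hq₂) (inv_ne_zero hq20) hp1 hp (hu.comp σ)]
    congr 1
    ext i
    simp [torusPt]
  rw [ellipticBlock, Finset.sum_congr rfl fun σ _ => hterm σ]
  simp only [Finset.sum_const, Finset.card_univ, Fintype.card_perm, Fintype.card_fin, nsmul_eq_mul]
  have : (k.factorial : ℂ) ≠ 0 := by exact_mod_cast k.factorial_ne_zero
  field_simp

end Torus


/-! ### Holomorphic dependence of the integral on parameters -/

section Parameter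

open MeasureTheory

variable {n k : ℕ}

/-- Integrals over a compact space of functions that depend holomorphically on a parameter are
holomorphic. -/
lemma differentiableOn_integral_of_continuousOn {T : Type*} [TopologicalSpace T] [CompactSpace T]
    [MeasurableSpace T] [BorelSpace T] (μ : Measure T) [IsFiniteMeasure μ]
    {G : ℂ → T → ℂ} {V : Set ℂ} (hV : IsOpen V)
    (hc : ContinuousOn (Function.uncurry G) (V ×ˢ Set.univ))
    (hd : ∀ u, DifferentiableOn ℂ (fun t => G t u) V) :
    DifferentiableOn ℂ (fun t => ∫ u, G t u ∂μ) V := by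
  intro t₀ ht₀
  obtain ⟨ε, hε, hball⟩ := Metric.isOpen_iff.1 hV t₀ ht₀
  have hcu : ∀ t ∈ V, Continuous (G t) := fun t ht => by
    have : ContinuousOn (Function.uncurry G ∘ fun u => (t, u)) Set.univ :=
      hc.comp (by fun_prop) fun u _ => ⟨ht, trivial⟩
    exact continuousOn_univ.1 this
  have hint : ∀ t ∈ V, Integrable (G t) μ := fun t ht =>
    (hcu t ht).integrable_of_hasCompactSupport (HasCompactSupport.of_compactSpace _)
  have hsub : Metric.closedBall t₀ (ε / 2) ⊆ V :=
    (Metric.closedBall_subset_ball (by linarith)).trans hball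
  obtain ⟨M, hM⟩ :=
    ((isCompact_closedBall t₀ (ε / 2)).prod isCompact_univ).exists_bound_of_continuousOn
    (hc.mono (Set.prod_mono hsub subset_rfl))
  have hdA : ∀ u, ∀ t ∈ V, HasDerivAt (fun t => G t u) (deriv (fun t => G t u) t) t :=
    fun u t ht => ((hd u).differentiableAt (hV.mem_nhds ht)).hasDerivAt
  have hmeas : AEStronglyMeasurable (fun u => deriv (fun t => G t u) t₀) μ := by
    let s : ℕ → ℂ := fun m => ((ε / 2 / (m + 1) : ℝ) : ℂ)
    have hs0 : ∀ m, s m ≠ 0 := fun m => by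
      simp only [s]
      exact_mod_cast (by positivity : ε / 2 / ((m : ℝ) + 1) ≠ 0)
    have hsV : ∀ m, t₀ + s m ∈ V := fun m => hsub (by
      simp only [Metric.mem_closedBall, dist_self_add_left, s]
      rw [Complex.norm_of_nonneg (by positivity)]
      exact div_le_self (by positivity) (by linarith [(Nat.cast_nonneg m : (0 : ℝ) ≤ m)]))
    have hs : Tendsto s atTop (𝓝[≠] 0) := by
      refine tendsto_nhdsWithin_iff.2 ⟨?_, .of_forall hs0⟩
      have h1 := (tendsto_one_div_add_atTop_nhds_zero_nat (𝕜 := ℝ)).const_mul (ε / 2)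
      rw [mul_zero] at h1
      have h2 := (Complex.continuous_ofReal.tendsto 0).comp h1
      refine h2.congr fun m => ?_
      simp [s, div_eq_mul_inv]
    refine aestronglyMeasurable_of_tendsto_ae (f := fun m u => (s m)⁻¹ • (G (t₀ + s m) u - G t₀ u))
      atTop (fun m => ?_) (.of_forall fun u => ?_)
    · have := hcu _ (hsV m)
      have := hcu _ ht₀
      exact Continuous.aestronglyMeasurable (by fun_prop)
    · exact (hdA u t₀ ht₀).tendsto_slope_zero.comp hs
  refine (hasDerivAt_integral_of_dominated_loc_of_deriv_le (μ := μ) (F := G)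
    (F' := fun t u => deriv (fun t => G t u) t) (bound := fun _ => M / (ε / 4))
    (s := Metric.ball t₀ (ε / 4)) (Metric.ball_mem_nhds _ (by positivity)) ?_ (hint _ ht₀) hmeas ?_
    (integrable_const _) ?_).2.differentiableAt.differentiableWithinAt
  · filter_upwards [hV.mem_nhds ht₀] with t ht using (hcu t ht).aestronglyMeasurable
  · refine .of_forall fun u t ht => ?_
    have hcb : Metric.closedBall t (ε / 4) ⊆ Metric.closedBall t₀ (ε / 2) := by
      refine Metric.closedBall_subset_closedBall' ?_
      have := Metric.mem_ball.1 ht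
      linarith
    refine Complex.norm_deriv_le_of_forall_mem_sphere_norm_le (by positivity) ?_ fun y hy =>
      hM (y, u) ⟨hcb (Metric.sphere_subset_closedBall hy), trivial⟩
    refine DifferentiableOn.diffContOnCl ((hd u).mono ?_)
    rw [closure_ball _ (by positivity)]
    exact hcb.trans hsub
  · refine .of_forall fun u t ht => hdA u t (hball ?_)
    exact Metric.ball_subset_ball (by linarith) ht

variable {q₂ p z : ℂ} {a : Fin n → ℂ} {κ : Fin n → ℕ}

/-- Admissibility is an open condition. -/
lemma Admissible.eventually {S : Type*} [TopologicalSpace S] {Q : S → ℂ} {L : S → Fin n → ℂ}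
    {ρ : S → Fin k → ℝ} {s : S}
    (hQ : ContinuousAt Q s) (hL : ∀ β, ContinuousAt (fun t => L t β) s)
    (hρ : ∀ i, ContinuousAt (fun t => ρ t i) s)
    (h : Admissible (Q s) q₂ p (L s) a κ (ρ s)) :
    ∀ᶠ t in 𝓝 s, Admissible (Q t) q₂ p (L t) a κ (ρ t) := by
  have h1 : ∀ᶠ t in 𝓝 s, ∀ i, 0 < ρ t i :=
    eventually_all.2 fun i => continuousAt_const.eventually_lt (hρ i) (h.pos i)
  have h2 : ∀ᶠ t in 𝓝 s, ∀ i j, i < j → ‖Q t‖ * ρ t i < ρ t j ∧ ‖p * Q t‖ * ρ t j < ρ t i :=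
    eventually_all.2 fun i => eventually_all.2 fun j => eventually_imp_distrib_left.2 fun hij =>
      ((hQ.norm.mul (hρ i)).eventually_lt (hρ j) (h.pair i j hij).1).and
      (((continuousAt_const.mul hQ).norm.mul (hρ j)).eventually_lt (hρ i) (h.pair i j hij).2)
  have h3 : ∀ᶠ t in 𝓝 s, ∀ i γ, HasColour κ i γ → ∀ β, γ ≤ β → ‖a β‖ < ρ t i :=
    eventually_all.2 fun i => eventually_all.2 fun γ => eventually_imp_distrib_left.2 fun hi =>
      eventually_all.2 fun β => eventually_imp_distrib_left.2 fun hβ =>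
      continuousAt_const.eventually_lt (hρ i) (h.lower i γ hi β hβ)
  have h4 : ∀ᶠ t in 𝓝 s, ∀ i γ, HasColour κ i γ → ∀ β, β < γ → ‖p * a β‖ < ρ t i :=
    eventually_all.2 fun i => eventually_all.2 fun γ => eventually_imp_distrib_left.2 fun hi =>
      eventually_all.2 fun β => eventually_imp_distrib_left.2 fun hβ =>
      continuousAt_const.eventually_lt (hρ i) (h.lower' i γ hi β hβ)
  have h5 : ∀ᶠ t in 𝓝 s, ∀ i γ, HasColour κ i γ → ∀ β, β ≤ γ → ρ t i < ‖q₂ * L t β * a β‖ :=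
    eventually_all.2 fun i => eventually_all.2 fun γ => eventually_imp_distrib_left.2 fun hi =>
      eventually_all.2 fun β => eventually_imp_distrib_left.2 fun hβ =>
      (hρ i).eventually_lt ((continuousAt_const.mul (hL β)).mul continuousAt_const).norm
        (h.upper i γ hi β hβ)
  have h6 : ∀ᶠ t in 𝓝 s, ∀ i γ, HasColour κ i γ → ∀ β, γ < β →
      ‖p‖ * ρ t i < ‖q₂ * L t β * a β‖ :=
    eventually_all.2 fun i => eventually_all.2 fun γ => eventually_imp_distrib_left.2 fun hi =>
      eventually_all.2 fun β => eventually_imp_distrib_left.2 fun hβ =>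
      (continuousAt_const.mul (hρ i)).eventually_lt
        ((continuousAt_const.mul (hL β)).mul continuousAt_const).norm (h.upper' i γ hi β hβ)
  filter_upwards [h1, h2, h3, h4, h5, h6] with t h1 h2 h3 h4 h5 h6 using ⟨h1, h2, h3, h4, h5, h6⟩

/-- The integral is holomorphic in `q₁`, the `K_α` and in the logarithms of the radii. -/
lemma differentiableOn_integral_regIntegrand {V : Set ℂ} (hV : IsOpen V) {Q : ℂ → ℂ}
    {L : ℂ → Fin n → ℂ} {ρ : ℂ → Fin k → ℂ} (hq₂ : 1 < ‖q₂‖) (hp : p ≠ 0) (hp1 : ‖p‖ < 1)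
    (hz : z ≠ 0) (ha : ∀ β, a β ≠ 0)
    (hQ : DifferentiableOn ℂ Q V) (hL : ∀ β, DifferentiableOn ℂ (fun t => L t β) V)
    (hρ : ∀ i, DifferentiableOn ℂ (fun t => ρ t i) V)
    (hQ0 : ∀ t ∈ V, Q t ≠ 0) (hL0 : ∀ t ∈ V, ∀ β, L t β ≠ 0)
    (hadm : ∀ t ∈ V, Admissible (Q t) q₂ p (L t) a κ fun i => ‖ρ t i‖) :
    DifferentiableOn ℂ (fun t => ∫ u, regIntegrand (Q t) q₂ p (L t) a z κ
      (fun i => ρ t i * (AddCircle.toCircle (u i) : ℂ)) ∂torusMeasure k) V := by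
  have hq20 : q₂ ≠ 0 := norm_pos_iff.1 (one_pos.trans hq₂)
  have key : ∀ t ∈ V, ∀ y : Fin k → ℂ, (∀ i, ‖y i‖ = 1) →
      DifferentiableAt ℂ (fun e : ℂ × (Fin k → ℂ) => regIntegrand (Q e.1) q₂ p (L e.1) a z κ
        (fun i => ρ e.1 i * e.2 i)) (t, y) := by
    intro t ht y hy
    have hVt := hV.mem_nhds ht
    have hfst : DifferentiableAt ℂ (fun e : ℂ × (Fin k → ℂ) => e.1) (t, y) := differentiableAt_fst
    have hsnd : ∀ i, DifferentiableAt ℂ (fun e : ℂ × (Fin k → ℂ) => e.2 i) (t, y) := fun i => by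
      fun_prop
    refine differentiableAt_regIntegrand (norm_inv_lt_one_of_one_lt hq₂) (inv_ne_zero hq20) hp1 hp
      hz ha ?_ (fun β => ?_) (fun i => ?_) (hQ0 t ht) (hL0 t ht) ?_
    · exact DifferentiableAt.comp (t, y) (hQ.differentiableAt hVt) hfst
    · exact DifferentiableAt.comp (t, y) ((hL β).differentiableAt hVt) hfst
    · exact (DifferentiableAt.comp (t, y) ((hρ i).differentiableAt hVt) hfst).mul (hsnd i)
    · simpa only [norm_mul, hy, mul_one] using hadm t ht
  have hu1 : ∀ (u : Fin k → UnitAddCircle) i, ‖(AddCircle.toCircle (u i) : ℂ)‖ = 1 :=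
    fun u i => Circle.norm_coe _
  refine differentiableOn_integral_of_continuousOn _ hV ?_ ?_
  · rintro ⟨t, u⟩ ⟨ht, -⟩
    refine ContinuousAt.continuousWithinAt ?_
    have hcirc : Continuous fun e : ℂ × (Fin k → UnitAddCircle) =>
        (e.1, fun i => (AddCircle.toCircle (e.2 i) : ℂ)) :=
      continuous_fst.prodMk (continuous_pi fun i => continuous_subtype_val.comp
        (AddCircle.continuous_toCircle.comp ((continuous_apply i).comp continuous_snd)))
    exact ContinuousAt.comp (x := (t, u)) (f := fun e : ℂ × (Fin k → UnitAddCircle) =>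
        (e.1, fun i => (AddCircle.toCircle (e.2 i) : ℂ)))
      (g := fun e : ℂ × (Fin k → ℂ) => regIntegrand (Q e.1) q₂ p (L e.1) a z κ
        (fun i => ρ e.1 i * e.2 i))
      (key t ht (fun i => (AddCircle.toCircle (u i) : ℂ)) (hu1 u)).continuousAt hcirc.continuousAt
  · intro u t ht
    refine DifferentiableAt.differentiableWithinAt ?_
    exact DifferentiableAt.comp t (f := fun t : ℂ =>
        (t, fun i => (AddCircle.toCircle (u i) : ℂ)))
      (key t ht _ (hu1 u)) (differentiableAt_id.prodMk (differentiableAt_const _))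

/-- The weighted geometric mean of two positive numbers. -/
noncomputable def geomMean (s x y : ℝ) : ℝ := Real.exp ((1 - s) * Real.log x + s * Real.log y)

lemma geomMean_self {x : ℝ} (hx : 0 < x) (s : ℝ) : geomMean s x x = x := by
  rw [geomMean, ← add_mul, sub_add_cancel, one_mul, Real.exp_log hx]

lemma mul_geomMean_lt {s c x x' y y' : ℝ} (hs : s ∈ Set.Icc (0 : ℝ) 1) (hc : 0 < c)
    (hx : 0 < x) (hx' : 0 < x') (h : c * x < y) (h' : c * x' < y') :
    c * geomMean s x x' < geomMean s y y' := by
  have h1 := Real.log_lt_log (mul_pos hc hx) h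
  have h2 := Real.log_lt_log (mul_pos hc hx') h'
  rw [Real.log_mul hc.ne' hx.ne'] at h1
  rw [Real.log_mul hc.ne' hx'.ne'] at h2
  rw [geomMean, geomMean, ← Real.exp_log hc, ← Real.exp_add, Real.exp_lt_exp]
  obtain ⟨h3, h4⟩ := hs
  rcases h3.eq_or_lt with rfl | h3
  · linarith
  · nlinarith [mul_lt_mul_of_pos_left h2 h3, mul_le_mul_of_nonneg_left h1.le (sub_nonneg.2 h4)]

/-- The admissible radii form a logarithmically convex set. -/
lemma Admissible.geomMean {q₁ : ℂ} {K : Fin n → ℂ} {r r' : Fin k → ℝ}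
    (hq₁ : q₁ ≠ 0) (hp : p ≠ 0) (ha : ∀ β, a β ≠ 0)
    (h : Admissible q₁ q₂ p K a κ r) (h' : Admissible q₁ q₂ p K a κ r') {s : ℝ}
    (hs : s ∈ Set.Icc (0 : ℝ) 1) :
    Admissible q₁ q₂ p K a κ fun i => geomMean s (r i) (r' i) := by
  have hl : ∀ {c x x' : ℝ}, 0 < c → c < x → c < x' → c < EllipticQKZ.geomMean s x x' := by
    intro c x x' hc h1 h2
    have := mul_geomMean_lt hs hc one_pos one_pos (by rwa [mul_one]) (by rwa [mul_one]) (y := x)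
      (y' := x')
    rwa [geomMean_self one_pos, mul_one] at this
  have hu : ∀ {c x x' y : ℝ}, 0 < c → 0 < x → 0 < x' → c * x < y → c * x' < y →
      c * EllipticQKZ.geomMean s x x' < y := by
    intro c x x' y hc hx hx' h1 h2
    have := mul_geomMean_lt hs hc hx hx' h1 h2
    rwa [geomMean_self ((mul_pos hc hx).trans h1)] at this
  refine ⟨fun i => Real.exp_pos _, fun i j hij => ⟨?_, ?_⟩, fun i γ hi β hβ => ?_,
    fun i γ hi β hβ => ?_, fun i γ hi β hβ => ?_, fun i γ hi β hβ => ?_⟩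
  · exact mul_geomMean_lt hs (norm_pos_iff.2 hq₁) (h.pos i) (h'.pos i) (h.pair i j hij).1
      (h'.pair i j hij).1
  · exact mul_geomMean_lt hs (norm_pos_iff.2 (mul_ne_zero hp hq₁)) (h.pos j) (h'.pos j)
      (h.pair i j hij).2 (h'.pair i j hij).2
  · exact hl (norm_pos_iff.2 (ha β)) (h.lower i γ hi β hβ) (h'.lower i γ hi β hβ)
  · exact hl (norm_pos_iff.2 (mul_ne_zero hp (ha β))) (h.lower' i γ hi β hβ) (h'.lower' i γ hi β hβ)
  · have := hu one_pos (h.pos i) (h'.pos i) (by rw [one_mul]; exact h.upper i γ hi β hβ)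
      (by rw [one_mul]; exact h'.upper i γ hi β hβ)
    rwa [one_mul] at this
  · exact hu (norm_pos_iff.2 hp) (h.pos i) (h'.pos i) (h.upper' i γ hi β hβ)
      (h'.upper' i γ hi β hβ)

/-- Cauchy's theorem in the form needed here. The radii are joined by a logarithmic segment; the
integral is holomorphic in its complexified parameter and does not change under imaginary
translations, which rotate the torus. -/
lemma blockIntegral_eq_of_admissible {q₁ : ℂ} {K : Fin n → ℂ} {r r' : Fin k → ℝ} (hq₁ : q₁ ≠ 0)
    (hq₂ : 1 < ‖q₂‖) (hp : p ≠ 0) (hp1 : ‖p‖ < 1) (hz : z ≠ 0) (hK : ∀ β, K β ≠ 0)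
    (ha : ∀ β, a β ≠ 0) (h : Admissible q₁ q₂ p K a κ r) (h' : Admissible q₁ q₂ p K a κ r') :
    blockIntegral q₁ q₂ p K a z κ r' = blockIntegral q₁ q₂ p K a z κ r := by
  let ρ : ℂ → Fin k → ℂ := fun s i =>
    Complex.exp ((1 - s) * Real.log (r i) + s * Real.log (r' i))
  have hρ : ∀ i, Differentiable ℂ fun s => ρ s i := fun i => by fun_prop
  have hnorm : ∀ s i, ‖ρ s i‖ = geomMean s.re (r i) (r' i) := by
    intro s i
    simp only [ρ, Complex.norm_exp, geomMean]
    congr 1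
    simp
  let V : Set ℂ := {s | Admissible q₁ q₂ p K a κ fun i => ‖ρ s i‖}
  have hV : IsOpen V := isOpen_iff_mem_nhds.2 fun s hs =>
    Admissible.eventually (Q := fun _ => q₁) (L := fun _ => K) continuousAt_const
      (fun β => continuousAt_const) (fun i => (hρ i).continuous.norm.continuousAt) hs
  let H : ℂ → ℂ := fun s => ∫ u, regIntegrand q₁ q₂ p K a z κ
      (fun i => ρ s i * (AddCircle.toCircle (u i) : ℂ)) ∂torusMeasure k
  have hH : DifferentiableOn ℂ H V :=
    differentiableOn_integral_regIntegrand hV hq₂ hp hp1 hz ha (differentiableOn_const _)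
      (fun β => differentiableOn_const _) (fun i => (hρ i).differentiableOn) (fun _ _ => hq₁)
      (fun _ _ => hK) (fun s hs => hs)
  have hshift : ∀ (s : ℂ) (τ : ℝ), H (s + τ * Complex.I) = H s := by
    intro s τ
    let v : Fin k → UnitAddCircle := fun i =>
      ((τ * (Real.log (r' i) - Real.log (r i)) / (2 * Real.pi) : ℝ) : UnitAddCircle)
    have := integral_add_right_eq_self (μ := torusMeasure k) (fun u => regIntegrand q₁ q₂ p K a z κ
      (fun i => ρ s i * (AddCircle.toCircle (u i) : ℂ))) v
    simp only [H]
    rw [← this]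
    congr 1
    ext u
    congr 1
    ext i
    have hpi : (Real.pi : ℂ) ≠ 0 := by exact_mod_cast Real.pi_ne_zero
    rw [Pi.add_apply, AddCircle.toCircle_add, Circle.coe_mul,
      mul_comm _ (AddCircle.toCircle (v i) : ℂ),
      ← mul_assoc]
    congr 1
    simp only [v, AddCircle.toCircle_apply_mk, Circle.coe_exp, ρ]
    rw [← Complex.exp_add]
    congr 1
    push_cast
    field_simp
    ring
  have hIcc : ∀ s ∈ Set.Icc (0 : ℝ) 1, (s : ℂ) ∈ V := by
    intro s hs
    simp only [V, Set.mem_ofPred_eq, hnorm, Complex.ofReal_re]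
    exact h.geomMean hq₁ hp ha h' hs
  have hder : ∀ s ∈ Set.Icc (0 : ℝ) 1, HasDerivAt H 0 (s : ℂ) := by
    intro s hs
    have h1 := (hH.differentiableAt (hV.mem_nhds (hIcc s hs))).hasDerivAt
    have h2 : HasDerivAt (fun τ : ℝ => (s : ℂ) + τ * Complex.I) Complex.I 0 := by
      simpa using ((Complex.ofRealCLM.hasDerivAt (x := 0)).mul_const Complex.I).const_add (s : ℂ)
    have h3 : HasDerivAt (fun τ : ℝ => H (s + τ * Complex.I)) (deriv H s * Complex.I) 0 := by
      have h1' : HasDerivAt H (deriv H s) ((s : ℂ) + ((0 : ℝ) : ℂ) * Complex.I) := by simpa using h1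
      exact h1'.comp (0 : ℝ) h2
    have h4 : HasDerivAt (fun τ : ℝ => H (s + τ * Complex.I)) 0 0 := by
      simp_rw [hshift]
      exact hasDerivAt_const _ _
    have h5 : deriv H s = 0 := by
      simpa [Complex.I_ne_zero] using h3.unique h4
    rwa [h5] at h1
  have hderR : ∀ s ∈ Set.Icc (0 : ℝ) 1, HasDerivAt (fun x : ℝ => H x) 0 s := fun s hs => by
    simpa using (hder s hs).comp_ofReal
  have hconst := constant_of_has_deriv_right_zero (f := fun x : ℝ => H x) (a := 0) (b := 1)
    (fun s hs => (hderR s hs).continuousAt.continuousWithinAt)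
    (fun s hs => (hderR s (Set.Ico_subset_Icc_self hs)).hasDerivWithinAt) 1 (by simp)
  have e0 : H (0 : ℝ) = blockIntegral q₁ q₂ p K a z κ r := by
    simp only [H, blockIntegral]
    congr 1
    ext u
    congr 1
    ext i
    simp only [ρ, torusPt, Complex.ofReal_zero, sub_zero, one_mul, zero_mul, add_zero]
    rw [← Complex.ofReal_exp, Real.exp_log (h.pos i)]
  have e1 : H (1 : ℝ) = blockIntegral q₁ q₂ p K a z κ r' := by
    simp only [H, blockIntegral]
    congr 1
    ext u
    congr 1
    ext i
    simp only [ρ, torusPt, Complex.ofReal_one, sub_self, one_mul, zero_mul, zero_add]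
    rw [← Complex.ofReal_exp, Real.exp_log (h'.pos i)]
  rw [← e0, ← e1]
  exact hconst

end Parameter


/-! ### The factor of two neighbouring sites in the stable envelope -/

section Sector

variable {n k m N N' : ℕ} {b b' : Fin n} {κ : Fin n → ℕ}

lemma prod_eq_mul_prod_filter {M : Type*} [CommMonoid M] (h : b ≠ b') (f : Fin n → M) :
    ∏ γ, f γ = (∏ γ with γ ≠ b ∧ γ ≠ b', f γ) * (f b * f b') := by
  rw [← Finset.prod_filter_mul_prod_filter_not Finset.univ (fun γ => γ ≠ b ∧ γ ≠ b'),
    ← Finset.prod_pair h]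
  congr 2
  ext γ
  simp only [Finset.mem_filter, Finset.mem_univ, true_and, Finset.mem_insert, Finset.mem_singleton]
  tauto

lemma Iio_eq_insert (hb : (b' : ℕ) = b + 1) : Finset.Iio b' = insert b (Finset.Iio b) := by
  ext β
  simp only [Finset.mem_Iio, Finset.mem_insert, Fin.lt_def, Fin.ext_iff]
  omega

lemma Iic_eq_insert (hb : (b' : ℕ) = b + 1) : Finset.Iic b' = insert b' (Finset.Iic b) := by
  ext β
  simp only [Finset.mem_Iic, Finset.mem_insert, Fin.le_def, Fin.ext_iff]
  omega

lemma Ioi_eq_insert (hb : (b' : ℕ) = b + 1) : Finset.Ioi b = insert b' (Finset.Ioi b') := by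
  ext β
  simp only [Finset.mem_Ioi, Finset.mem_insert, Fin.lt_def, Fin.ext_iff]
  omega

lemma hasColour_left (hb : (b' : ℕ) = b + 1) (hm : κ b + κ b' = m)
    (hN : ∑ β ∈ Finset.Ioi b', κ β = N) (i : Fin k) :
    HasColour κ i b ↔ N + κ b' ≤ i ∧ (i : ℕ) < N + m := by
  have h1 : ∑ β ∈ Finset.Ioi b, κ β = κ b' + N := by
    rw [Ioi_eq_insert hb, Finset.sum_insert (by simp), hN]
  rw [HasColour, ← Finset.Ioi_insert, Finset.sum_insert (by simp), h1]
  omega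

lemma hasColour_right (hN : ∑ β ∈ Finset.Ioi b', κ β = N) (i : Fin k) :
    HasColour κ i b' ↔ N ≤ i ∧ (i : ℕ) < N + κ b' := by
  rw [HasColour, ← Finset.Ioi_insert, Finset.sum_insert (by simp), hN]
  omega

/-- The factor of `stabSummand` that does not depend on how the variables in the positions
`N, …, N + m - 1` are distributed over the neighbouring sites `b` and `b'`. -/
noncomputable def sectorFactor (q₁ q₂ : ℂ) (K a : Fin n → ℂ) (z : ℂ) (κ : Fin n → ℕ) (b b' : Fin n)
    (N m : ℕ) (x : Fin k → ℂ) : ℂ :=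
  (∏ ij : Fin k × Fin k with ij.1 < ij.2 ∧
      ¬ ((N ≤ ij.1 ∧ (ij.1 : ℕ) < N + m) ∧ (N ≤ ij.2 ∧ (ij.2 : ℕ) < N + m)),
      theta (q₁ * x ij.2 / x ij.1) q₂⁻¹ / theta (x ij.2 / x ij.1) q₂⁻¹) *
    (∏ γ with γ ≠ b ∧ γ ≠ b', ∏ i : Fin k with HasColour κ i γ, envFactor q₁ q₂ K a z γ i (x i)) *
    ∏ i ∈ Finset.univ.filter fun i : Fin k => N ≤ (i : ℕ) ∧ (i : ℕ) < N + m,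
      ((∏ β ∈ Finset.Iio b, theta (a β / x i) q₂⁻¹) *
        ∏ β ∈ Finset.Ioi b', theta (K β * a β / x i) q₂⁻¹)

/-- The dynamical parameter of the two-site stable envelope of the sites `b`, `b + 1` inside of the
stable envelope of all sites, if `N` variables belong to the sites after them and `N'` to the
sites before them. -/
noncomputable def pairParam (q₁ : ℂ) (K : Fin n → ℂ) (z : ℂ) (b : Fin n) (N N' : ℕ) : ℂ :=
  z * (∏ β ∈ Finset.Iio b, K β) * q₁ ^ ((N : ℤ) - N')

section

variable {q₁ q₂ z : ℂ} {K a : Fin n → ℂ} {e : Fin m ↪ Fin k}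

lemma filter_sector_eq_map (he : ∀ t, (e t : ℕ) = N + t) :
    (Finset.univ.filter fun i : Fin k => N ≤ (i : ℕ) ∧ (i : ℕ) < N + m) = Finset.univ.map e := by
  ext i
  simp only [Finset.mem_filter, Finset.mem_univ, true_and, Finset.mem_map]
  constructor
  · rintro ⟨h1, h2⟩
    exact ⟨⟨i - N, by omega⟩, Fin.ext (by rw [he]; simp only; omega)⟩
  · rintro ⟨t, rfl⟩
    have := t.2
    rw [he]
    omega

lemma filter_hasColour_left_eq_map (hb : (b' : ℕ) = b + 1) (hm : κ b + κ b' = m)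
    (hN : ∑ β ∈ Finset.Ioi b', κ β = N) (he : ∀ t, (e t : ℕ) = N + t) :
    (Finset.univ.filter fun i : Fin k => HasColour κ i b) =
      (Finset.univ.filter fun t : Fin m => HasColour ![κ b, κ b'] t 0).map e := by
  have hm' : κ b' = m - κ b := by omega
  ext i
  simp only [Finset.mem_filter, Finset.mem_univ, true_and, Finset.mem_map,
    hasColour_left hb hm hN, hm', hasColour_two_zero (show κ b ≤ m by omega)]
  constructor
  · rintro ⟨h1, h2⟩
    exact ⟨⟨i - N, by omega⟩, by simp only; omega, Fin.ext (by rw [he]; simp only; omega)⟩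
  · rintro ⟨t, ht, rfl⟩
    have := t.2
    rw [he]
    omega

lemma filter_hasColour_right_eq_map (hm : κ b + κ b' = m)
    (hN : ∑ β ∈ Finset.Ioi b', κ β = N) (he : ∀ t, (e t : ℕ) = N + t) :
    (Finset.univ.filter fun i : Fin k => HasColour κ i b') =
      (Finset.univ.filter fun t : Fin m => HasColour ![κ b, κ b'] t 1).map e := by
  have hm' : κ b' = m - κ b := by omega
  ext i
  simp only [Finset.mem_filter, Finset.mem_univ, true_and, Finset.mem_map,
    hasColour_right hN, hm', hasColour_two_one]
  constructor
  · rintro ⟨h1, h2⟩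
    exact ⟨⟨i - N, by omega⟩, by simp only; omega, Fin.ext (by rw [he]; simp only; omega)⟩
  · rintro ⟨t, ht, rfl⟩
    have := t.2
    rw [he]
    omega

lemma pairParam_mul_rhoFactor (hq₁ : q₁ ≠ 0) (hk : N + m + N' = k) (he : ∀ t, (e t : ℕ) = N + t)
    (t : Fin m) :
    pairParam q₁ K z b N N' * rhoFactor q₁ t =
      z * rhoFactor q₁ (e t) * ∏ β ∈ Finset.Iio b, K β := by
  have : rhoFactor q₁ (e t) = q₁ ^ ((N : ℤ) - N') * rhoFactor q₁ t := by
    rw [rhoFactor, rhoFactor, ← zpow_add₀ hq₁, he]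
    congr 1
    push_cast [← hk]
    ring
  rw [pairParam, this]
  ring

lemma KProd_left : KProd K b = (∏ β ∈ Finset.Iio b, K β) * K b := by
  rw [KProd, ← Finset.Iio_insert, Finset.prod_insert (by simp), mul_comm]

lemma KProd_right (hb : (b' : ℕ) = b + 1) :
    KProd K b' = (∏ β ∈ Finset.Iio b, K β) * (K b * K b') := by
  rw [KProd, Iic_eq_insert hb, Finset.prod_insert (by rw [Finset.mem_Iic, Fin.le_def]; omega),
    ← KProd, KProd_left]
  ring

/-- The summand of the stable envelope is the two-site summand in the variables of the sites `b`,
`b'`, with the dynamical parameter `pairParam`, times a factor that depends on these variables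
symmetrically. -/
lemma stabSummand_eq_sectorFactor_mul (hq₁ : q₁ ≠ 0) (hb : (b' : ℕ) = b + 1)
    (hm : κ b + κ b' = m) (hN : ∑ β ∈ Finset.Ioi b', κ β = N) (hk : N + m + N' = k)
    (he : ∀ t, (e t : ℕ) = N + t) (x : Fin k → ℂ) :
    stabSummand q₁ q₂ K a z κ x = sectorFactor q₁ q₂ K a z κ b b' N m x *
      stabSummand q₁ q₂ ![K b, K b'] ![a b, a b'] (pairParam q₁ K z b N N') ![κ b, κ b']
        (x ∘ e) := by
  have hbb : b ≠ b' := fun h => by rw [Fin.ext_iff] at h; omega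
  have hpair : ∀ {l : ℕ} (f : Fin l → Fin l → ℂ),
      ∏ i, ∏ j ∈ Finset.Ioi i, f i j = ∏ ij : Fin l × Fin l with ij.1 < ij.2, f ij.1 ij.2 := by
    intro l f
    rw [Finset.prod_filter, Fintype.prod_prod_type]
    refine Finset.prod_congr rfl fun i _ => ?_
    rw [← Finset.prod_filter]
    congr 1
    ext j
    simp
  have hpairs : (∏ i, ∏ j ∈ Finset.Ioi i, theta (q₁ * x j / x i) q₂⁻¹ / theta (x j / x i) q₂⁻¹) =
      (∏ ij : Fin k × Fin k with ij.1 < ij.2 ∧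
        ¬ ((N ≤ ij.1 ∧ (ij.1 : ℕ) < N + m) ∧ (N ≤ ij.2 ∧ (ij.2 : ℕ) < N + m)),
        theta (q₁ * x ij.2 / x ij.1) q₂⁻¹ / theta (x ij.2 / x ij.1) q₂⁻¹) *
      ∏ i, ∏ j ∈ Finset.Ioi i,
        theta (q₁ * (x ∘ e) j / (x ∘ e) i) q₂⁻¹ / theta ((x ∘ e) j / (x ∘ e) i) q₂⁻¹ := by
    rw [hpair, hpair, mul_comm,
      ← Finset.prod_filter_mul_prod_filter_not (Finset.univ.filter _)
        (fun ij : Fin k × Fin k =>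
          (N ≤ ij.1 ∧ (ij.1 : ℕ) < N + m) ∧ (N ≤ ij.2 ∧ (ij.2 : ℕ) < N + m)),
      Finset.filter_filter, Finset.filter_filter]
    congr 1
    have hmap : (Finset.univ.filter fun ij : Fin k × Fin k => ij.1 < ij.2 ∧
        ((N ≤ ij.1 ∧ (ij.1 : ℕ) < N + m) ∧ (N ≤ ij.2 ∧ (ij.2 : ℕ) < N + m))) =
        (Finset.univ.filter fun st : Fin m × Fin m => st.1 < st.2).map (e.prodMap e) := by
      ext ⟨i, j⟩
      simp only [Finset.mem_filter, Finset.mem_univ, true_and, Finset.mem_map, Prod.exists,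
        Function.Embedding.coe_prodMap, Prod.map_apply, Prod.mk.injEq, Fin.lt_def]
      constructor
      · rintro ⟨h1, ⟨h2, h3⟩, h4, h5⟩
        exact ⟨⟨i - N, by omega⟩, ⟨j - N, by omega⟩, by simp only; omega,
          Fin.ext (by rw [he]; simp only; omega), Fin.ext (by rw [he]; simp only; omega)⟩
      · rintro ⟨s, t, hst, rfl, rfl⟩
        have := s.2
        have := t.2
        rw [he, he]
        omega
    rw [hmap, Finset.prod_map]
    rfl
  let G : Fin m → ℂ := fun t => (∏ β ∈ Finset.Iio b, theta (a β / x (e t)) q₂⁻¹) *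
    ∏ β ∈ Finset.Ioi b', theta (K β * a β / x (e t)) q₂⁻¹
  have hleft : ∀ t, envFactor q₁ q₂ K a z b (e t) (x (e t)) =
      G t * envFactor q₁ q₂ ![K b, K b'] ![a b, a b'] (pairParam q₁ K z b N N') 0 t (x (e t)) := by
    intro t
    rw [envFactor_two_zero, pairParam_mul_rhoFactor hq₁ hk he, envFactor, KProd_left,
      Ioi_eq_insert hb, Finset.prod_insert (by simp), ← mul_assoc (z * _)]
    simp only [G]
    ring
  have hright : ∀ t, envFactor q₁ q₂ K a z b' (e t) (x (e t)) =
      G t * envFactor q₁ q₂ ![K b, K b'] ![a b, a b'] (pairParam q₁ K z b N N') 1 t (x (e t)) := by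
    intro t
    rw [envFactor_two_one, pairParam_mul_rhoFactor hq₁ hk he, envFactor, KProd_right hb,
      Iio_eq_insert hb, Finset.prod_insert (by simp), ← mul_assoc (z * _)]
    simp only [G]
    ring
  have hsector : ∀ g : Fin m → ℂ, ∏ t, g t =
      (∏ t with HasColour ![κ b, κ b'] t 0, g t) * ∏ t with HasColour ![κ b, κ b'] t 1, g t := by
    intro g
    obtain ⟨c, hc⟩ := exists_colour (κ := ![κ b, κ b']) (k := m) (by simpa using hm)
    have := prod_prod_hasColour hc fun _ t => g t
    rw [Fin.prod_univ_two] at this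
    exact this.symm
  have hG : (∏ i ∈ Finset.univ.filter fun i : Fin k => N ≤ (i : ℕ) ∧ (i : ℕ) < N + m,
      ((∏ β ∈ Finset.Iio b, theta (a β / x i) q₂⁻¹) *
        ∏ β ∈ Finset.Ioi b', theta (K β * a β / x i) q₂⁻¹)) = ∏ t, G t := by
    rw [filter_sector_eq_map he, Finset.prod_map]
  rw [stabSummand_eq_mul, stabSummand_eq_mul, hpairs, sectorFactor, hG, hsector G,
    prod_eq_mul_prod_filter hbb, filter_hasColour_left_eq_map hb hm hN he,
    filter_hasColour_right_eq_map hm hN he, Finset.prod_map, Finset.prod_map,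
    Finset.prod_congr rfl fun t _ => hleft t, Finset.prod_congr rfl fun t _ => hright t,
    Finset.prod_mul_distrib (f := G), Finset.prod_mul_distrib (f := G), Fin.prod_univ_two]
  simp only [Function.comp_apply]
  ring

/-- The factor of `stabConst` that does not depend on how the variables of the sites `b` and `b'`
are distributed over them. -/
noncomputable def sectorConst (k : ℕ) (q₁ q₂ : ℂ) (K : Fin n → ℂ) (z : ℂ) (κ : Fin n → ℕ)
    (b b' : Fin n) : ℂ :=
  ∏ γ with γ ≠ b ∧ γ ≠ b', ∏ i : Fin k with HasColour κ i γ,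
    theta (K γ) q₂⁻¹ / theta (z * rhoFactor q₁ i * KProd K γ) q₂⁻¹

/-- The corresponding factorization of the normalization constant. -/
lemma stabConst_eq_sectorConst_mul (hq₁ : q₁ ≠ 0) (hb : (b' : ℕ) = b + 1)
    (hm : κ b + κ b' = m) (hN : ∑ β ∈ Finset.Ioi b', κ β = N) (hk : N + m + N' = k) :
    stabConst k q₁ q₂ K z κ = sectorConst k q₁ q₂ K z κ b b' *
      stabConst m q₁ q₂ ![K b, K b'] (pairParam q₁ K z b N N') ![κ b, κ b'] := by
  have hbb : b ≠ b' := fun h => by rw [Fin.ext_iff] at h; omega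
  let e : Fin m ↪ Fin k := ⟨fun t => ⟨N + t, by omega⟩, fun s t h => by
    simpa [Fin.ext_iff] using h⟩
  have he : ∀ t, (e t : ℕ) = N + t := fun t => rfl
  rw [stabConst, sectorConst, prod_eq_mul_prod_filter hbb, stabConst, Fin.prod_univ_two,
    filter_hasColour_left_eq_map hb hm hN he, filter_hasColour_right_eq_map hm hN he,
    Finset.prod_map, Finset.prod_map]
  congr 2
  · refine Finset.prod_congr rfl fun t _ => ?_
    have h1 : KProd ![K b, K b'] 0 = K b := by
      rw [KProd, show Finset.Iic (0 : Fin 2) = {0} from rfl]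
      simp
    rw [pairParam_mul_rhoFactor hq₁ hk he, h1, KProd_left, ← mul_assoc]
    rfl
  · refine Finset.prod_congr rfl fun t _ => ?_
    have h1 : KProd ![K b, K b'] 1 = K b * K b' := by
      rw [KProd, show Finset.Iic (1 : Fin 2) = {0, 1} from rfl]
      simp
    rw [pairParam_mul_rhoFactor hq₁ hk he, h1, KProd_right hb, ← mul_assoc]
    rfl

/-- `sectorFactor` is symmetric in the variables of the sites `b` and `b'`. -/
lemma sectorFactor_comp (σ : Equiv.Perm (Fin k))
    (hσ : ∀ i : Fin k, ¬ (N ≤ i ∧ (i : ℕ) < N + m) → σ i = i) (hb : (b' : ℕ) = b + 1)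
    (hm : κ b + κ b' = m) (hN : ∑ β ∈ Finset.Ioi b', κ β = N) (hκ : ∑ γ, κ γ = k)
    (x : Fin k → ℂ) :
    sectorFactor q₁ q₂ K a z κ b b' N m (x ∘ σ) = sectorFactor q₁ q₂ K a z κ b b' N m x := by
  have hσ' : ∀ i : Fin k, (N ≤ i ∧ (i : ℕ) < N + m) ↔ (N ≤ σ i ∧ (σ i : ℕ) < N + m) := by
    intro i
    by_cases h : N ≤ i ∧ (i : ℕ) < N + m
    · refine iff_of_true h ?_
      by_contra h'
      rw [σ.injective (hσ _ h')] at h'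
      exact h' h
    · rw [hσ i h]
  rw [sectorFactor, sectorFactor]
  congr 1
  · congr 1
    · refine Finset.prod_equiv (σ.prodCongr σ) (fun ij => ?_) fun ij _ => rfl
      simp only [Finset.mem_filter, Finset.mem_univ, true_and, Equiv.prodCongr_apply,
        Prod.map_fst, Prod.map_snd, Fin.lt_def]
      have h1 := hσ' ij.1
      have h2 := hσ' ij.2
      have h3 := hσ ij.1
      have h4 := hσ ij.2
      rw [Fin.ext_iff] at h3 h4
      omega
    · refine Finset.prod_congr rfl fun γ hγ => Finset.prod_congr rfl fun i hi => ?_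
      have hγ := (Finset.mem_filter.1 hγ).2
      have hi := (Finset.mem_filter.1 hi).2
      obtain ⟨c, hc⟩ := exists_colour hκ
      have h1 : ¬ (N ≤ i ∧ (i : ℕ) < N + m) := by
        intro h
        have e1 := (hc i γ).1 hi
        by_cases h2 : (i : ℕ) < N + κ b'
        · exact hγ.2 (e1.trans ((hc i b').1 ((hasColour_right hN i).2 ⟨h.1, h2⟩)).symm)
        · exact hγ.1 (e1.trans ((hc i b).1 ((hasColour_left hb hm hN i).2
            ⟨not_lt.1 h2, h.2⟩)).symm)
      rw [Function.comp_apply, hσ i h1]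
  · refine Finset.prod_equiv σ (fun i => ?_) fun i _ => rfl
    simp only [Finset.mem_filter, Finset.mem_univ, true_and]
    exact hσ' i

section Congr

variable {s : Equiv.Perm (Fin n)}

lemma prod_comp_of_fix {M : Type*} [CommMonoid M] (hs : ∀ γ, γ ≠ b → γ ≠ b' → s γ = γ)
    {S : Finset (Fin n)} (hS : b ∈ S ↔ b' ∈ S) (f : Fin n → M) :
    ∏ β ∈ S, f (s β) = ∏ β ∈ S, f β := by
  refine Finset.prod_equiv s (fun β => ?_) fun β _ => rfl
  have key : ∀ γ, γ = b ∨ γ = b' → s γ = b ∨ s γ = b' := by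
    intro γ hγ
    by_contra! h
    have := s.injective (hs _ h.1 h.2)
    rw [this] at h
    tauto
  by_cases h : β = b ∨ β = b'
  · have h1 : β ∈ S ↔ b ∈ S := by
      rcases h with h | h <;> rw [h]
      exact hS.symm
    have h2 : s β ∈ S ↔ b ∈ S := by
      rcases key β h with h | h <;> rw [h]
      exact hS.symm
    rw [h1, h2]
  · push Not at h
    rw [hs β h.1 h.2]

/-- The positions of the variables of the other sites do not depend on the distribution of the
remaining variables over the neighbouring sites `b` and `b'`. -/
lemma hasColour_congr (hb : (b' : ℕ) = b + 1) {κ' : Fin n → ℕ}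
    (hκ : ∀ γ, γ ≠ b → γ ≠ b' → κ' γ = κ γ) (hm : κ' b + κ' b' = κ b + κ b') {γ : Fin n}
    (h : γ ≠ b) (h' : γ ≠ b') (i : Fin k) : HasColour κ' i γ ↔ HasColour κ i γ := by
  have hbb : b ≠ b' := fun h => by rw [Fin.ext_iff] at h; omega
  have key : ∀ S : Finset (Fin n), (b ∈ S ↔ b' ∈ S) → ∑ β ∈ S, κ' β = ∑ β ∈ S, κ β := by
    intro S hS
    by_cases hbS : b ∈ S
    · have hb'S := hS.1 hbS
      have h1 : b' ∈ S.erase b := Finset.mem_erase.2 ⟨hbb.symm, hb'S⟩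
      rw [← Finset.add_sum_erase _ _ hbS, ← Finset.add_sum_erase _ _ h1,
        ← Finset.add_sum_erase (a := b) _ _ hbS, ← Finset.add_sum_erase _ _ h1, ← add_assoc,
        hm, add_assoc]
      congr 2
      refine Finset.sum_congr rfl fun β hβ => ?_
      simp only [Finset.mem_erase] at hβ
      exact hκ β hβ.2.1 hβ.1
    · refine Finset.sum_congr rfl fun β hβ => hκ β ?_ ?_
      · rintro rfl
        exact hbS hβ
      · rintro rfl
        exact hbS (hS.2 hβ)
  rw [Ne, Fin.ext_iff] at h h'
  rw [HasColour, HasColour, key, key]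
  · simp only [Finset.mem_Ici, Fin.le_def]
    omega
  · simp only [Finset.mem_Ioi, Fin.lt_def]
    omega

lemma KProd_comp (hb : (b' : ℕ) = b + 1) (hs : ∀ γ, γ ≠ b → γ ≠ b' → s γ = γ) {γ : Fin n}
    (h : γ ≠ b) (h' : γ ≠ b') : KProd (K ∘ s) γ = KProd K γ := by
  rw [Ne, Fin.ext_iff] at h h'
  refine prod_comp_of_fix hs ?_ K
  simp only [Finset.mem_Iic, Fin.le_def]
  omega

lemma pairParam_comp (hb : (b' : ℕ) = b + 1) (hs : ∀ γ, γ ≠ b → γ ≠ b' → s γ = γ) :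
    pairParam q₁ (K ∘ s) z b N N' = pairParam q₁ K z b N N' := by
  rw [pairParam, pairParam]
  congr 2
  refine Finset.prod_congr rfl fun β hβ => ?_
  have := Fin.lt_def.1 (Finset.mem_Iio.1 hβ)
  rw [Function.comp_apply, hs] <;> rw [Ne, Fin.ext_iff] <;> omega

/-- `sectorFactor` depends neither on the order of the sites `b`, `b'` nor on the distribution of
the variables over them. -/
lemma sectorFactor_congr (hb : (b' : ℕ) = b + 1) (hs : ∀ γ, γ ≠ b → γ ≠ b' → s γ = γ)
    {κ' : Fin n → ℕ} (hκ : ∀ γ, γ ≠ b → γ ≠ b' → κ' γ = κ γ)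
    (hm : κ' b + κ' b' = κ b + κ b') (x : Fin k → ℂ) :
    sectorFactor q₁ q₂ (K ∘ s) (a ∘ s) z κ' b b' N m x =
      sectorFactor q₁ q₂ K a z κ b b' N m x := by
  rw [sectorFactor, sectorFactor]
  congr 1
  · congr 1
    refine Finset.prod_congr rfl fun γ hγ => ?_
    obtain ⟨h, h'⟩ := (Finset.mem_filter.1 hγ).2
    simp_rw [hasColour_congr hb hκ hm h h']
    refine Finset.prod_congr rfl fun i _ => ?_
    rw [envFactor, envFactor, KProd_comp hb hs h h', Function.comp_apply, hs γ h h']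
    rw [Ne, Fin.ext_iff] at h h'
    congr 1
    · congr 1
      refine prod_comp_of_fix hs ?_ fun β => theta (a β / x i) q₂⁻¹
      simp only [Finset.mem_Iio, Fin.lt_def]
      omega
    · refine prod_comp_of_fix hs ?_ fun β => theta (K β * a β / x i) q₂⁻¹
      simp only [Finset.mem_Ioi, Fin.lt_def]
      omega
  · refine Finset.prod_congr rfl fun i _ => ?_
    congr 1
    · refine prod_comp_of_fix hs ?_ fun β => theta (a β / x i) q₂⁻¹
      simp only [Finset.mem_Iio, Fin.lt_def]
      omega
    · refine prod_comp_of_fix hs ?_ fun β => theta (K β * a β / x i) q₂⁻¹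
      simp only [Finset.mem_Ioi, Fin.lt_def]
      omega

lemma sectorConst_congr (hb : (b' : ℕ) = b + 1) (hs : ∀ γ, γ ≠ b → γ ≠ b' → s γ = γ)
    {κ' : Fin n → ℕ} (hκ : ∀ γ, γ ≠ b → γ ≠ b' → κ' γ = κ γ)
    (hm : κ' b + κ' b' = κ b + κ b') :
    sectorConst k q₁ q₂ (K ∘ s) z κ' b b' = sectorConst k q₁ q₂ K z κ b b' := by
  rw [sectorConst, sectorConst]
  refine Finset.prod_congr rfl fun γ hγ => ?_
  obtain ⟨h, h'⟩ := (Finset.mem_filter.1 hγ).2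
  simp_rw [hasColour_congr hb hκ hm h h', KProd_comp hb hs h h', Function.comp_apply, hs γ h h']

end Congr

end

end Sector


/-! ### Exchange of two neighbouring sites for small `q₁` -/

section Exchange

open MeasureTheory

variable {n k m N N' : ℕ} {b b' : Fin n} {q₁ q₂ p z : ℂ} {K a : Fin n → ℂ} {κ κ' : Fin n → ℕ}
  {s : Equiv.Perm (Fin n)} {e : Fin m ↪ Fin k}

lemma GenericPoint.inequivalent {x : Fin k → ℂ} (h : GenericPoint q₁ q₂ p K a x)
    (hx : ∀ i, x i ≠ 0) : Inequivalent q₂⁻¹ x :=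
  ⟨hx, fun i j hij t e => (h.ratio j i hij.symm).2 t 0 (by
    rw [zpow_zero, mul_one, div_eq_iff (hx j), e])⟩

lemma principalPart_site_comp (s : Equiv.Perm (Fin n)) (x : Fin k → ℂ) :
    principalPart q₁ q₂ p (K ∘ s) (a ∘ s) x = principalPart q₁ q₂ p K a x := by
  unfold principalPart
  congr 1
  exact Finset.prod_congr rfl fun i _ => Equiv.prod_comp s
    fun β => ellGamma (a β / x i) q₂⁻¹ p / ellGamma (K β * a β / x i) q₂⁻¹ p

lemma stabDenom_site_comp (s : Equiv.Perm (Fin n)) (x : Fin k → ℂ) :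
    stabDenom q₂ (K ∘ s) (a ∘ s) x = stabDenom q₂ K a x :=
  Finset.prod_congr rfl fun i _ => Equiv.prod_comp s fun β => theta (K β * a β / x i) q₂⁻¹

/-- Symmetrization over the variables of two neighbouring sites turns the summand of the stable
envelope into a multiple of a two-site stable envelope. -/
lemma sum_stabSummand (hq₁ : q₁ ≠ 0) (hb : (b' : ℕ) = b + 1) (hm : κ b + κ b' = m)
    (hN : ∑ β ∈ Finset.Ioi b', κ β = N) (hk : N + m + N' = k) (hsum : ∑ γ, κ γ = k)
    (he : ∀ t, (e t : ℕ) = N + t) (hs : ∀ γ, γ ≠ b → γ ≠ b' → s γ = γ)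
    (hκ : ∀ γ, γ ≠ b → γ ≠ b' → κ' γ = κ γ) (hm' : κ' b + κ' b' = κ b + κ b') (x : Fin k → ℂ) :
    ∑ τ : Equiv.Perm (Fin m),
        stabSummand q₁ q₂ (K ∘ s) (a ∘ s) z κ' (x ∘ τ.viaFintypeEmbedding e) =
      sectorFactor q₁ q₂ K a z κ b b' N m x *
        stabNum q₁ q₂ ![K (s b), K (s b')] ![a (s b), a (s b')] (pairParam q₁ K z b N N')
          ![κ' b, κ' b'] (x ∘ e) := by
  have hN' : ∑ β ∈ Finset.Ioi b', κ' β = N := by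
    rw [← hN]
    refine Finset.sum_congr rfl fun β hβ => ?_
    have := Fin.lt_def.1 (Finset.mem_Ioi.1 hβ)
    refine hκ β ?_ ?_ <;> rw [Ne, Fin.ext_iff] <;> omega
  rw [stabNum, Finset.mul_sum]
  refine Finset.sum_congr rfl fun τ _ => ?_
  rw [stabSummand_eq_sectorFactor_mul hq₁ hb (hm'.trans hm) hN' hk he,
    sectorFactor_congr hb hs hκ hm', sectorFactor_comp _ _ hb hm hN hsum, pairParam_comp hb hs]
  · congr 2
    ext t
    simp only [Function.comp_apply]
    rw [Equiv.Perm.viaFintypeEmbedding_apply_image]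
  · intro i hi
    refine Equiv.Perm.viaFintypeEmbedding_apply_notMem_range _ _ fun ⟨t, ht⟩ => hi ?_
    rw [← ht, he]
    have := t.2
    omega

/-- The composition with the parts `u` and `v` at the sites `b` and `b'`, and the parts of `κ` at
the other sites. -/
def pairComp (κ : Fin n → ℕ) (b b' : Fin n) (u v : ℕ) : Fin n → ℕ :=
  Function.update (Function.update κ b u) b' v

lemma pairComp_left (h : b ≠ b') (u v : ℕ) : pairComp κ b b' u v b = u := by
  rw [pairComp, Function.update_of_ne h, Function.update_self]

lemma pairComp_right (u v : ℕ) : pairComp κ b b' u v b' = v := by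
  rw [pairComp, Function.update_self]

lemma pairComp_of_ne {γ : Fin n} (h : γ ≠ b) (h' : γ ≠ b') (u v : ℕ) :
    pairComp κ b b' u v γ = κ γ := by
  rw [pairComp, Function.update_of_ne h', Function.update_of_ne h]

lemma sum_pairComp (h : b ≠ b') {u v : ℕ} (huv : u + v = κ b + κ b') :
    ∑ γ, pairComp κ b b' u v γ = ∑ γ, κ γ := by
  have key : ∀ κ : Fin n → ℕ, ∑ γ, κ γ = ∑ γ with γ ≠ b ∧ γ ≠ b', κ γ + (κ b + κ b') := by
    intro κ
    exact prod_eq_mul_prod_filter (M := Multiplicative ℕ) h κ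
  rw [key, key κ, pairComp_left h, pairComp_right, huv]
  congr 1
  refine Finset.sum_congr rfl fun γ hγ => ?_
  obtain ⟨h1, h2⟩ := (Finset.mem_filter.1 hγ).2
  exact pairComp_of_ne h1 h2 u v

lemma Admissible.continuous (hq₂ : 1 < ‖q₂‖) (hp : p ≠ 0) (hp1 : ‖p‖ < 1) (hq₁ : q₁ ≠ 0)
    (hz : z ≠ 0) (hK : ∀ β, K β ≠ 0) (ha : ∀ β, a β ≠ 0) {r : Fin k → ℝ}
    (h : Admissible q₁ q₂ p K a κ r) :
    Continuous fun u => regIntegrand q₁ q₂ p K a z κ (torusPt r u) := by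
  have hq20 : q₂ ≠ 0 := norm_pos_iff.1 (one_pos.trans hq₂)
  refine continuous_iff_continuousAt.2 fun u => ?_
  have h1 : DifferentiableAt ℂ (fun x : Fin k → ℂ => regIntegrand q₁ q₂ p K a z κ x)
      (torusPt r u) := by
    refine differentiableAt_regIntegrand (Q := fun _ => q₁) (L := fun _ => K) (X := fun x => x)
      (norm_inv_lt_one_of_one_lt hq₂) (inv_ne_zero hq20) hp1 hp hz ha (by fun_prop)
      (fun β => by fun_prop) (fun i => by fun_prop) hq₁ hK ?_
    simp_rw [norm_torusPt h.pos]
    exact h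
  exact h1.continuousAt.comp
    (f := torusPt r) (continuous_pi fun i => continuous_torusPt r i).continuousAt

/-- If the torus has equal radii, then the integral may be symmetrized. -/
lemma factorial_mul_blockIntegral (hq₂ : 1 < ‖q₂‖) (hp : p ≠ 0) (hp1 : ‖p‖ < 1) (hq₁ : q₁ ≠ 0)
    (hz : z ≠ 0) (hK : ∀ β, K β ≠ 0) (ha : ∀ β, a β ≠ 0) {R : ℝ}
    (h : Admissible q₁ q₂ p K a κ fun _ : Fin k => R) (e : Fin m ↪ Fin k) :
    (m.factorial : ℂ) * blockIntegral q₁ q₂ p K a z κ (fun _ : Fin k => R) =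
      ∫ u, ∑ τ : Equiv.Perm (Fin m), regIntegrand q₁ q₂ p K a z κ
        (torusPt (fun _ => R) u ∘ τ.viaFintypeEmbedding e) ∂torusMeasure k := by
  have hc := h.continuous hq₂ hp hp1 hq₁ hz hK ha
  rw [integral_finsetSum]
  · have : ∀ τ : Equiv.Perm (Fin m), ∫ u, regIntegrand q₁ q₂ p K a z κ
        (torusPt (fun _ => R) u ∘ τ.viaFintypeEmbedding e) ∂torusMeasure k =
        blockIntegral q₁ q₂ p K a z κ (fun _ : Fin k => R) := fun τ =>
      integral_torus_comp_perm (fun u => regIntegrand q₁ q₂ p K a z κ (torusPt (fun _ => R) u)) _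
    rw [Finset.sum_congr rfl fun τ _ => this τ]
    simp [Fintype.card_perm]
  · intro τ _
    refine Continuous.integrable_of_hasCompactSupport ?_ (HasCompactSupport.of_compactSpace _)
    exact hc.comp (continuous_pi fun i => continuous_apply (τ.viaFintypeEmbedding e i))

/-- The exchange relation on a torus with equal radii. -/
lemma blockIntegral_exchange_of_common_radius (hq₂ : 1 < ‖q₂‖) (hp : p ≠ 0) (hp1 : ‖p‖ < 1)
    (hq₁ : q₁ ≠ 0) (hz : z ≠ 0) (hK : ∀ β, K β ≠ 0) (ha : ∀ β, a β ≠ 0)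
    (hb : (b' : ℕ) = b + 1) (hm : κ b + κ b' = m) (hN : ∑ β ∈ Finset.Ioi b', κ β = N)
    (hk : N + m + N' = k) (hsum : ∑ γ, κ γ = k)
    (hgen : GenericPair q₁ q₂ (a b) (a b') (K b) (K b') (pairParam q₁ K z b N N')) {R : ℝ}
    (h₁ : ∀ j : Fin (m + 1),
      Admissible q₁ q₂ p K a (pairComp κ b b' j (m - j)) fun _ : Fin k => R)
    (h₂ : ∀ l : Fin (m + 1), Admissible q₁ q₂ p (K ∘ Equiv.swap b b') (a ∘ Equiv.swap b b')
      (pairComp κ b b' (m - l) l) fun _ : Fin k => R) (j : Fin (m + 1)) :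
    blockIntegral q₁ q₂ p K a z (pairComp κ b b' j (m - j)) (fun _ : Fin k => R) =
      ∑ l : Fin (m + 1),
        (antiMatrix q₁ q₂ (a b) (a b') (K b) (K b') (pairParam q₁ K z b N N') m *
          (antiMatrixRev q₁ q₂ (a b) (a b') (K b) (K b') (pairParam q₁ K z b N N') m)⁻¹) j l *
        blockIntegral q₁ q₂ p (K ∘ Equiv.swap b b') (a ∘ Equiv.swap b b') z
          (pairComp κ b b' (m - l) l) (fun _ : Fin k => R) := by
  have hbb : b ≠ b' := fun h => by rw [Fin.ext_iff] at h; omega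
  have hq := norm_inv_lt_one_of_one_lt hq₂
  have hq20 : q₂ ≠ 0 := norm_pos_iff.1 (one_pos.trans hq₂)
  have hq0 := inv_ne_zero hq20
  have hR : 0 < k → 0 < R := fun hk => (h₁ 0).pos ⟨0, hk⟩
  have hs : ∀ γ, γ ≠ b → γ ≠ b' → Equiv.swap b b' γ = γ := fun γ => Equiv.swap_apply_of_ne_of_ne
  have hs1 : ∀ γ, γ ≠ b → γ ≠ b' → (1 : Equiv.Perm (Fin n)) γ = γ := fun _ _ _ => rfl
  let e : Fin m ↪ Fin k := ⟨fun t => ⟨N + t, by omega⟩, fun s t h => by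
    simpa [Fin.ext_iff] using h⟩
  have he : ∀ t, (e t : ℕ) = N + t := fun t => rfl
  set M := antiMatrix q₁ q₂ (a b) (a b') (K b) (K b') (pairParam q₁ K z b N N') m *
    (antiMatrixRev q₁ q₂ (a b) (a b') (K b) (K b') (pairParam q₁ K z b N N') m)⁻¹ with hM
  have hK' : ∀ β, (K ∘ Equiv.swap b b') β ≠ 0 := fun β => hK _
  have ha' : ∀ β, (a ∘ Equiv.swap b b') β ≠ 0 := fun β => ha _
  have hjm : ∀ j : Fin (m + 1), (j : ℕ) + (m - j) = m := fun j => by omega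
  have hlm : ∀ l : Fin (m + 1), (m - l : ℕ) + l = m := fun l => by omega
  -- the symmetrized integrands at a generic point
  have h12 : ∀ x : Fin k → ℂ, GenericPoint q₁ q₂ p K a x → ∀ j : Fin (m + 1),
      ∑ τ : Equiv.Perm (Fin m), regIntegrand q₁ q₂ p K a z (pairComp κ b b' j (m - j))
        (x ∘ τ.viaFintypeEmbedding e) =
      principalPart q₁ q₂ p K a x / stabDenom q₂ K a x * sectorFactor q₁ q₂ K a z κ b b' N m x *
        stabNum q₁ q₂ ![K b, K b'] ![a b, a b'] (pairParam q₁ K z b N N') ![(j : ℕ), m - (j : ℕ)]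
          (x ∘ e) := by
    intro x hx j
    have hsumj : ∑ γ, pairComp κ b b' j (m - j) γ = k :=
      (sum_pairComp hbb ((hjm j).trans hm.symm)).trans hsum
    have h := sum_stabSummand (q₂ := q₂) (z := z) (K := K) (a := a) (s := 1)
      (κ' := pairComp κ b b' j (m - j)) hq₁ hb hm hN hk hsum he hs1
      (fun γ h h' => pairComp_of_ne h h' _ _)
      (by rw [pairComp_left hbb, pairComp_right, hjm, hm]) x
    simp only [pairComp_left hbb, pairComp_right, Equiv.Perm.coe_one, Function.comp_id, id_eq] at h
    rw [mul_assoc, ← h, Finset.mul_sum]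
    refine Finset.sum_congr rfl fun τ _ => ?_
    rw [← regIntegrand_eq hsumj hq hq0 hp1 hp (hx.comp _), principalPart_comp, stabDenom_comp]
    ring
  have h21 : ∀ x : Fin k → ℂ, GenericPoint q₁ q₂ p K a x → ∀ l : Fin (m + 1),
      ∑ τ : Equiv.Perm (Fin m), regIntegrand q₁ q₂ p (K ∘ Equiv.swap b b') (a ∘ Equiv.swap b b') z
        (pairComp κ b b' (m - l) l) (x ∘ τ.viaFintypeEmbedding e) =
      principalPart q₁ q₂ p K a x / stabDenom q₂ K a x * sectorFactor q₁ q₂ K a z κ b b' N m x *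
        stabNum q₁ q₂ ![K b', K b] ![a b', a b] (pairParam q₁ K z b N N') ![m - (l : ℕ), (l : ℕ)]
          (x ∘ e) := by
    intro x hx l
    have hsuml : ∑ γ, pairComp κ b b' (m - l) l γ = k :=
      (sum_pairComp hbb ((hlm l).trans hm.symm)).trans hsum
    have hx' : GenericPoint q₁ q₂ p (K ∘ Equiv.swap b b') (a ∘ Equiv.swap b b') x :=
      ⟨hx.ratio, hx.ratio', fun i β => hx.site i _, fun i β => hx.site' i _⟩
    have h := sum_stabSummand (q₂ := q₂) (z := z) (K := K) (a := a) (s := Equiv.swap b b')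
      (κ' := pairComp κ b b' (m - l) l) hq₁ hb hm hN hk hsum he hs
      (fun γ h h' => pairComp_of_ne h h' _ _)
      (by rw [pairComp_left hbb, pairComp_right, hlm, hm]) x
    simp only [pairComp_left hbb, pairComp_right, Equiv.swap_apply_left,
      Equiv.swap_apply_right] at h
    rw [mul_assoc, ← h, Finset.mul_sum]
    refine Finset.sum_congr rfl fun τ _ => ?_
    rw [← regIntegrand_eq hsuml hq hq0 hp1 hp (hx'.comp _), principalPart_comp, stabDenom_comp,
      principalPart_site_comp, stabDenom_site_comp]
    ring
  have hpoint : ∀ x : Fin k → ℂ, GenericPoint q₁ q₂ p K a x → (∀ i, x i ≠ 0) →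
      ∑ τ : Equiv.Perm (Fin m), regIntegrand q₁ q₂ p K a z (pairComp κ b b' j (m - j))
        (x ∘ τ.viaFintypeEmbedding e) =
      ∑ l : Fin (m + 1), M j l * ∑ τ : Equiv.Perm (Fin m),
        regIntegrand q₁ q₂ p (K ∘ Equiv.swap b b') (a ∘ Equiv.swap b b') z
          (pairComp κ b b' (m - l) l) (x ∘ τ.viaFintypeEmbedding e) := by
    intro x hx hx0
    have hy : Inequivalent q₂⁻¹ (x ∘ e) := by
      have := hx.inequivalent hx0
      exact ⟨fun _ => hx0 _, fun i j hij => this.2 _ _ (e.injective.ne hij)⟩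
    have hoff : stabNum q₁ q₂ ![K b, K b'] ![a b, a b'] (pairParam q₁ K z b N N')
          ![(j : ℕ), m - (j : ℕ)] (x ∘ e) =
        ∑ l : Fin (m + 1), M j l * stabNum q₁ q₂ ![K b', K b] ![a b', a b]
          (pairParam q₁ K z b N N') ![m - (l : ℕ), (l : ℕ)] (x ∘ e) := by
      apply mul_right_cancel₀ (thetaVandermonde_ne_zero hq hq0 hy)
      rw [stabNum_mul_thetaVandermonde hq hq0 hy, hgen.antiNum_eq_sum j hy.1, Finset.sum_mul]
      refine Finset.sum_congr rfl fun l _ => ?_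
      rw [mul_assoc, stabNum_mul_thetaVandermonde hq hq0 hy]
    rw [h12 x hx, hoff, Finset.mul_sum]
    refine Finset.sum_congr rfl fun l _ => ?_
    rw [h21 x hx]
    ring
  have hfact : (m.factorial : ℂ) ≠ 0 := by exact_mod_cast m.factorial_ne_zero
  apply mul_left_cancel₀ hfact
  rw [factorial_mul_blockIntegral hq₂ hp hp1 hq₁ hz hK ha (h₁ j) e, Finset.mul_sum]
  have hrhs : ∀ l : Fin (m + 1), (m.factorial : ℂ) * (M j l *
      blockIntegral q₁ q₂ p (K ∘ Equiv.swap b b') (a ∘ Equiv.swap b b') z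
          (pairComp κ b b' (m - l) l) (fun _ : Fin k => R)) =
      ∫ u, M j l * ∑ τ : Equiv.Perm (Fin m),
        regIntegrand q₁ q₂ p (K ∘ Equiv.swap b b') (a ∘ Equiv.swap b b') z
          (pairComp κ b b' (m - l) l) (torusPt (fun _ => R) u ∘ τ.viaFintypeEmbedding e)
          ∂torusMeasure k := by
    intro l
    rw [integral_const_mul, ← factorial_mul_blockIntegral hq₂ hp hp1 hq₁ hz hK' ha' (h₂ l) e]
    ring
  rw [Finset.sum_congr rfl fun l _ => hrhs l, ← integral_finsetSum]
  · refine integral_congr_ae ?_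
    have hRpos : ∀ _ : Fin k, 0 < R := fun i => hR (i.pos)
    filter_upwards [ae_genericPoint hq₁ hq20 hp hK ha hRpos] with u hu
    exact hpoint _ hu fun i => norm_pos_iff.1 (by rw [norm_torusPt hRpos]; exact hRpos i)
  · intro l _
    refine Continuous.integrable_of_hasCompactSupport ?_ (HasCompactSupport.of_compactSpace _)
    refine continuous_const.mul (continuous_finsetSum _ fun τ _ => ?_)
    exact ((h₂ l).continuous hq₂ hp hp1 hq₁ hz hK' ha').comp
      (continuous_pi fun i => continuous_apply (τ.viaFintypeEmbedding e i))

end Exchange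


/-! ### Exchange of two neighbouring sites by analytic continuation -/

section Continuation

open MeasureTheory

/-- If `c t ^ e = d` does not hold at `t = 1`, then it has at most countably many solutions `t ≠ 0`.
-/
lemma countable_mul_zpow_eq {c : ℂ} (hc : c ≠ 0) (d : ℂ) (e : ℤ) :
    {t : ℂ | t ≠ 0 ∧ c ≠ d ∧ c * t ^ e = d}.Countable := by
  have hpow : ∀ (N : ℕ) (y : ℂ), 0 < N → {t : ℂ | t ^ N = y}.Countable := by
    intro N y hN
    refine ((Polynomial.nthRoots N y).toFinset.finite_toSet.subset fun t ht => ?_).countable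
    simpa [Polynomial.mem_nthRoots hN] using ht
  obtain ⟨N, rfl | rfl⟩ := e.eq_nat_or_neg
  · rcases Nat.eq_zero_or_pos N with rfl | hN
    · refine Set.Countable.mono (fun t ht => ?_) Set.countable_empty
      obtain ⟨-, h1, h2⟩ := ht
      exact h1 (by simpa using h2)
    · refine (hpow N (d / c) hN).mono fun t ht => ?_
      obtain ⟨-, -, h2⟩ := ht
      rw [zpow_natCast] at h2
      change t ^ N = d / c
      rw [← h2, mul_div_cancel_left₀ _ hc]
  · rcases Nat.eq_zero_or_pos N with rfl | hN
    · refine Set.Countable.mono (fun t ht => ?_) Set.countable_empty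
      obtain ⟨-, h1, h2⟩ := ht
      exact h1 (by simpa using h2)
    · refine (hpow N (c / d) hN).mono fun t ht => ?_
      obtain ⟨h0, -, h2⟩ := ht
      rw [zpow_neg, zpow_natCast] at h2
      change t ^ N = c / d
      rw [← h2]
      field_simp

/-- Genericity of two sites persists for all but countably many members of the family
`(t q₁, K₁ / t, K₂ / t)`. -/
lemma GenericPair.exists_countable {q₁ q₂ a₁ a₂ K₁ K₂ w : ℂ} (h : GenericPair q₁ q₂ a₁ a₂ K₁ K₂ w)
    (e : ℤ) : ∃ C : Set ℂ, C.Countable ∧ ∀ t : ℂ, t ≠ 0 → t ∉ C →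
      GenericPair (t * q₁) q₂ a₁ a₂ (K₁ / t) (K₂ / t) (w * t ^ e) := by
  have hq20 := h.q₂_ne
  have hq₁ := h.q₁_ne
  let S : ℂ → ℂ → ℤ → Set ℂ := fun c d e => {t : ℂ | t ≠ 0 ∧ c ≠ d ∧ c * t ^ e = d}
  have hlat : ∀ s u : ℤ, q₁ ^ s * q₂ ^ u ≠ 0 := fun s u =>
    mul_ne_zero (zpow_ne_zero _ hq₁) (zpow_ne_zero _ hq20)
  refine ⟨(⋃ s : ℤ, ⋃ u : ℤ, S (q₁ ^ s) (q₂ ^ u) s) ∪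
    (⋃ s : ℤ, ⋃ u : ℤ, S (q₁ ^ s * q₂ ^ u) (a₁ / a₂) s) ∪
    (⋃ s : ℤ, ⋃ u : ℤ, S (q₁ ^ s * q₂ ^ u) (K₁ * a₁ / a₂) (s + 1)) ∪
    (⋃ s : ℤ, ⋃ u : ℤ, S (q₁ ^ s * q₂ ^ u) (K₂ * a₂ / a₁) (s + 1)) ∪
    (⋃ s : ℤ, ⋃ u : ℤ, ⋃ e₁ : ℤ, ⋃ e₂ : ℤ,
      S (q₁ ^ s * q₂ ^ u * (K₁ ^ e₁ * K₂ ^ e₂)) w (s - e₁ - e₂ - e)), ?_, ?_⟩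
  · refine Set.Countable.union (Set.Countable.union (Set.Countable.union (Set.Countable.union
      ?_ ?_) ?_) ?_) ?_
    · exact Set.countable_iUnion fun s => Set.countable_iUnion fun u =>
        countable_mul_zpow_eq (zpow_ne_zero _ hq₁) _ _
    · exact Set.countable_iUnion fun s => Set.countable_iUnion fun u =>
        countable_mul_zpow_eq (hlat s u) _ _
    · exact Set.countable_iUnion fun s => Set.countable_iUnion fun u =>
        countable_mul_zpow_eq (hlat s u) _ _
    · exact Set.countable_iUnion fun s => Set.countable_iUnion fun u =>
        countable_mul_zpow_eq (hlat s u) _ _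
    · exact Set.countable_iUnion fun s => Set.countable_iUnion fun u =>
        Set.countable_iUnion fun e₁ => Set.countable_iUnion fun e₂ =>
        countable_mul_zpow_eq (mul_ne_zero (hlat s u)
          (mul_ne_zero (zpow_ne_zero _ h.K₁_ne) (zpow_ne_zero _ h.K₂_ne))) _ _
  · intro t ht hC
    simp only [Set.mem_union, Set.mem_iUnion, not_or, not_exists, S, Set.mem_ofPred_eq,
      not_and] at hC
    obtain ⟨⟨⟨⟨h1, h2⟩, h3⟩, h4⟩, h5⟩ := hC
    refine ⟨h.one_lt, mul_ne_zero ht hq₁, h.a₁_ne, h.a₂_ne, div_ne_zero h.K₁_ne ht,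
      div_ne_zero h.K₂_ne ht, mul_ne_zero h.z_ne (zpow_ne_zero _ ht), fun s u hs e => ?_,
      fun s u e => ?_, fun s u e => ?_, fun s u e => ?_, fun s u e₁ e₂ e' => ?_⟩
    · refine h1 s u ht (h.pow_ne s u hs) ?_
      rw [← e, mul_zpow, mul_comm]
    · refine h2 s u ht (h.a_ne s u).symm ?_
      rw [e, mul_zpow]
      ring
    · refine h3 s u ht (h.Ka_ne s u).symm ?_
      have : K₁ * a₁ / a₂ = K₁ / t * a₁ / a₂ * t := by field_simp
      rw [this, e, mul_zpow, zpow_add_one₀ ht]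
      ring
    · refine h4 s u ht (h.Ka_ne' s u).symm ?_
      have : K₂ * a₂ / a₁ = K₂ / t * a₂ / a₁ * t := by field_simp
      rw [this, e, mul_zpow, zpow_add_one₀ ht]
      ring
    · refine h5 s u e₁ e₂ ht (h.zK_ne s u e₁ e₂).symm ?_
      have h0 := zpow_ne_zero e ht
      have : w = w * t ^ e * (t ^ e)⁻¹ := by field_simp
      rw [this, e', mul_zpow, div_zpow, div_zpow, zpow_sub₀ ht, zpow_sub₀ ht, zpow_sub₀ ht]
      simp only [div_eq_mul_inv]
      ring

variable {n k m N N' : ℕ} {b b' : Fin n} {q₁ q₂ p z : ℂ} {K a : Fin n → ℂ} {κ : Fin n → ℕ}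

/-- In the family `(t q₁, K / t)` the conditions on the radii get weaker as `|t|` decreases. -/
lemma Admissible.of_norm_le {r : Fin k → ℝ} {t t' : ℂ} (ht' : t' ≠ 0) (hle : ‖t'‖ ≤ ‖t‖)
    (h : Admissible (t * q₁) q₂ p (fun β => K β / t) a κ r) :
    Admissible (t' * q₁) q₂ p (fun β => K β / t') a κ r := by
  have hpos : 0 < ‖t'‖ := norm_pos_iff.2 ht'
  have hle' : ∀ β, ‖q₂ * (K β / t) * a β‖ ≤ ‖q₂ * (K β / t') * a β‖ := by
    intro β
    simp only [norm_mul, norm_div]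
    gcongr
  refine ⟨h.pos, fun i j hij => ⟨?_, ?_⟩, h.lower, h.lower', fun i γ hi β hβ => ?_,
    fun i γ hi β hβ => ?_⟩
  · refine lt_of_le_of_lt ?_ (h.pair i j hij).1
    have := h.pos i
    simp only [norm_mul]
    gcongr
  · refine lt_of_le_of_lt ?_ (h.pair i j hij).2
    have := h.pos j
    simp only [norm_mul]
    gcongr
  · exact (h.upper i γ hi β hβ).trans_le (hle' β)
  · exact (h.upper' i γ hi β hβ).trans_le (hle' β)

/-- If `q₁` is small and the `K_α` are large, then all radii may be chosen equal. -/
lemma admissible_const {R : ℝ} (hp1 : ‖p‖ < 1) (hq : ‖q₁‖ < 1) (hR : 0 < R) (ha : ∀ β, ‖a β‖ < R)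
    (hK : ∀ β, R < ‖q₂ * K β * a β‖) : Admissible q₁ q₂ p K a κ fun _ : Fin k => R := by
  refine ⟨fun _ => hR, fun i j _ => ⟨?_, ?_⟩, fun i γ _ β _ => ha β, fun i γ _ β _ => ?_,
    fun i γ _ β _ => hK β, fun i γ _ β _ => ?_⟩
  · nlinarith
  · rw [norm_mul]
    have : ‖p‖ * ‖q₁‖ < 1 := by nlinarith [norm_nonneg p, norm_nonneg q₁]
    nlinarith
  · rw [norm_mul]
    exact (mul_le_of_le_one_left (norm_nonneg _) hp1.le).trans_lt (ha β)
  · exact (mul_le_of_le_one_left hR.le hp1.le).trans_lt (hK β)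

/-- The dynamical parameter of the pair changes by a power of `t` in the family. -/
lemma pairParam_family (hq₁ : q₁ ≠ 0) {t : ℂ} (ht : t ≠ 0) :
    pairParam (t * q₁) (fun β => K β / t) z b N N' =
      pairParam q₁ K z b N N' * t ^ ((N : ℤ) - N' - b) := by
  rw [pairParam, pairParam, Finset.prod_div_distrib, Finset.prod_const, Fin.card_Iio, mul_zpow,
    zpow_sub₀ ht ((N : ℤ) - N') b, zpow_natCast]
  field_simp

lemma differentiableAt_det {ι : Type*} [Fintype ι] [DecidableEq ι] {M : ℂ → Matrix ι ι ℂ} {t : ℂ}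
    (h : ∀ i j, DifferentiableAt ℂ (fun t => M t i j) t) :
    DifferentiableAt ℂ (fun t => (M t).det) t := by
  simp_rw [Matrix.det_apply]
  refine DifferentiableAt.fun_sum fun σ _ => DifferentiableAt.const_smul ?_ _
  exact differentiableAt_prod fun i _ => h _ _

lemma differentiableAt_adjugate {ι : Type*} [Fintype ι] [DecidableEq ι] {M : ℂ → Matrix ι ι ℂ}
    {t : ℂ} (h : ∀ i j, DifferentiableAt ℂ (fun t => M t i j) t) (i j : ι) :
    DifferentiableAt ℂ (fun t => (M t).adjugate i j) t := by
  simp_rw [Matrix.adjugate_apply]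
  refine differentiableAt_det fun i' j' => ?_
  by_cases hi : i' = j
  · subst hi
    simp_rw [Matrix.updateRow_self]
    exact differentiableAt_const _
  · simp_rw [Matrix.updateRow_ne hi]
    exact h _ _

lemma differentiableAt_antiNum_two {Q Z A B : ℂ → ℂ} {a₁ a₂ c₁ c₂ t : ℂ} (hq₂ : 1 < ‖q₂‖)
    (hQ : DifferentiableAt ℂ Q t) (hZ : DifferentiableAt ℂ Z t) (hA : DifferentiableAt ℂ A t)
    (hB : DifferentiableAt ℂ B t) (hQ0 : Q t ≠ 0) (hZ0 : Z t ≠ 0) (hA0 : A t ≠ 0) (hB0 : B t ≠ 0)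
    (h₁ : a₁ ≠ 0) (h₂ : a₂ ≠ 0) (hc₁ : c₁ ≠ 0) (hc₂ : c₂ ≠ 0) (κ : Fin 2 → ℕ) (l : ℕ) :
    DifferentiableAt ℂ (fun t => antiNum (Q t) q₂ ![A t, B t] ![a₁, a₂] (Z t) κ
      (fixedPoint (Q t) c₁ c₂ m l)) t := by
  refine differentiableAt_antiNum (L := fun t => ![A t, B t])
    (norm_inv_lt_one_of_one_lt hq₂) hZ0 (fun β => ?_) hZ hQ (fun β => ?_) (fun i => ?_) hQ0
    (fun β => ?_) (fixedPoint_ne_zero hQ0 hc₁ hc₂ l)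
  · fin_cases β <;> assumption
  · fin_cases β <;> assumption
  · unfold fixedPoint
    split_ifs
    · exact (hQ.pow _).const_mul _
    · exact (hQ.pow _).const_mul _
  · fin_cases β <;> assumption

/-- The exchange relation for arbitrary admissible radii. Both sides are holomorphic in the family
`(t q₁, K / t)`, and for small `t` all radii may be chosen equal. -/
theorem blockIntegral_exchange (hq₂ : 1 < ‖q₂‖) (hp : p ≠ 0) (hp1 : ‖p‖ < 1)
    (hq₁ : q₁ ≠ 0) (hz : z ≠ 0) (hK : ∀ β, K β ≠ 0) (ha : ∀ β, a β ≠ 0)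
    (hb : (b' : ℕ) = b + 1) (hm : κ b + κ b' = m) (hN : ∑ β ∈ Finset.Ioi b', κ β = N)
    (hk : N + m + N' = k) (hsum : ∑ γ, κ γ = k)
    (hgen : GenericPair q₁ q₂ (a b) (a b') (K b) (K b') (pairParam q₁ K z b N N'))
    {r₁ r₂ : Fin (m + 1) → Fin k → ℝ}
    (h₁ : ∀ j : Fin (m + 1), Admissible q₁ q₂ p K a (pairComp κ b b' j (m - j)) (r₁ j))
    (h₂ : ∀ l : Fin (m + 1), Admissible q₁ q₂ p (K ∘ Equiv.swap b b') (a ∘ Equiv.swap b b')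
      (pairComp κ b b' (m - l) l) (r₂ l)) (j : Fin (m + 1)) :
    blockIntegral q₁ q₂ p K a z (pairComp κ b b' j (m - j)) (r₁ j) =
      ∑ l : Fin (m + 1),
        (antiMatrix q₁ q₂ (a b) (a b') (K b) (K b') (pairParam q₁ K z b N N') m *
          (antiMatrixRev q₁ q₂ (a b) (a b') (K b) (K b') (pairParam q₁ K z b N N') m)⁻¹) j l *
        blockIntegral q₁ q₂ p (K ∘ Equiv.swap b b') (a ∘ Equiv.swap b b') z
          (pairComp κ b b' (m - l) l) (r₂ l) := by
  set S := Equiv.swap b b' with hS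
  let w : ℂ → ℂ := fun t => pairParam q₁ K z b N N' * t ^ ((N : ℤ) - N' - b)
  let L : ℂ → Fin n → ℂ := fun t β => K β / t
  let A : ℂ → Matrix (Fin (m + 1)) (Fin (m + 1)) ℂ := fun t =>
    antiMatrix (t * q₁) q₂ (a b) (a b') (L t b) (L t b') (w t) m
  let B : ℂ → Matrix (Fin (m + 1)) (Fin (m + 1)) ℂ := fun t =>
    antiMatrixRev (t * q₁) q₂ (a b) (a b') (L t b) (L t b') (w t) m
  let J₁ : Fin (m + 1) → ℂ → ℂ := fun j t =>
    blockIntegral (t * q₁) q₂ p (L t) a z (pairComp κ b b' j (m - j)) (r₁ j)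
  let J₂ : Fin (m + 1) → ℂ → ℂ := fun l t =>
    blockIntegral (t * q₁) q₂ p (fun β => (K ∘ S) β / t) (a ∘ S) z (pairComp κ b b' (m - l) l)
      (r₂ l)
  let V : Set ℂ := {t | 0 < t.re ∧
    (∀ j : Fin (m + 1), Admissible (t * q₁) q₂ p (fun β => K β / t) a
      (pairComp κ b b' j (m - j)) (r₁ j)) ∧
    ∀ l : Fin (m + 1), Admissible (t * q₁) q₂ p (fun β => (K ∘ S) β / t) (a ∘ S)
      (pairComp κ b b' (m - l) l) (r₂ l)}
  have hre : ∀ {t : ℂ}, 0 < t.re → t ≠ 0 := by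
    rintro t ht rfl
    simp at ht
  have hV0 : ∀ t ∈ V, t ≠ 0 := fun t ht => hre ht.1
  have hmono : ∀ t ∈ V, ∀ t' : ℂ, 0 < t'.re → ‖t'‖ ≤ ‖t‖ → t' ∈ V := fun t ht t' h0 hle =>
    ⟨h0, fun j => (ht.2.1 j).of_norm_le (hre h0) hle, fun l => (ht.2.2 l).of_norm_le (hre h0) hle⟩
  have hopen : IsOpen V := by
    refine isOpen_iff_mem_nhds.2 fun t ht => ?_
    have ht0 := hV0 t ht
    have hd : ∀ c : ℂ, ContinuousAt (fun t : ℂ => c / t) t := fun c =>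
      continuousAt_const.div continuousAt_id ht0
    refine (continuousAt_const.eventually_lt Complex.continuous_re.continuousAt ht.1).and
      ((eventually_all.2 fun j => ?_).and (eventually_all.2 fun l => ?_))
    · exact Admissible.eventually (by fun_prop) (fun β => hd _) (fun i => continuousAt_const)
        (ht.2.1 j)
    · exact Admissible.eventually (by fun_prop) (fun β => hd _) (fun i => continuousAt_const)
        (ht.2.2 l)
  -- `V` is the intersection of a half plane with a set that is closed under decreasing `|t|`
  have hconv : Convex ℝ V := by
    intro t ht t' ht' x y hx hy hxy
    have h0 : 0 < (x • t + y • t').re := by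
      have h1 := ht.1
      have h2 := ht'.1
      simp only [Complex.add_re, Complex.real_smul, Complex.re_ofReal_mul]
      rcases hx.eq_or_lt with rfl | hx
      · have : y = 1 := by linarith
        subst this
        linarith
      · have := mul_pos hx h1
        have := mul_nonneg hy h2.le
        linarith
    have hle : ‖x • t + y • t'‖ ≤ x * ‖t‖ + y * ‖t'‖ := by
      refine (norm_add_le _ _).trans_eq ?_
      rw [norm_smul, norm_smul, Real.norm_of_nonneg hx, Real.norm_of_nonneg hy]
    rcases le_total ‖t‖ ‖t'‖ with h | h
    · refine hmono t' ht' _ h0 (hle.trans ?_)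
      calc x * ‖t‖ + y * ‖t'‖ ≤ x * ‖t'‖ + y * ‖t'‖ := by gcongr
        _ = ‖t'‖ := by rw [← add_mul, hxy, one_mul]
    · refine hmono t ht _ h0 (hle.trans ?_)
      calc x * ‖t‖ + y * ‖t'‖ ≤ x * ‖t‖ + y * ‖t‖ := by gcongr
        _ = ‖t‖ := by rw [← add_mul, hxy, one_mul]
  have h1V : (1 : ℂ) ∈ V := by
    refine ⟨by simp, fun j => ?_, fun l => ?_⟩
    · simpa using h₁ j
    · simp only [one_mul, div_one]
      exact h₂ l
  have hd : ∀ t ∈ V, ∀ c : ℂ, DifferentiableAt ℂ (fun t : ℂ => c / t) t := fun t ht c =>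
    differentiableAt_div (differentiableAt_const _) differentiableAt_id (hV0 t ht)
  have hw0 : ∀ t ∈ V, w t ≠ 0 := fun t ht => mul_ne_zero hgen.z_ne (zpow_ne_zero _ (hV0 t ht))
  have hw : ∀ t ∈ V, DifferentiableAt ℂ w t := fun t ht =>
    (differentiableAt_id.zpow (Or.inl (hV0 t ht))).const_mul _
  have hA : ∀ t ∈ V, ∀ i l, DifferentiableAt ℂ (fun t => A t i l) t := fun t ht i l =>
    differentiableAt_antiNum_two (Q := fun t => t * q₁) (A := fun t => L t b)
      (B := fun t => L t b') hq₂ (by fun_prop) (hw t ht) (hd t ht _) (hd t ht _)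
      (mul_ne_zero (hV0 t ht) hq₁) (hw0 t ht) (div_ne_zero (hK _) (hV0 t ht))
      (div_ne_zero (hK _) (hV0 t ht)) (ha _) (ha _) (ha _) (ha _) _ _
  have hB : ∀ t ∈ V, ∀ i l, DifferentiableAt ℂ (fun t => B t i l) t := fun t ht i l =>
    differentiableAt_antiNum_two (Q := fun t => t * q₁) (A := fun t => L t b')
      (B := fun t => L t b) hq₂ (by fun_prop) (hw t ht) (hd t ht _) (hd t ht _)
      (mul_ne_zero (hV0 t ht) hq₁) (hw0 t ht) (div_ne_zero (hK _) (hV0 t ht))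
      (div_ne_zero (hK _) (hV0 t ht)) (ha _) (ha _) (ha _) (ha _) _ _
  have hJ₁ : ∀ j, DifferentiableOn ℂ (J₁ j) V := fun j =>
    differentiableOn_integral_regIntegrand (Q := fun t => t * q₁) (L := L)
      (ρ := fun _ i => (r₁ j i : ℂ)) hopen hq₂ hp hp1 hz ha
      (by fun_prop) (fun β t ht => (hd t ht _).differentiableWithinAt)
      (fun i => differentiableOn_const _) (fun t ht => mul_ne_zero (hV0 t ht) hq₁)
      (fun t ht β => div_ne_zero (hK β) (hV0 t ht)) fun t ht => by
        simp only [Complex.norm_real, Real.norm_of_nonneg ((h₁ j).pos _).le]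
        exact ht.2.1 j
  have hJ₂ : ∀ l, DifferentiableOn ℂ (J₂ l) V := fun l =>
    differentiableOn_integral_regIntegrand (Q := fun t => t * q₁) (L := fun t β => (K ∘ S) β / t)
      (ρ := fun _ i => (r₂ l i : ℂ)) hopen hq₂ hp hp1 hz (fun β => ha _)
      (by fun_prop) (fun β t ht => (hd t ht _).differentiableWithinAt)
      (fun i => differentiableOn_const _) (fun t ht => mul_ne_zero (hV0 t ht) hq₁)
      (fun t ht β => div_ne_zero (hK _) (hV0 t ht)) fun t ht => by
        simp only [Complex.norm_real, Real.norm_of_nonneg ((h₂ l).pos _).le]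
        exact ht.2.2 l
  -- multiplied by `det B`, the exchange relation involves the adjugate matrix in place of the
  -- inverse, so both sides are holomorphic also where `B` is singular
  let F : ℂ → ℂ := fun t => (B t).det * J₁ j t
  let G : ℂ → ℂ := fun t => ∑ l, (A t * (B t).adjugate) j l * J₂ l t
  have hF : DifferentiableOn ℂ F V := fun t ht =>
    ((differentiableAt_det (hB t ht)).mul
      ((hJ₁ j).differentiableAt (hopen.mem_nhds ht))).differentiableWithinAt
  have hG : DifferentiableOn ℂ G V := fun t ht => by
    refine (DifferentiableAt.fun_sum fun l _ => DifferentiableAt.mul ?_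
      ((hJ₂ l).differentiableAt (hopen.mem_nhds ht))).differentiableWithinAt
    simp_rw [Matrix.mul_apply]
    exact DifferentiableAt.fun_sum fun i _ =>
      (hA t ht _ _).mul (differentiableAt_adjugate (hB t ht) _ _)
  -- for small `t` the torus with radii `R` is admissible for all components
  obtain ⟨R, hR0, hRa⟩ : ∃ R : ℝ, 0 < R ∧ ∀ β, ‖a β‖ < R := by
    refine ⟨1 + ∑ β, ‖a β‖, by positivity, fun β => ?_⟩
    have := Finset.single_le_sum (f := fun β => ‖a β‖) (fun _ _ => norm_nonneg _)
      (Finset.mem_univ β)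
    linarith
  obtain ⟨δ, hδ, hball⟩ : ∃ δ > 0, ∀ t : ℂ, ‖t‖ < δ →
      ‖t * q₁‖ < 1 ∧ ∀ β, ‖t‖ * R < ‖q₂ * K β * a β‖ := by
    have h1 : ∀ᶠ t in 𝓝 (0 : ℂ), ‖t * q₁‖ < 1 :=
      ContinuousAt.eventually_lt (by fun_prop) continuousAt_const (by simp)
    have h2 : ∀ᶠ t in 𝓝 (0 : ℂ), ∀ β, ‖t‖ * R < ‖q₂ * K β * a β‖ :=
      eventually_all.2 fun β => ContinuousAt.eventually_lt (by fun_prop) continuousAt_const (by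
        have h3 : q₂ ≠ 0 := norm_pos_iff.1 (one_pos.trans hq₂)
        have := mul_ne_zero (mul_ne_zero h3 (hK β)) (ha β)
        simpa only [norm_zero, zero_mul, norm_pos_iff] using this)
    obtain ⟨δ, hδ, h⟩ := Metric.eventually_nhds_iff.1 (h1.and h2)
    exact ⟨δ, hδ, fun t ht => h (by simpa using ht)⟩
  obtain ⟨C, hC, hCgen⟩ := hgen.exists_countable ((N : ℤ) - N' - b)
  have hsmall : ∀ t ∈ V, ‖t‖ < δ → t ∉ C → F t = G t := by
    intro t ht htδ htC
    have ht0 := hV0 t ht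
    obtain ⟨hq, hKt⟩ := hball t htδ
    have hKt' : ∀ β, R < ‖q₂ * (K β / t) * a β‖ := by
      intro β
      rw [show q₂ * (K β / t) * a β = q₂ * K β * a β / t by ring, norm_div,
        lt_div_iff₀ (norm_pos_iff.2 ht0), mul_comm]
      exact hKt β
    have hgt := hCgen t ht0 htC
    have hadm₁ : ∀ j : Fin (m + 1), Admissible (t * q₁) q₂ p (L t) a
        (pairComp κ b b' j (m - j)) fun _ : Fin k => R := fun j =>
      admissible_const hp1 hq hR0 hRa hKt'
    have hadm₂ : ∀ l : Fin (m + 1), Admissible (t * q₁) q₂ p (L t ∘ S) (a ∘ S)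
        (pairComp κ b b' (m - l) l) fun _ : Fin k => R := fun l =>
      admissible_const hp1 hq hR0 (fun β => hRa _) fun β => hKt' (S β)
    have hL0 : ∀ β, L t β ≠ 0 := fun β => div_ne_zero (hK β) ht0
    have hex := blockIntegral_exchange_of_common_radius (K := L t) hq₂ hp hp1
      (mul_ne_zero ht0 hq₁) hz hL0 ha hb hm hN hk hsum
      (by rw [pairParam_family hq₁ ht0]; exact hgt) hadm₁ hadm₂ j
    rw [pairParam_family hq₁ ht0,
      blockIntegral_eq_of_admissible (mul_ne_zero ht0 hq₁) hq₂ hp hp1 hz hL0 ha (ht.2.1 j)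
        (hadm₁ j)] at hex
    have hex₂ : ∀ l : Fin (m + 1), blockIntegral (t * q₁) q₂ p (L t ∘ S) (a ∘ S) z
        (pairComp κ b b' (m - l) l) (fun _ : Fin k => R) = J₂ l t := fun l =>
      blockIntegral_eq_of_admissible (mul_ne_zero ht0 hq₁) hq₂ hp hp1 hz (fun β => hL0 _)
        (fun β => ha _) (ht.2.2 l) (hadm₂ l)
    have hdet : (B t).det ≠ 0 := hgt.det_antiMatrixRev_ne_zero
    change (B t).det * blockIntegral _ _ _ _ _ _ _ _ = _
    rw [hex, Finset.mul_sum]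
    refine Finset.sum_congr rfl fun l _ => ?_
    rw [hex₂ l, ← mul_assoc]
    congr 1
    change (B t).det * (A t * (B t)⁻¹) j l = _
    rw [Matrix.inv_def, Matrix.mul_smul, Matrix.smul_apply, smul_eq_mul, Ring.inverse_eq_inv',
      mul_inv_cancel_left₀ hdet]
  -- the identity theorem carries the relation from a neighbourhood of `t₀` to `t = 1`
  let t₀ : ℂ := ((min δ 1 / 2 : ℝ) : ℂ)
  have hmin : 0 < min δ 1 := lt_min hδ one_pos
  have ht₀norm : ‖t₀‖ = min δ 1 / 2 := Complex.norm_of_nonneg (by positivity)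
  have ht₀ : t₀ ∈ V := hmono 1 h1V t₀ (by simp only [t₀, Complex.ofReal_re]; positivity) (by
    rw [ht₀norm, norm_one]
    have := min_le_right δ 1
    linarith)
  have hfreq : ∃ᶠ t in 𝓝[≠] t₀, F t = G t := by
    rw [frequently_nhdsWithin_iff, frequently_iff]
    intro U hU
    have h1 : ∀ᶠ t in 𝓝 t₀, ‖t‖ < δ := ContinuousAt.eventually_lt (by fun_prop)
      continuousAt_const (by
        rw [ht₀norm]
        have := min_le_left δ 1
        linarith)
    obtain ⟨t, ht, htC⟩ := ((hC.insert t₀).dense_compl ℂ).inter_nhds_nonempty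
      (inter_mem hU (inter_mem (hopen.mem_nhds ht₀) h1))
    rw [Set.mem_compl_iff, Set.mem_insert_iff, not_or] at ht
    exact ⟨t, htC.1, hsmall t htC.2.1 htC.2.2 ht.2, ht.1⟩
  have hFG := (hF.analyticOnNhd hopen).eqOn_of_preconnected_of_frequently_eq
    (hG.analyticOnNhd hopen) hconv.isPreconnected ht₀ hfreq h1V
  have hL1 : L 1 = K := by
    ext β
    simp [L]
  have hdet := hgen.det_antiMatrixRev_ne_zero (m := m)
  simp only [F, G, A, B, J₁, J₂, hL1, w, one_mul, one_zpow, mul_one, div_one] at hFG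
  apply mul_left_cancel₀ hdet
  refine hFG.trans ?_
  rw [Finset.mul_sum]
  refine Finset.sum_congr rfl fun l _ => ?_
  rw [← mul_assoc, Matrix.inv_def, Matrix.mul_smul, Matrix.smul_apply, smul_eq_mul,
    Ring.inverse_eq_inv', mul_inv_cancel_left₀ hdet]

end Continuation


/-! ### The exchange relation for the components of the block -/

section SiteExchange

variable {n k : ℕ} {q₁ q₂ p z : ℂ} {K a : Fin n → ℂ}

/-- The genericity of the parameters of the sites that makes all two-site `R`-matrices well
defined. -/
structure GenericSites (q₁ q₂ : ℂ) (K a : Fin n → ℂ) : Prop where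
  one_lt : 1 < ‖q₂‖
  q₁_ne : q₁ ≠ 0
  K_ne : ∀ α, K α ≠ 0
  a_ne : ∀ α, a α ≠ 0
  pow_ne : ∀ s t : ℤ, s ≠ 0 → q₁ ^ s ≠ q₂ ^ t
  K_ne_zpow : ∀ α (t : ℤ), K α ≠ q₂ ^ t
  a_div_ne : ∀ α β, α ≠ β → ∀ s t : ℤ, a α / a β ≠ q₁ ^ s * q₂ ^ t
  Ka_div_ne : ∀ α β, α ≠ β → ∀ s t : ℤ, K α * a α / a β ≠ q₁ ^ s * q₂ ^ t

/-- The genericity of the dynamical parameter. -/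
structure GenericDyn (q₁ q₂ : ℂ) (K : Fin n → ℂ) (z : ℂ) : Prop where
  ne_zero : z ≠ 0
  ne : ∀ (s t : ℤ) (e : Fin n → ℤ), z ≠ q₁ ^ s * q₂ ^ t * ∏ α, K α ^ e α

lemma GenericDyn.mul_zpow (h : GenericDyn q₁ q₂ K z) (hq₁ : q₁ ≠ 0) (s : ℤ) :
    GenericDyn q₁ q₂ K (z * q₁ ^ s) := by
  have h0 := zpow_ne_zero s hq₁
  refine ⟨mul_ne_zero h.ne_zero h0, fun s' t e h' => h.ne (s' - s) t e ?_⟩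
  rw [zpow_sub₀ hq₁]
  field_simp
  linear_combination h'

lemma GenericDyn.mul_prod (h : GenericDyn q₁ q₂ K z) (hK : ∀ α, K α ≠ 0) (d : Fin n → ℤ) :
    GenericDyn q₁ q₂ K (z * ∏ α, K α ^ d α) := by
  have h0 : ∏ α, K α ^ d α ≠ 0 := Finset.prod_ne_zero_iff.2 fun α _ => zpow_ne_zero _ (hK α)
  refine ⟨mul_ne_zero h.ne_zero h0, fun s' t e h' => h.ne s' t (e - d) ?_⟩
  have : ∏ α, K α ^ (e - d) α = (∏ α, K α ^ e α) / ∏ α, K α ^ d α := by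
    rw [← Finset.prod_div_distrib]
    exact Finset.prod_congr rfl fun α _ => by rw [Pi.sub_apply, zpow_sub₀ (hK α)]
  rw [this, ← mul_div_assoc, eq_div_iff h0]
  exact h'

lemma GenericSites.comp (h : GenericSites q₁ q₂ K a) (o : Equiv.Perm (Fin n)) :
    GenericSites q₁ q₂ (K ∘ o) (a ∘ o) :=
  ⟨h.one_lt, h.q₁_ne, fun _ => h.K_ne _, fun _ => h.a_ne _, h.pow_ne, fun _ => h.K_ne_zpow _,
    fun _ _ hne => h.a_div_ne _ _ (o.injective.ne hne),
    fun _ _ hne => h.Ka_div_ne _ _ (o.injective.ne hne)⟩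

lemma GenericDyn.comp (h : GenericDyn q₁ q₂ K z) (o : Equiv.Perm (Fin n)) :
    GenericDyn q₁ q₂ (K ∘ o) z := by
  refine ⟨h.ne_zero, fun s t e => ?_⟩
  rw [← Equiv.prod_comp o.symm]
  simpa using h.ne s t (e ∘ o.symm)

lemma GenericSites.genericPair (h : GenericSites q₁ q₂ K a) (hz : GenericDyn q₁ q₂ K z)
    {b b' : Fin n} (hb : b ≠ b') (N N' : ℕ) :
    GenericPair q₁ q₂ (a b) (a b') (K b) (K b') (pairParam q₁ K z b N N') := by
  have hw : GenericDyn q₁ q₂ K (pairParam q₁ K z b N N') := by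
    have h1 := (hz.mul_prod h.K_ne fun β => if β ∈ Finset.Iio b then 1 else 0).mul_zpow h.q₁_ne
      ((N : ℤ) - N')
    have h2 : ∏ β, K β ^ (if β ∈ Finset.Iio b then (1 : ℤ) else 0) = ∏ β ∈ Finset.Iio b, K β := by
      rw [← Finset.prod_subset (Finset.subset_univ (Finset.Iio b))]
      · exact Finset.prod_congr rfl fun β hβ => by rw [if_pos hβ, zpow_one]
      · intro β _ hβ
        rw [if_neg hβ, zpow_zero]
    rwa [h2] at h1
  refine ⟨h.one_lt, h.q₁_ne, h.a_ne _, h.a_ne _, h.K_ne _, h.K_ne _, hw.ne_zero, h.pow_ne,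
    h.a_div_ne _ _ hb, h.Ka_div_ne _ _ hb, h.Ka_div_ne _ _ hb.symm, fun s t e₁ e₂ e => ?_⟩
  refine hw.ne s t (Pi.single b e₁ + Pi.single b' e₂) ?_
  rw [e]
  congr 1
  simp_rw [Pi.add_apply, zpow_add₀ (h.K_ne _), Finset.prod_mul_distrib]
  congr 1
  · rw [Finset.prod_eq_single b (fun β _ hβ => by rw [Pi.single_eq_of_ne hβ, zpow_zero])
      (fun hn => absurd (Finset.mem_univ b) hn), Pi.single_eq_same]
  · rw [Finset.prod_eq_single b' (fun β _ hβ => by rw [Pi.single_eq_of_ne hβ, zpow_zero])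
      (fun hn => absurd (Finset.mem_univ b') hn), Pi.single_eq_same]

/-- The component of total `k` that has the part `l` at the site `α` and differs from `κ` at most at
the sites `α` and `β`. -/
def Comp.transfer (κ : Comp n k) {α β : Fin n} (h : α ≠ β) {m : ℕ} (hm : κ.1 α + κ.1 β = m)
    (l : Fin (m + 1)) : Comp n k :=
  ⟨pairComp κ.1 α β l (m - l), (sum_pairComp h (by omega)).trans κ.2⟩

/-- A row of `siteR` has nonzero entries only at the components that differ from `κ` at most at the
sites `α` and `β`; they are indexed by the part at `α`. -/
lemma sum_siteR_mul (κ : Comp n k) {α β : Fin n} (h : α ≠ β) {m : ℕ} (hm : κ.1 α + κ.1 β = m)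
    (w : ℂ) (G : Comp n k → ℂ) :
    ∑ κ', siteR q₁ q₂ K a β α w κ κ' * G κ' =
      ∑ l : Fin (m + 1),
        twoSiteR q₁ q₂ (a α) (a β) (K α) (K β) m (w * q₁ ^ ((k : ℤ) - (m : ℤ)))
          (Fin.ofNat _ (κ.1 α)) l * G (κ.transfer h hm l) := by
  subst hm
  have hpair : ∀ κ' : Comp n k, (∀ γ, γ ≠ α → γ ≠ β → κ.1 γ = κ'.1 γ) →
      κ'.1 α + κ'.1 β = κ.1 α + κ.1 β := by
    intro κ' hκ'
    have key : ∀ κ : Fin n → ℕ, ∑ γ, κ γ = ∑ γ with γ ≠ α ∧ γ ≠ β, κ γ + (κ α + κ β) := fun κ =>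
      prod_eq_mul_prod_filter (M := Multiplicative ℕ) h κ
    have h1 := key κ.1
    have h2 := key κ'.1
    have h3 : ∑ γ with γ ≠ α ∧ γ ≠ β, κ.1 γ = ∑ γ with γ ≠ α ∧ γ ≠ β, κ'.1 γ :=
      Finset.sum_congr rfl fun γ hγ =>
        hκ' γ (Finset.mem_filter.1 hγ).2.1 (Finset.mem_filter.1 hγ).2.2
    rw [κ.2] at h1
    rw [κ'.2] at h2
    omega
  simp only [siteR, ite_mul, zero_mul]
  rw [← Finset.sum_filter]
  refine Finset.sum_bij' (fun κ' _ => Fin.ofNat _ (κ'.1 α)) (fun l _ => κ.transfer h rfl l)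
    (fun _ _ => Finset.mem_univ _) (fun l _ => ?_) (fun κ' hκ' => ?_) (fun l _ => ?_)
    (fun κ' hκ' => ?_)
  · exact Finset.mem_filter.2 ⟨Finset.mem_univ _, fun γ h1 h2 => (pairComp_of_ne h1 h2 _ _).symm⟩
  · have h1 := (Finset.mem_filter.1 hκ').2
    have h2 := hpair κ' h1
    have h3 : ((Fin.ofNat (κ.1 α + κ.1 β + 1) (κ'.1 α) : Fin _) : ℕ) = κ'.1 α := by
      rw [Fin.val_ofNat]
      exact Nat.mod_eq_of_lt (by omega)
    refine Subtype.ext (funext fun γ => ?_)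
    change pairComp κ.1 α β _ _ γ = _
    rw [h3]
    by_cases hβ : γ = β
    · rw [hβ, pairComp_right]
      omega
    · by_cases hα : γ = α
      · rw [hα, pairComp_left h]
      · rw [pairComp_of_ne hα hβ, h1 γ hα hβ]
  · refine Fin.ext ?_
    change (pairComp κ.1 α β _ _ α) % _ = _
    rw [pairComp_left h]
    exact Nat.mod_eq_of_lt l.2
  · have h1 := (Finset.mem_filter.1 hκ').2
    have h2 := hpair κ' h1
    have h3 : κ.transfer h rfl (Fin.ofNat (κ.1 α + κ.1 β + 1) (κ'.1 α)) = κ' := by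
      have h3 : ((Fin.ofNat (κ.1 α + κ.1 β + 1) (κ'.1 α) : Fin _) : ℕ) = κ'.1 α := by
        rw [Fin.val_ofNat]
        exact Nat.mod_eq_of_lt (by omega)
      refine Subtype.ext (funext fun γ => ?_)
      change pairComp κ.1 α β _ _ γ = _
      rw [h3]
      by_cases hβ : γ = β
      · rw [hβ, pairComp_right]
        omega
      · by_cases hα : γ = α
        · rw [hα, pairComp_left h]
        · rw [pairComp_of_ne hα hβ, h1 γ hα hβ]
    rw [h3]

/-- The block with the sites in the order `o 1, …, o n`. The components are labelled by the sites,
not by their positions in this order. -/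
noncomputable def orderedBlock (q₁ q₂ p : ℂ) (K a : Fin n → ℂ) (o : Equiv.Perm (Fin n))
    (r : Comp n k → Fin k → ℝ) (z : ℂ) (κ : Comp n k) : ℂ :=
  stabConst k q₁ q₂ (K ∘ o) z (κ.1 ∘ o) *
    blockIntegral q₁ q₂ p (K ∘ o) (a ∘ o) z (κ.1 ∘ o) (r κ)

/-- Admissible radii for all components of the block in the order `o`. -/
def OrderAdmissible (q₁ q₂ p : ℂ) (K a : Fin n → ℂ) (o : Equiv.Perm (Fin n))
    (r : Comp n k → Fin k → ℝ) : Prop :=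
  ∀ κ : Comp n k, Admissible q₁ q₂ p (K ∘ o) (a ∘ o) (κ.1 ∘ o) (r κ)

lemma pairComp_comp_perm (κ : Fin n → ℕ) (o : Equiv.Perm (Fin n)) {b b' : Fin n} (h : b ≠ b')
    (u v : ℕ) : pairComp κ (o b) (o b') u v ∘ o = pairComp (κ ∘ o) b b' u v := by
  ext γ
  rw [Function.comp_apply]
  by_cases hb' : γ = b'
  · rw [hb', pairComp_right, pairComp_right]
  · by_cases hb : γ = b
    · rw [hb, pairComp_left h, pairComp_left (o.injective.ne h)]
    · rw [pairComp_of_ne hb hb', pairComp_of_ne (o.injective.ne hb) (o.injective.ne hb')]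
      rfl

lemma pairComp_comp_swap (κ : Fin n → ℕ) {b b' : Fin n} (h : b ≠ b') (u v : ℕ) :
    pairComp κ b b' u v ∘ Equiv.swap b b' = pairComp κ b b' v u := by
  ext γ
  rw [Function.comp_apply]
  by_cases hb' : γ = b'
  · rw [hb', Equiv.swap_apply_right, pairComp_right, pairComp_left h]
  · by_cases hb : γ = b
    · rw [hb, Equiv.swap_apply_left, pairComp_left h, pairComp_right]
    · rw [Equiv.swap_apply_of_ne_of_ne hb hb', pairComp_of_ne hb hb', pairComp_of_ne hb hb']

/-- The exchange of the sites in the neighbouring positions `b`, `b'` of the order `o` is given by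
the `R`-matrix. -/
theorem orderedBlock_exchange (h : GenericSites q₁ q₂ K a) (hz : GenericDyn q₁ q₂ K z) (hp : p ≠ 0)
    (hp1 : ‖p‖ < 1) (o : Equiv.Perm (Fin n)) {b b' : Fin n} (hb : (b' : ℕ) = b + 1)
    {r r' : Comp n k → Fin k → ℝ} (hr : OrderAdmissible q₁ q₂ p K a o r)
    (hr' : OrderAdmissible q₁ q₂ p K a (o * Equiv.swap b b') r') (κ : Comp n k) :
    orderedBlock q₁ q₂ p K a o r z κ =
      ∑ κ', siteR q₁ q₂ K a (o b') (o b)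
        (z * ∏ γ ∈ Finset.Iio b, kappa q₁ K κ.1 (o γ)) κ κ' *
        orderedBlock q₁ q₂ p K a (o * Equiv.swap b b') r' z κ' := by
  have hbb : b ≠ b' := fun h => by rw [Fin.ext_iff] at h; omega
  have hobb := o.injective.ne hbb
  have hq₁ := h.q₁_ne
  obtain ⟨m, hm⟩ : ∃ m, κ.1 (o b) + κ.1 (o b') = m := ⟨_, rfl⟩
  obtain ⟨N, hN⟩ : ∃ N, ∑ β ∈ Finset.Ioi b', (κ.1 ∘ o) β = N := ⟨_, rfl⟩
  obtain ⟨N', hN'⟩ : ∃ N', ∑ β ∈ Finset.Iio b, (κ.1 ∘ o) β = N' := ⟨_, rfl⟩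
  have hsum : ∑ γ, (κ.1 ∘ o) γ = k := (Equiv.sum_comp o κ.1).trans κ.2
  have hk : N + m + N' = k := by
    have h1 := prod_Iio_mul_prod_Ioi (M := Multiplicative ℕ) (κ.1 ∘ o) b
    have h2 : ∑ γ, (κ.1 ∘ o) γ = ∑ β ∈ Finset.Iio b, (κ.1 ∘ o) β + (κ.1 ∘ o) b +
        ∑ β ∈ Finset.Ioi b, (κ.1 ∘ o) β := h1
    rw [hsum, Ioi_eq_insert hb, Finset.sum_insert (by simp), hN, hN'] at h2
    simp only [Function.comp_apply] at h2
    omega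
  have hgen := (h.comp o).genericPair (hz.comp o) hbb N N'
  set w := pairParam q₁ (K ∘ o) z b N N' with hw
  have hparam : z * (∏ γ ∈ Finset.Iio b, kappa q₁ K κ.1 (o γ)) * q₁ ^ ((k : ℤ) - (m : ℤ)) = w := by
    have h1 : ∏ γ ∈ Finset.Iio b, kappa q₁ K κ.1 (o γ) =
        (∏ γ ∈ Finset.Iio b, (K ∘ o) γ) * q₁ ^ (-2 * (N' : ℤ)) := by
      simp only [kappa, Finset.prod_mul_distrib]
      congr 1
      rw [← hN']
      push_cast
      rw [Finset.mul_sum]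
      induction Finset.Iio b using Finset.induction_on with
      | empty => simp
      | insert γ s hγ ih =>
        rw [Finset.prod_insert hγ, Finset.sum_insert hγ, zpow_add₀ hq₁, ih]
        rfl
    rw [h1, hw, pairParam, mul_assoc, mul_assoc, ← zpow_add₀ hq₁, mul_assoc]
    congr 3
    rw [← hk]
    push_cast
    ring
  let j : Fin (m + 1) := Fin.ofNat _ (κ.1 (o b))
  have hj : (j : ℕ) = κ.1 (o b) := by
    simp only [j, Fin.val_ofNat]
    exact Nat.mod_eq_of_lt (by omega)
  have hcomp : ∀ l : Fin (m + 1), (κ.transfer hobb hm l).1 ∘ o =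
      pairComp (κ.1 ∘ o) b b' l (m - l) := fun l => pairComp_comp_perm _ _ hbb _ _
  have hcomp' : ∀ l : Fin (m + 1), (κ.transfer hobb hm l).1 ∘ (o * Equiv.swap b b') =
      pairComp (κ.1 ∘ o) b b' (m - l) l := fun l => by
    rw [Equiv.Perm.coe_mul, ← Function.comp_assoc, hcomp, pairComp_comp_swap _ hbb]
  have hκj : pairComp (κ.1 ∘ o) b b' j (m - j) = κ.1 ∘ o := by
    ext γ
    rw [hj]
    by_cases hγ : γ = b'
    · rw [hγ, pairComp_right, Function.comp_apply]
      omega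
    · by_cases hγ' : γ = b
      · rw [hγ', pairComp_left hbb]
        rfl
      · rw [pairComp_of_ne hγ' hγ]
  have hκj' : κ.transfer hobb hm j = κ := by
    refine Subtype.ext ?_
    have := (hcomp j).trans hκj
    exact funext fun γ => by simpa using congrFun this (o.symm γ)
  have hex := blockIntegral_exchange (κ := κ.1 ∘ o) (K := K ∘ o) (a := a ∘ o) (z := z)
    h.one_lt hp hp1
    hq₁ hz.ne_zero (h.comp o).K_ne (h.comp o).a_ne hb hm hN hk hsum hgen
    (r₁ := fun j => r (κ.transfer hobb hm j)) (r₂ := fun l => r' (κ.transfer hobb hm l))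
    (fun j => by rw [← hcomp]; exact hr _)
    (fun l => by rw [← hcomp']; exact hr' (κ.transfer hobb hm l)) j
  rw [hκj, hκj', ← hw] at hex
  simp only [Function.comp_apply (f := a), Function.comp_apply (f := K)] at hex
  have hs : ∀ γ, γ ≠ b → γ ≠ b' → Equiv.swap b b' γ = γ := fun γ => Equiv.swap_apply_of_ne_of_ne
  have hc : stabConst k q₁ q₂ (K ∘ o) z (κ.1 ∘ o) = sectorConst k q₁ q₂ (K ∘ o) z (κ.1 ∘ o) b b' *
      stabConst m q₁ q₂ ![K (o b), K (o b')] w ![(j : ℕ), m - (j : ℕ)] := by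
    rw [stabConst_eq_sectorConst_mul hq₁ hb hm hN hk, hj, ← hm, Nat.add_sub_cancel_left]
    rfl
  have hc' : ∀ l : Fin (m + 1), stabConst k q₁ q₂ (K ∘ (o * Equiv.swap b b')) z
      (pairComp (κ.1 ∘ o) b b' (m - l) l) = sectorConst k q₁ q₂ (K ∘ o) z (κ.1 ∘ o) b b' *
      stabConst m q₁ q₂ ![K (o b'), K (o b)] w ![m - (l : ℕ), (l : ℕ)] := by
    intro l
    have hlm : pairComp (κ.1 ∘ o) b b' (m - l) l b + pairComp (κ.1 ∘ o) b b' (m - l) l b' = m := by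
      rw [pairComp_left hbb, pairComp_right]
      omega
    have hlN : ∑ β ∈ Finset.Ioi b', pairComp (κ.1 ∘ o) b b' (m - l) l β = N := by
      rw [← hN]
      refine Finset.sum_congr rfl fun β hβ => ?_
      have := Fin.lt_def.1 (Finset.mem_Ioi.1 hβ)
      refine pairComp_of_ne ?_ ?_ _ _ <;> rw [Ne, Fin.ext_iff] <;> omega
    rw [Equiv.Perm.coe_mul, ← Function.comp_assoc, stabConst_eq_sectorConst_mul hq₁ hb hlm hlN hk,
      sectorConst_congr hb hs (fun γ h1 h2 => pairComp_of_ne h1 h2 _ _) (hlm.trans hm.symm),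
      pairParam_comp hb hs, pairComp_left hbb, pairComp_right]
    simp only [Function.comp_apply, Equiv.swap_apply_left, Equiv.swap_apply_right]
    rfl
  rw [sum_siteR_mul κ hobb hm, hparam, orderedBlock, hex, Finset.mul_sum]
  refine Finset.sum_congr rfl fun l _ => ?_
  have htwo := hgen.twoSiteR_mul_stabConst (m := m) (h.K_ne_zpow _) (h.K_ne_zpow _) j l
  simp only [Function.comp_apply] at htwo
  rw [orderedBlock, hcomp' l, hc, hc' l, Equiv.Perm.coe_mul, ← Function.comp_assoc,
    ← Function.comp_assoc]
  linear_combination (-(sectorConst k q₁ q₂ (K ∘ o) z (κ.1 ∘ o) b b') *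
    blockIntegral q₁ q₂ p ((K ∘ o) ∘ Equiv.swap b b') ((a ∘ o) ∘ Equiv.swap b b') z
      (pairComp (κ.1 ∘ o) b b' (m - l) l) (r' (κ.transfer hobb hm l))) * htwo

end SiteExchange


/-! ### Existence of admissible radii -/

section Radii

variable {n k : ℕ} {q₁ q₂ p : ℂ} {K a : Fin n → ℂ} {κ : Fin n → ℕ}

/-- The inequalities between the parameters that are equivalent, for `k > 0`, to the existence of
admissible radii for all components, if the sites are in the order `1, …, n`. -/
structure RadiiBounds (k : ℕ) (q₁ q₂ p : ℂ) (K a : Fin n → ℂ) : Prop where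
  le : ∀ β δ, δ ≤ β → max ‖q₁‖ 1 ^ (k - 1) * ‖a β‖ < ‖q₂ * K δ * a δ‖
  all : ∀ β δ, max ‖q₁‖ 1 ^ (k - 1) * (‖p‖ * ‖a β‖) < ‖q₂ * K δ * a δ‖
  pow : 2 ≤ k → ‖p‖ * max ‖q₁‖ 1 ^ k < 1

lemma hasColour_single (γ : Fin n) (i : Fin k) :
    HasColour (Pi.single γ k : Fin n → ℕ) i γ := by
  constructor
  · rw [Finset.sum_eq_zero]
    · exact Nat.zero_le _
    · intro β hβ
      exact Pi.single_eq_of_ne (Finset.mem_Ioi.1 hβ).ne' _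
  · rw [← Finset.Ioi_insert, Finset.sum_insert (by simp), Pi.single_eq_same]
    omega

/-- The conditions on neighbouring radii accumulate to a power of `|q₁|`. -/
lemma Admissible.pow_mul_le {r : Fin k → ℝ} (h : Admissible q₁ q₂ p K a κ r) (i j : Fin k)
    (hij : i ≤ j) : ‖q₁‖ ^ ((j : ℕ) - i) * r i ≤ r j := by
  obtain ⟨d, hd⟩ : ∃ d, (j : ℕ) - i = d := ⟨_, rfl⟩
  rw [hd]
  induction d generalizing j with
  | zero =>
    have : i = j := Fin.ext (by rw [Fin.le_def] at hij; omega)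
    rw [this, pow_zero, one_mul]
  | succ d ih =>
    have h1 : (j : ℕ) - 1 < k := by omega
    have h2 := ih ⟨j - 1, h1⟩ (by rw [Fin.le_def]; simp only; omega) (by simp only; omega)
    have h3 := (h.pair ⟨j - 1, h1⟩ j (by rw [Fin.lt_def]; simp only; omega)).1
    calc ‖q₁‖ ^ (d + 1) * r i = ‖q₁‖ * (‖q₁‖ ^ d * r i) := by ring
      _ ≤ ‖q₁‖ * r ⟨j - 1, h1⟩ := by gcongr
      _ ≤ r j := h3.le

/-- The components with all variables at one site already give the inequalities of `RadiiBounds`, by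
comparison of the first and the last radius. -/
lemma radiiBounds_of_admissible (hk : 0 < k) (hp1 : ‖p‖ < 1) [NeZero n]
    (h : ∀ γ : Fin n, ∃ r : Fin k → ℝ, Admissible q₁ q₂ p K a (Pi.single γ k) r) :
    RadiiBounds k q₁ q₂ p K a := by
  choose r hr using h
  let i₀ : Fin k := ⟨0, hk⟩
  let i₁ : Fin k := ⟨k - 1, by omega⟩
  have hle : ∀ γ, ∃ i : Fin k, max ‖q₁‖ 1 ^ (k - 1) * r γ i₀ ≤ r γ i := by
    intro γ
    rcases le_total ‖q₁‖ 1 with hq | hq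
    · exact ⟨i₀, by rw [max_eq_right hq, one_pow, one_mul]⟩
    · refine ⟨i₁, ?_⟩
      rw [max_eq_left hq]
      exact (hr γ).pow_mul_le i₀ i₁ (Fin.le_def.2 (Nat.zero_le _))
  have hM : (0 : ℝ) < max ‖q₁‖ 1 ^ (k - 1) := by positivity
  have h1 : ∀ β δ, δ ≤ β → max ‖q₁‖ 1 ^ (k - 1) * ‖a β‖ < ‖q₂ * K δ * a δ‖ := by
    intro β δ hδ
    obtain ⟨i, hi⟩ := hle β
    calc max ‖q₁‖ 1 ^ (k - 1) * ‖a β‖ < max ‖q₁‖ 1 ^ (k - 1) * r β i₀ :=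
          mul_lt_mul_of_pos_left ((hr β).lower i₀ β (hasColour_single _ _) β le_rfl) hM
      _ ≤ r β i := hi
      _ < _ := (hr β).upper i β (hasColour_single _ _) δ hδ
  refine ⟨h1, fun β δ => ?_, fun hk2 => ?_⟩
  · rcases le_or_gt δ β with hδ | hδ
    · refine lt_of_le_of_lt ?_ (h1 β δ hδ)
      gcongr
      exact mul_le_of_le_one_left (norm_nonneg _) hp1.le
    · obtain ⟨i, hi⟩ := hle δ
      calc max ‖q₁‖ 1 ^ (k - 1) * (‖p‖ * ‖a β‖) < max ‖q₁‖ 1 ^ (k - 1) * r δ i₀ := by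
            refine mul_lt_mul_of_pos_left ?_ hM
            rw [← norm_mul]
            exact (hr δ).lower' i₀ δ (hasColour_single _ _) β hδ
        _ ≤ r δ i := hi
        _ < _ := (hr δ).upper i δ (hasColour_single _ _) δ le_rfl
  · rcases le_total ‖q₁‖ 1 with hq | hq
    · rw [max_eq_right hq, one_pow, mul_one]
      exact hp1
    · rw [max_eq_left hq]
      have h2 := (hr 0).pow_mul_le i₀ i₁ (Fin.le_def.2 (Nat.zero_le _))
      have h3 := ((hr 0).pair i₀ i₁ (by rw [Fin.lt_def]; simp only [i₀, i₁]; omega)).2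
      have h4 := (hr 0).pos i₀
      simp only [i₀, i₁, Nat.sub_zero] at h2
      rw [norm_mul] at h3
      have h5 : ‖p‖ * ‖q₁‖ ^ k * r 0 i₀ < 1 * r 0 i₀ := by
        calc ‖p‖ * ‖q₁‖ ^ k * r 0 i₀ = ‖p‖ * ‖q₁‖ * (‖q₁‖ ^ (k - 1) * r 0 i₀) := by
              rw [show ‖q₁‖ ^ k = ‖q₁‖ * ‖q₁‖ ^ (k - 1) by
                rw [← pow_succ']; congr 1; omega]
              ring
          _ ≤ ‖p‖ * ‖q₁‖ * r 0 i₁ := by gcongr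
          _ < 1 * r 0 i₀ := by rw [one_mul]; exact h3
      exact lt_of_mul_lt_mul_right h5 h4.le

/-- The smallest radius at the position `i` that a site with `|a| = A` asks for, if `N` is the
number of variables at the sites after it and `|p| = P`. The radius has to exceed `A` at the
positions `i ≥ N` and `P A` at the positions `i < N`, and to grow by the factor `s` from each
position to the next. The exponent in the second case continues the first one from position `i + k`
to position `i`, at the cost of a factor `P`. -/
noncomputable def siteRadius (k : ℕ) (s ε P A : ℝ) (N i : ℕ) : ℝ :=
  if N ≤ i then ε * (A * s ^ (i - N)) else ε * (P * A * s ^ (i + k - N))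

/-- The radii are the maxima over all sites of `siteRadius`. Each lower bound and each ratio
condition then follows from the one for a single site; the upper bounds are the inequalities of
`RadiiBounds`. -/
lemma RadiiBounds.exists_admissible [NeZero n] (h : RadiiBounds k q₁ q₂ p K a) (hp : p ≠ 0)
    (hp1 : ‖p‖ < 1) (ha : ∀ β, a β ≠ 0) (hκ : ∑ γ, κ γ = k) :
    ∃ r : Fin k → ℝ, Admissible q₁ q₂ p K a κ r := by
  have hP : 0 < ‖p‖ := norm_pos_iff.2 hp
  have hA : ∀ β, 0 < ‖a β‖ := fun β => norm_pos_iff.2 (ha β)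
  -- all inequalities survive a small increase of `max ‖q₁‖ 1` to `s` and of `1` to `ε`
  obtain ⟨s, ε, hs, hε, h1, h2, h3⟩ : ∃ s ε : ℝ, max ‖q₁‖ 1 < s ∧ 1 < ε ∧
      (∀ β δ, δ ≤ β → ε * (‖a β‖ * s ^ (k - 1)) < ‖q₂ * K δ * a δ‖) ∧
      (∀ β δ, ε * (‖p‖ * ‖a β‖ * s ^ (k - 1)) < ‖q₂ * K δ * a δ‖) ∧
      (2 ≤ k → ‖p‖ * s ^ k < 1) := by
    have e0 : ∀ᶠ η in 𝓝[>] (0 : ℝ), 0 < η := self_mem_nhdsWithin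
    have e1 : ∀ᶠ η in 𝓝 (0 : ℝ), ∀ β δ, δ ≤ β →
        (1 + η) * (‖a β‖ * (max ‖q₁‖ 1 + η) ^ (k - 1)) < ‖q₂ * K δ * a δ‖ :=
      eventually_all.2 fun β => eventually_all.2 fun δ => eventually_imp_distrib_left.2 fun hδ =>
        ContinuousAt.eventually_lt (by fun_prop) continuousAt_const (by
          have := h.le β δ hδ
          simpa [mul_comm] using this)
    have e2 : ∀ᶠ η in 𝓝 (0 : ℝ), ∀ β δ,
        (1 + η) * (‖p‖ * ‖a β‖ * (max ‖q₁‖ 1 + η) ^ (k - 1)) < ‖q₂ * K δ * a δ‖ :=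
      eventually_all.2 fun β => eventually_all.2 fun δ =>
        ContinuousAt.eventually_lt (by fun_prop) continuousAt_const (by
          have := h.all β δ
          rw [add_zero, one_mul, add_zero, mul_comm]
          exact this)
    have e3 : ∀ᶠ η in 𝓝 (0 : ℝ), 2 ≤ k → ‖p‖ * (max ‖q₁‖ 1 + η) ^ k < 1 :=
      eventually_imp_distrib_left.2 fun hk =>
        ContinuousAt.eventually_lt (by fun_prop) continuousAt_const (by
          rw [add_zero]
          exact h.pow hk)
    obtain ⟨η, h0, h1, h2, h3⟩ := (e0.and ((e1.filter_mono nhdsWithin_le_nhds).and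
      ((e2.filter_mono nhdsWithin_le_nhds).and (e3.filter_mono nhdsWithin_le_nhds)))).exists
    exact ⟨max ‖q₁‖ 1 + η, 1 + η, by linarith, by linarith, h1, h2, h3⟩
  have hs1 : 1 < s := (le_max_right _ _).trans_lt hs
  have hqs : ‖q₁‖ < s := (le_max_left _ _).trans_lt hs
  have hs0 : 0 < s := by linarith
  have hpow : ∀ {u v : ℕ}, u ≤ v → s ^ u ≤ s ^ v := pow_le_pow_right₀ hs1.le
  have hε0 : 0 < ε := by linarith
  let N : Fin n → ℕ := fun β => ∑ γ ∈ Finset.Ioi β, κ γ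
  have hNk : ∀ β, N β ≤ k := fun β => by
    rw [← hκ]
    exact Finset.sum_le_sum_of_subset (Finset.subset_univ _)
  have hcol : ∀ (i : Fin k) γ, HasColour κ i γ → ∀ β, N β ≤ i ↔ γ ≤ β := by
    intro i γ hi β
    constructor
    · intro hle
      by_contra! hlt
      have : ∑ δ ∈ Finset.Ici γ, κ δ ≤ N β := Finset.sum_le_sum_of_subset fun δ hδ =>
        Finset.mem_Ioi.2 (hlt.trans_le (Finset.mem_Ici.1 hδ))
      have := hi.2
      omega
    · intro hle
      have : N β ≤ ∑ δ ∈ Finset.Ioi γ, κ δ := Finset.sum_le_sum_of_subset fun δ hδ =>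
        Finset.mem_Ioi.2 (hle.trans_lt (Finset.mem_Ioi.1 hδ))
      exact this.trans hi.1
  let L : Fin n → Fin k → ℝ := fun β i => siteRadius k s ε ‖p‖ ‖a β‖ (N β) i
  have hLpos : ∀ β i, 0 < L β i := by
    intro β i
    have := hA β
    simp only [L, siteRadius]
    split_ifs <;> positivity
  have hup : ∀ β (i j : Fin k), i < j → s * L β i ≤ L β j := by
    intro β i j hij
    have := hA β
    rw [Fin.lt_def] at hij
    have := j.2
    simp only [L, siteRadius]
    by_cases hi : N β ≤ i
    · rw [if_pos hi, if_pos (by omega)]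
      calc s * (ε * (‖a β‖ * s ^ ((i : ℕ) - N β))) = ε * (‖a β‖ * s ^ ((i : ℕ) - N β + 1)) := by
            rw [pow_succ]; ring
        _ ≤ _ := by
          have hexp := hpow (show (i : ℕ) - N β + 1 ≤ (j : ℕ) - N β by omega)
          gcongr
    · rw [if_neg hi]
      by_cases hj : N β ≤ j
      · rw [if_pos hj]
        have hexp := hpow (show (i : ℕ) + k - N β + 1 ≤ k + (j - N β) by omega)
        calc s * (ε * (‖p‖ * ‖a β‖ * s ^ ((i : ℕ) + k - N β)))
            = ε * ‖a β‖ * (‖p‖ * s ^ ((i : ℕ) + k - N β + 1)) := by rw [pow_succ]; ring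
          _ ≤ ε * ‖a β‖ * (‖p‖ * s ^ (k + (j - N β))) := by
            gcongr
          _ = ε * ‖a β‖ * s ^ ((j : ℕ) - N β) * (‖p‖ * s ^ k) := by rw [pow_add]; ring
          _ ≤ ε * ‖a β‖ * s ^ ((j : ℕ) - N β) * 1 := by
            gcongr
            exact (h3 (by omega)).le
          _ = _ := by ring
      · rw [if_neg hj]
        calc s * (ε * (‖p‖ * ‖a β‖ * s ^ ((i : ℕ) + k - N β)))
            = ε * (‖p‖ * ‖a β‖ * s ^ ((i : ℕ) + k - N β + 1)) := by rw [pow_succ]; ring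
          _ ≤ _ := by
            have := hNk β
            have hexp := hpow (show (i : ℕ) + k - N β + 1 ≤ (j : ℕ) + k - N β by omega)
            gcongr
  have hdown : ∀ β (i j : Fin k), i < j → ‖p‖ * s * L β j ≤ L β i := by
    intro β i j hij
    have := hA β
    rw [Fin.lt_def] at hij
    have hj2 := j.2
    have hps := (h3 (by omega)).le
    simp only [L, siteRadius]
    by_cases hi : N β ≤ i
    · rw [if_pos hi, if_pos (by omega)]
      calc ‖p‖ * s * (ε * (‖a β‖ * s ^ ((j : ℕ) - N β)))
          = ε * ‖a β‖ * (‖p‖ * s ^ ((j : ℕ) - N β + 1)) := by rw [pow_succ]; ring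
        _ ≤ ε * ‖a β‖ * (‖p‖ * s ^ (k + (i - N β))) := by
          have hexp := hpow (show (j : ℕ) - N β + 1 ≤ k + ((i : ℕ) - N β) by omega)
          gcongr
        _ = ε * ‖a β‖ * s ^ ((i : ℕ) - N β) * (‖p‖ * s ^ k) := by rw [pow_add]; ring
        _ ≤ ε * ‖a β‖ * s ^ ((i : ℕ) - N β) * 1 := by gcongr
        _ = _ := by ring
    · rw [if_neg hi]
      by_cases hj : N β ≤ j
      · rw [if_pos hj]
        calc ‖p‖ * s * (ε * (‖a β‖ * s ^ ((j : ℕ) - N β)))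
            = ε * (‖p‖ * ‖a β‖ * s ^ ((j : ℕ) - N β + 1)) := by rw [pow_succ]; ring
          _ ≤ _ := by
            have hexp := hpow (show (j : ℕ) - N β + 1 ≤ (i : ℕ) + k - N β by omega)
            gcongr
      · rw [if_neg hj]
        have := hNk β
        calc ‖p‖ * s * (ε * (‖p‖ * ‖a β‖ * s ^ ((j : ℕ) + k - N β)))
            = ε * (‖p‖ * ‖a β‖) * (‖p‖ * s ^ ((j : ℕ) + k - N β + 1)) := by rw [pow_succ]; ring
          _ ≤ ε * (‖p‖ * ‖a β‖) * (‖p‖ * s ^ (k + (i + k - N β))) := by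
            have hexp := hpow (show (j : ℕ) + k - N β + 1 ≤ k + ((i : ℕ) + k - N β) by omega)
            gcongr
          _ = ε * (‖p‖ * ‖a β‖) * s ^ ((i : ℕ) + k - N β) * (‖p‖ * s ^ k) := by rw [pow_add]; ring
          _ ≤ ε * (‖p‖ * ‖a β‖) * s ^ ((i : ℕ) + k - N β) * 1 := by gcongr
          _ = _ := by ring
  have hne : (Finset.univ : Finset (Fin n)).Nonempty := ⟨0, Finset.mem_univ _⟩
  let r : Fin k → ℝ := fun i => Finset.univ.sup' hne fun β => L β i
  have hLr : ∀ β i, L β i ≤ r i := fun β i =>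
    Finset.le_sup' (fun β => L β i) (Finset.mem_univ β)
  have hrL : ∀ i, ∃ β, r i = L β i := fun i => by
    obtain ⟨β, -, hβ⟩ := Finset.exists_mem_eq_sup' hne fun β => L β i
    exact ⟨β, hβ⟩
  have hrpos : ∀ i, 0 < r i := fun i => (hLpos 0 i).trans_le (hLr 0 i)
  refine ⟨r, hrpos, fun i j hij => ⟨?_, ?_⟩, fun i γ hi β hβ => ?_, fun i γ hi β hβ => ?_,
    fun i γ hi β hβ => ?_, fun i γ hi β hβ => ?_⟩
  · obtain ⟨β, hβ⟩ := hrL i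
    calc ‖q₁‖ * r i < s * r i := mul_lt_mul_of_pos_right hqs (hrpos i)
      _ = s * L β i := by rw [hβ]
      _ ≤ L β j := hup β i j hij
      _ ≤ r j := hLr β j
  · obtain ⟨β, hβ⟩ := hrL j
    rw [norm_mul]
    calc ‖p‖ * ‖q₁‖ * r j < ‖p‖ * s * r j :=
          mul_lt_mul_of_pos_right (mul_lt_mul_of_pos_left hqs hP) (hrpos j)
      _ = ‖p‖ * s * L β j := by rw [hβ]
      _ ≤ L β i := hdown β i j hij
      _ ≤ r i := hLr β i
  · refine lt_of_lt_of_le ?_ (hLr β i)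
    simp only [L, siteRadius]
    rw [if_pos ((hcol i γ hi β).2 hβ)]
    have h4 : ‖a β‖ * 1 ≤ ‖a β‖ * s ^ ((i : ℕ) - N β) := by
      gcongr
      exact one_le_pow₀ hs1.le
    nlinarith [hA β]
  · refine lt_of_lt_of_le ?_ (hLr β i)
    simp only [L, siteRadius]
    rw [if_neg (fun hle => absurd ((hcol i γ hi β).1 hle) (not_le.2 hβ)), norm_mul]
    have h4 : ‖p‖ * ‖a β‖ * 1 ≤ ‖p‖ * ‖a β‖ * s ^ ((i : ℕ) + k - N β) := by
      gcongr
      exact one_le_pow₀ hs1.le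
    nlinarith [mul_pos hP (hA β)]
  · obtain ⟨δ, hδ⟩ := hrL i
    have := i.2
    rw [hδ]
    simp only [L, siteRadius]
    split_ifs with hN
    · refine lt_of_le_of_lt ?_ (h1 δ β (hβ.trans ((hcol i γ hi δ).1 hN)))
      have hexp := hpow (show (i : ℕ) - N δ ≤ k - 1 by omega)
      gcongr
    · refine lt_of_le_of_lt ?_ (h2 δ β)
      have hexp := hpow (show (i : ℕ) + k - N δ ≤ k - 1 by omega)
      gcongr
  · obtain ⟨δ, hδ⟩ := hrL i
    have := i.2
    rw [hδ]
    refine lt_of_le_of_lt ?_ (h2 δ β)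
    simp only [L, siteRadius]
    split_ifs with hN
    · calc ‖p‖ * (ε * (‖a δ‖ * s ^ ((i : ℕ) - N δ)))
          = ε * (‖p‖ * ‖a δ‖ * s ^ ((i : ℕ) - N δ)) := by ring
        _ ≤ _ := by
          have hexp := hpow (show (i : ℕ) - N δ ≤ k - 1 by omega)
          gcongr
    · calc ‖p‖ * (ε * (‖p‖ * ‖a δ‖ * s ^ ((i : ℕ) + k - N δ)))
          ≤ 1 * (ε * (‖p‖ * ‖a δ‖ * s ^ ((i : ℕ) + k - N δ))) := by gcongr
        _ = ε * (‖p‖ * ‖a δ‖ * s ^ ((i : ℕ) + k - N δ)) := one_mul _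
        _ ≤ _ := by
          have hexp := hpow (show (i : ℕ) + k - N δ ≤ k - 1 by omega)
          gcongr

end Radii


/-! ### Cyclicity -/

section Intervals

variable {m : ℕ} {M : Type*} [CommMonoid M]

@[to_additive]
lemma prod_Ioi_castSucc (f : Fin (m + 1) → M) (a : Fin m) :
    ∏ i ∈ Finset.Ioi a.castSucc, f i = (∏ i ∈ Finset.Ioi a, f i.castSucc) * f (Fin.last m) := by
  have h : ∀ {l : ℕ} (c : Fin l), Finset.Ioi c = Finset.univ.filter (c < ·) := fun c => by
    ext; simp
  rw [h, h, Finset.prod_filter, Finset.prod_filter, Fin.prod_univ_castSucc]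
  simp [Fin.castSucc_lt_last]

lemma sum_Ici_castSucc (f : Fin (m + 1) → ℕ) (a : Fin m) :
    ∑ i ∈ Finset.Ici a.castSucc, f i = ∑ i ∈ Finset.Ici a, f i.castSucc + f (Fin.last m) := by
  have h : ∀ {l : ℕ} (c : Fin l), Finset.Ici c = Finset.univ.filter (c ≤ ·) := fun c => by
    ext; simp
  rw [h, h, Finset.sum_filter, Finset.sum_filter, Fin.sum_univ_castSucc]
  simp [Fin.le_last]

lemma prod_Iio_succ (f : Fin (m + 1) → M) (a : Fin m) :
    ∏ i ∈ Finset.Iio a.succ, f i = f 0 * ∏ i ∈ Finset.Iio a, f i.succ := by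
  have h : ∀ {l : ℕ} (c : Fin l), Finset.Iio c = Finset.univ.filter (· < c) := fun c => by
    ext; simp
  rw [h, h, Finset.prod_filter, Finset.prod_filter, Fin.prod_univ_succ]
  simp

lemma prod_Iic_succ (f : Fin (m + 1) → M) (a : Fin m) :
    ∏ i ∈ Finset.Iic a.succ, f i = f 0 * ∏ i ∈ Finset.Iic a, f i.succ := by
  have h : ∀ {l : ℕ} (c : Fin l), Finset.Iic c = Finset.univ.filter (· ≤ c) := fun c => by
    ext; simp
  rw [h, h, Finset.prod_filter, Finset.prod_filter, Fin.prod_univ_succ]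
  simp

/-- The product over the pairs of positions, after a permutation of the positions. -/
lemma prod_prod_Ioi_eq_of_perm {k : ℕ} (σ : Equiv.Perm (Fin k)) {f g : Fin k → Fin k → M}
    (h : ∀ i j, i < j → g i j = if σ i < σ j then f (σ i) (σ j) else f (σ j) (σ i)) :
    ∏ i, ∏ j ∈ Finset.Ioi i, g i j = ∏ i, ∏ j ∈ Finset.Ioi i, f i j := by
  rw [Finset.prod_sigma', Finset.prod_sigma']
  refine Finset.prod_bij'
    (fun x _ => if σ x.1 < σ x.2 then ⟨σ x.1, σ x.2⟩ else ⟨σ x.2, σ x.1⟩)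
    (fun x _ => if σ.symm x.1 < σ.symm x.2 then ⟨σ.symm x.1, σ.symm x.2⟩
      else ⟨σ.symm x.2, σ.symm x.1⟩) ?_ ?_ ?_ ?_ ?_
  · rintro ⟨i, j⟩ hx
    simp only [Finset.mem_sigma, Finset.mem_univ, Finset.mem_Ioi, true_and] at hx ⊢
    split_ifs with hσ
    · exact hσ
    · exact lt_of_le_of_ne (not_lt.1 hσ) (σ.injective.ne hx.ne')
  · rintro ⟨i, j⟩ hx
    simp only [Finset.mem_sigma, Finset.mem_univ, Finset.mem_Ioi, true_and] at hx ⊢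
    split_ifs with hσ
    · exact hσ
    · exact lt_of_le_of_ne (not_lt.1 hσ) (σ.symm.injective.ne hx.ne')
  · rintro ⟨i, j⟩ hx
    simp only [Finset.mem_sigma, Finset.mem_univ, Finset.mem_Ioi, true_and] at hx
    by_cases hσ : σ i < σ j
    · simp [hσ, hx]
    · simp [hσ, hx.not_gt]
  · rintro ⟨i, j⟩ hx
    simp only [Finset.mem_sigma, Finset.mem_univ, Finset.mem_Ioi, true_and] at hx
    by_cases hσ : σ.symm i < σ.symm j
    · simp [hσ, hx]
    · simp [hσ, hx.not_gt]
  · rintro ⟨i, j⟩ hx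
    simp only [Finset.mem_sigma, Finset.mem_univ, Finset.mem_Ioi, true_and] at hx
    dsimp only
    rw [h i j hx]
    split_ifs <;> rfl

end Intervals

section Cyclic

variable {m k : ℕ} {q₁ q₂ p z K₀ a₀ : ℂ} {K a : Fin m → ℂ} {l : ℕ} {κ : Fin m → ℕ}

/-- The cyclic permutation of the positions that moves the first `l` of `k` positions to the end. -/
def rotatePositions {k l : ℕ} (h : l ≤ k) : Equiv.Perm (Fin k) where
  toFun i := if hi : (i : ℕ) < l then ⟨i + (k - l), by omega⟩ else ⟨i - l, by omega⟩
  invFun j := if hj : (j : ℕ) < k - l then ⟨j + l, by omega⟩ else ⟨j - (k - l), by omega⟩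
  left_inv i := by
    ext
    by_cases hi : (i : ℕ) < l
    · simp [hi]
    · simp only [hi, dite_false]
      rw [dif_pos (by omega)]
      change (i : ℕ) - l + l = i
      omega
  right_inv j := by
    ext
    by_cases hj : (j : ℕ) < k - l
    · simp [hj]
    · simp only [hj, dite_false]
      rw [dif_pos (by omega)]
      change (j : ℕ) - (k - l) + (k - l) = j
      omega

lemma rotatePositions_of_lt (h : l ≤ k) {i : Fin k} (hi : (i : ℕ) < l) :
    (rotatePositions h i : ℕ) = i + (k - l) := by
  simp [rotatePositions, hi]

lemma rotatePositions_of_not_lt (h : l ≤ k) {i : Fin k} (hi : ¬(i : ℕ) < l) :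
    (rotatePositions h i : ℕ) = i - l := by
  simp [rotatePositions, hi]

lemma hasColour_snoc_last (i : Fin k) :
    HasColour (Fin.snoc κ l : Fin (m + 1) → ℕ) i (Fin.last m) ↔ (i : ℕ) < l := by
  have h1 : Finset.Ioi (Fin.last m) = ∅ := by ext; simp [Fin.le_last]
  rw [HasColour, ← Finset.Ioi_insert, Finset.sum_insert (by simp), h1]
  simp

lemma hasColour_snoc_castSucc (i : Fin k) (γ : Fin m) :
    HasColour (Fin.snoc κ l : Fin (m + 1) → ℕ) i γ.castSucc ↔
      ∑ β ∈ Finset.Ioi γ, κ β + l ≤ (i : ℕ) ∧ (i : ℕ) < ∑ β ∈ Finset.Ici γ, κ β + l := by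
  rw [HasColour, sum_Ioi_castSucc, sum_Ici_castSucc]
  simp

lemma hasColour_cons_zero (hκ : l + ∑ γ, κ γ = k) (i : Fin k) :
    HasColour (Fin.cons l κ : Fin (m + 1) → ℕ) i 0 ↔ k - l ≤ (i : ℕ) := by
  have h1 : Finset.Ici (0 : Fin (m + 1)) = Finset.univ := by ext; simp
  rw [HasColour, Fin.sum_Ioi_zero, h1, Fin.sum_univ_succ]
  simp only [Fin.cons_succ, Fin.cons_zero]
  omega

lemma hasColour_cons_succ (i : Fin k) (γ : Fin m) :
    HasColour (Fin.cons l κ : Fin (m + 1) → ℕ) i γ.succ ↔ HasColour κ i γ := by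
  rw [HasColour, Fin.sum_Ioi_succ, Fin.sum_Ici_succ]
  simp [HasColour]

lemma hasColour_rotate_zero (hκ : l + ∑ γ, κ γ = k) (h : l ≤ k) (i : Fin k) :
    HasColour (Fin.cons l κ : Fin (m + 1) → ℕ) (rotatePositions h i) 0 ↔
      HasColour (Fin.snoc κ l : Fin (m + 1) → ℕ) i (Fin.last m) := by
  rw [hasColour_cons_zero hκ, hasColour_snoc_last]
  by_cases hi : (i : ℕ) < l
  · rw [rotatePositions_of_lt h hi]
    omega
  · rw [rotatePositions_of_not_lt h hi]
    omega

lemma hasColour_rotate_succ (hκ : l + ∑ γ, κ γ = k) (h : l ≤ k) (i : Fin k) (γ : Fin m) :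
    HasColour (Fin.cons l κ : Fin (m + 1) → ℕ) (rotatePositions h i) γ.succ ↔
      HasColour (Fin.snoc κ l : Fin (m + 1) → ℕ) i γ.castSucc := by
  have h1 : ∑ β ∈ Finset.Ici γ, κ β ≤ ∑ β, κ β := Finset.sum_le_sum_of_subset (Finset.subset_univ _)
  rw [hasColour_cons_succ, hasColour_snoc_castSucc, HasColour]
  by_cases hi : (i : ℕ) < l
  · rw [rotatePositions_of_lt h hi]
    omega
  · rw [rotatePositions_of_not_lt h hi]
    omega

/-- A product over the colours and the positions of each colour, after the last colour has become
the first one. -/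
lemma prod_hasColour_rotate {M : Type*} [CommMonoid M] (hκ : l + ∑ γ, κ γ = k) (h : l ≤ k)
    {f g : Fin (m + 1) → Fin k → M}
    (h0 : ∀ i : Fin k, (i : ℕ) < l → g (Fin.last m) i = f 0 (rotatePositions h i))
    (h1 : ∀ (i : Fin k) γ, l ≤ (i : ℕ) → g (Fin.castSucc γ) i = f γ.succ (rotatePositions h i)) :
    ∏ γ, ∏ i : Fin k with HasColour (Fin.snoc κ l : Fin (m + 1) → ℕ) i γ, g γ i =
      ∏ γ, ∏ i : Fin k with HasColour (Fin.cons l κ : Fin (m + 1) → ℕ) i γ, f γ i := by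
  rw [Fin.prod_univ_castSucc, Fin.prod_univ_succ, mul_comm]
  congr 1
  · refine Finset.prod_equiv (rotatePositions h) (fun i => ?_) fun i hi => ?_
    · simp [hasColour_rotate_zero hκ h]
    · exact h0 i ((hasColour_snoc_last i).1 (Finset.mem_filter.1 hi).2)
  · refine Finset.prod_congr rfl fun γ _ =>
      Finset.prod_equiv (rotatePositions h) (fun i => ?_) fun i hi => ?_
    · simp [hasColour_rotate_succ hκ h]
    · have := ((hasColour_snoc_castSucc i γ).1 (Finset.mem_filter.1 hi).2).1
      exact h1 i γ (by omega)

/-- The dynamical arguments of the variables of the distinguished site agree in the two orders: with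
this site in the last place, the product of all `K_γ` is `q₁ ^ (2 k)`, and the rotation of the
positions changes the power of `q₁` accordingly. -/
lemma mul_rhoFactor_mul_KProd_last (hq₁ : q₁ ≠ 0) (h : l ≤ k)
    (hzero : K₀ * ∏ γ, K γ = q₁ ^ (2 * k)) {i : Fin k} (hi : (i : ℕ) < l) :
    z * (K₀ * q₁ ^ (-2 * (l : ℤ))) * rhoFactor q₁ i *
        KProd (Fin.snoc K K₀ : Fin (m + 1) → ℂ) (Fin.last m) =
      z * rhoFactor q₁ (rotatePositions h i) * KProd (Fin.cons K₀ K : Fin (m + 1) → ℂ) 0 := by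
  have h1 : KProd (Fin.snoc K K₀ : Fin (m + 1) → ℂ) (Fin.last m) = q₁ ^ (2 * (k : ℤ)) := by
    have : Finset.Iic (Fin.last m) = Finset.univ := by ext; simp [Fin.le_last]
    rw [KProd, this, Fin.prod_univ_castSucc]
    simp only [Fin.snoc_castSucc, Fin.snoc_last]
    rw [mul_comm, hzero]
    norm_cast
  have h2 : KProd (Fin.cons K₀ K : Fin (m + 1) → ℂ) 0 = K₀ := by
    have : Finset.Iic (0 : Fin (m + 1)) = {0} := by ext; simp
    rw [KProd, this, Finset.prod_singleton, Fin.cons_zero]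
  rw [h1, h2, rhoFactor, rhoFactor, rotatePositions_of_lt h hi]
  calc _ = z * K₀ * (q₁ ^ (-2 * (l : ℤ)) * q₁ ^ (2 * ((i : ℤ) + 1) - k - 1) *
        q₁ ^ (2 * (k : ℤ))) := by ring
    _ = _ := by
      rw [← zpow_add₀ hq₁, ← zpow_add₀ hq₁, mul_right_comm]
      congr 3
      push_cast [h]
      ring

/-- The dynamical arguments of the variables of the other sites agree as well: the factor `K₀` comes
from the shift of `z` on the left, and from the site in front on the right. -/
lemma mul_rhoFactor_mul_KProd_castSucc (hq₁ : q₁ ≠ 0) (h : l ≤ k) {i : Fin k} (hi : l ≤ (i : ℕ))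
    (γ : Fin m) :
    z * (K₀ * q₁ ^ (-2 * (l : ℤ))) * rhoFactor q₁ i *
        KProd (Fin.snoc K K₀ : Fin (m + 1) → ℂ) γ.castSucc =
      z * rhoFactor q₁ (rotatePositions h i) * KProd (Fin.cons K₀ K : Fin (m + 1) → ℂ) γ.succ := by
  have h1 : KProd (Fin.snoc K K₀ : Fin (m + 1) → ℂ) γ.castSucc = KProd K γ := by
    rw [KProd, Fin.prod_Iic_castSucc]
    simp [KProd]
  have h2 : KProd (Fin.cons K₀ K : Fin (m + 1) → ℂ) γ.succ = K₀ * KProd K γ := by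
    rw [KProd, prod_Iic_succ]
    simp [KProd]
  rw [h1, h2, rhoFactor, rhoFactor, rotatePositions_of_not_lt h (not_lt.2 hi)]
  calc _ = z * (q₁ ^ (-2 * (l : ℤ)) * q₁ ^ (2 * ((i : ℤ) + 1) - k - 1)) * (K₀ * KProd K γ) := by
        ring
    _ = _ := by
      rw [← zpow_add₀ hq₁]
      congr 3
      push_cast [hi]
      ring

lemma stabConst_rotate (hq₁ : q₁ ≠ 0) (hκ : l + ∑ γ, κ γ = k)
    (hzero : K₀ * ∏ γ, K γ = q₁ ^ (2 * k)) :
    stabConst k q₁ q₂ (Fin.snoc K K₀ : Fin (m + 1) → ℂ) (z * (K₀ * q₁ ^ (-2 * (l : ℤ))))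
        (Fin.snoc κ l : Fin (m + 1) → ℕ) =
      stabConst k q₁ q₂ (Fin.cons K₀ K : Fin (m + 1) → ℂ) z (Fin.cons l κ : Fin (m + 1) → ℕ) := by
  have h : l ≤ k := by omega
  refine prod_hasColour_rotate hκ h (fun i hi => ?_) fun i γ hi => ?_
  · rw [mul_rhoFactor_mul_KProd_last hq₁ h hzero hi]
    simp
  · rw [mul_rhoFactor_mul_KProd_castSucc hq₁ h hi]
    simp

lemma regPair_mul_mul (hp : p ≠ 0) (x y : ℂ) :
    regPair q₁ q₂ p (p * x) (p * y) = regPair q₁ q₂ p x y := by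
  rw [regPair, regPair, mul_left_comm q₁, mul_left_comm q₁, mul_div_mul_left _ _ hp,
    mul_div_mul_left _ _ hp, mul_div_mul_left _ _ hp]

/-- Multiplication of one variable by `p` exchanges the two variables of the regularized pair
factor. This is the cyclicity of the trace. -/
lemma regPair_mul_left (hp : p ≠ 0) {x y : ℂ} :
    regPair q₁ q₂ p (p * x) y = regPair q₁ q₂ p y x := by
  have h1 : theta (p * x / y) p = theta (y / x) p := by
    have e1 : p / (p * x / y) = y / x := by
      rw [div_div_eq_mul_div, mul_div_mul_left _ _ hp]
    have e2 : p * x / y = p / (y / x) := by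
      rw [div_div_eq_mul_div]
    rw [theta, theta, e1, ← e2, mul_comm]
  have h2 : p * (q₁ * y / (p * x)) = q₁ * y / x := by
    rw [← mul_div_assoc, mul_div_mul_left _ _ hp]
  have h3 : q₁ * (p * x) / y = p * (q₁ * x / y) := by ring
  rw [regPair, regPair, h1, h2, h3]
  ring

lemma regSite_rotate_last (hp : p ≠ 0) (hq₁ : q₁ ≠ 0) (h : l ≤ k)
    (hzero : K₀ * ∏ γ, K γ = q₁ ^ (2 * k)) {i : Fin k} (hi : (i : ℕ) < l) (w : ℂ) :
    regSite q₁ q₂ p (Fin.snoc K K₀ : Fin (m + 1) → ℂ) (Fin.snoc a (p * a₀) : Fin (m + 1) → ℂ)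
        (z * (K₀ * q₁ ^ (-2 * (l : ℤ)))) (Fin.last m) i (p * w) =
      regSite q₁ q₂ p (Fin.cons K₀ K : Fin (m + 1) → ℂ) (Fin.cons a₀ a : Fin (m + 1) → ℂ) z 0
        (rotatePositions h i) w := by
  have e1 : ∀ b : ℂ, p * (b / (p * w)) = b / w := fun b => by
    rw [← mul_div_assoc, mul_div_mul_left _ _ hp]
  have e2 : ∀ b : ℂ, b * (p * a₀) / (p * w) = b * a₀ / w := fun b => by
    rw [mul_left_comm, mul_div_mul_left _ _ hp]
  have h1 : Finset.Ioi (Fin.last m) = ∅ := by ext; simp [Fin.le_last]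
  have h2 : Finset.Iio (0 : Fin (m + 1)) = ∅ := by ext; simp
  rw [regSite, regSite, mul_rhoFactor_mul_KProd_last hq₁ h hzero hi, h1, h2, Fin.prod_Ioi_zero,
    Fin.Iio_last_eq_map, Finset.prod_map]
  simp only [Fin.coe_castSuccEmb, Fin.snoc_castSucc, Fin.snoc_last, Fin.cons_zero, Fin.cons_succ,
    Finset.prod_empty, e1, e2, mul_div_mul_left _ _ hp]
  ring

lemma regSite_rotate_castSucc (hq₁ : q₁ ≠ 0) (h : l ≤ k) {i : Fin k} (hi : l ≤ (i : ℕ))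
    (γ : Fin m) (w : ℂ) :
    regSite q₁ q₂ p (Fin.snoc K K₀ : Fin (m + 1) → ℂ) (Fin.snoc a (p * a₀) : Fin (m + 1) → ℂ)
        (z * (K₀ * q₁ ^ (-2 * (l : ℤ)))) γ.castSucc i w =
      regSite q₁ q₂ p (Fin.cons K₀ K : Fin (m + 1) → ℂ) (Fin.cons a₀ a : Fin (m + 1) → ℂ) z γ.succ
        (rotatePositions h i) w := by
  have e1 : p * a₀ / w = p * (a₀ / w) := by ring
  have e2 : K₀ * (p * a₀) / w = p * (K₀ * a₀ / w) := by ring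
  rw [regSite, regSite, mul_rhoFactor_mul_KProd_castSucc hq₁ h hi, Fin.prod_Iio_castSucc,
    prod_Iio_succ, prod_Ioi_castSucc, Fin.prod_Ioi_succ]
  simp only [Fin.snoc_castSucc, Fin.snoc_last, Fin.cons_zero, Fin.cons_succ, e1, e2]
  ring

/-- The integrand for the order with the distinguished site in the last place, shifted by `p`,
becomes the one with this site in the first place if its variables are multiplied by `p`. -/
lemma regIntegrand_rotate (hp : p ≠ 0) (hq₁ : q₁ ≠ 0) (hκ : l + ∑ γ, κ γ = k) (h : l ≤ k)
    (hzero : K₀ * ∏ γ, K γ = q₁ ^ (2 * k)) (y : Fin k → ℂ) :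
    regIntegrand q₁ q₂ p (Fin.snoc K K₀ : Fin (m + 1) → ℂ)
        (Fin.snoc a (p * a₀) : Fin (m + 1) → ℂ) (z * (K₀ * q₁ ^ (-2 * (l : ℤ))))
        (Fin.snoc κ l : Fin (m + 1) → ℕ)
        (fun i => if (i : ℕ) < l then p * y (rotatePositions h i) else y (rotatePositions h i)) =
      regIntegrand q₁ q₂ p (Fin.cons K₀ K : Fin (m + 1) → ℂ) (Fin.cons a₀ a : Fin (m + 1) → ℂ) z
        (Fin.cons l κ : Fin (m + 1) → ℕ) y := by
  rw [regIntegrand, regIntegrand]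
  refine congrArg₂ (· * ·) ?_ ?_
  · refine prod_prod_Ioi_eq_of_perm (rotatePositions h) fun i j hij => ?_
    rw [Fin.lt_def] at hij
    by_cases hi : (i : ℕ) < l <;> by_cases hj : (j : ℕ) < l
    · rw [if_pos hi, if_pos hj, if_pos, regPair_mul_mul hp]
      rw [Fin.lt_def, rotatePositions_of_lt h hi, rotatePositions_of_lt h hj]
      omega
    · rw [if_pos hi, if_neg hj, if_neg, regPair_mul_left hp]
      rw [Fin.lt_def, rotatePositions_of_lt h hi, rotatePositions_of_not_lt h hj]
      omega
    · omega
    · rw [if_neg hi, if_neg hj, if_pos]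
      rw [Fin.lt_def, rotatePositions_of_not_lt h hi, rotatePositions_of_not_lt h hj]
      omega
  · refine prod_hasColour_rotate hκ h (fun i hi => ?_) fun i γ hi => ?_
    · rw [if_pos hi, regSite_rotate_last hp hq₁ h hzero hi]
    · rw [if_neg (not_lt.2 hi), regSite_rotate_castSucc hq₁ h hi]

/-- The admissible radii for the two orders correspond to each other in the same way. -/
lemma Admissible.rotate (hp : p ≠ 0) (hκ : l + ∑ γ, κ γ = k) (h : l ≤ k) {r : Fin k → ℝ}
    (hr : Admissible q₁ q₂ p (Fin.cons K₀ K : Fin (m + 1) → ℂ) (Fin.cons a₀ a : Fin (m + 1) → ℂ)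
      (Fin.cons l κ : Fin (m + 1) → ℕ) r) :
    Admissible q₁ q₂ p (Fin.snoc K K₀ : Fin (m + 1) → ℂ) (Fin.snoc a (p * a₀) : Fin (m + 1) → ℂ)
      (Fin.snoc κ l : Fin (m + 1) → ℕ)
      (fun i => if (i : ℕ) < l then ‖p‖ * r (rotatePositions h i)
        else r (rotatePositions h i)) := by
  have hP : 0 < ‖p‖ := norm_pos_iff.2 hp
  have hpU : ∀ b : ℂ, ‖b * (p * a₀)‖ = ‖p‖ * ‖b * a₀‖ := fun b => by
    rw [mul_left_comm, norm_mul]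
  have hlow : ∀ i : Fin k, (i : ℕ) < l → ‖a₀‖ < r (rotatePositions h i) ∧
      (∀ β, ‖a β‖ < r (rotatePositions h i)) ∧
      r (rotatePositions h i) < ‖q₂ * K₀ * a₀‖ ∧
      ∀ β, ‖p‖ * r (rotatePositions h i) < ‖q₂ * K β * a β‖ := by
    intro i hi
    have hc := (hasColour_rotate_zero hκ h i).2 ((hasColour_snoc_last i).2 hi)
    exact ⟨by simpa using hr.lower _ _ hc 0 le_rfl,
      fun β => by simpa using hr.lower _ _ hc β.succ (Fin.zero_le _),
      by simpa using hr.upper _ _ hc 0 le_rfl,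
      fun β => by simpa using hr.upper' _ _ hc β.succ (Fin.succ_pos _)⟩
  refine ⟨fun i => ?_, fun i j hij => ?_, fun i γ hi β hβ => ?_, fun i γ hi β hβ => ?_,
    fun i γ hi β hβ => ?_, fun i γ hi β hβ => ?_⟩
  · split_ifs
    · exact mul_pos hP (hr.pos _)
    · exact hr.pos _
  · rw [Fin.lt_def] at hij
    by_cases hi : (i : ℕ) < l <;> by_cases hj : (j : ℕ) < l
    · have h1 := hr.pair (rotatePositions h i) (rotatePositions h j) (by
        rw [Fin.lt_def, rotatePositions_of_lt h hi, rotatePositions_of_lt h hj]; omega)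
      rw [if_pos hi, if_pos hj, mul_left_comm, mul_left_comm _ ‖p‖]
      exact ⟨mul_lt_mul_of_pos_left h1.1 hP, mul_lt_mul_of_pos_left h1.2 hP⟩
    · have h1 := hr.pair (rotatePositions h j) (rotatePositions h i) (by
        rw [Fin.lt_def, rotatePositions_of_lt h hi, rotatePositions_of_not_lt h hj]; omega)
      rw [if_pos hi, if_neg hj, norm_mul, mul_assoc, mul_left_comm, ← mul_assoc, ← norm_mul]
      exact ⟨h1.2, mul_lt_mul_of_pos_left h1.1 hP⟩
    · omega
    · have h1 := hr.pair (rotatePositions h i) (rotatePositions h j) (by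
        rw [Fin.lt_def, rotatePositions_of_not_lt h hi, rotatePositions_of_not_lt h hj]; omega)
      rw [if_neg hi, if_neg hj]
      exact h1
  · induction γ using Fin.lastCases with
    | last =>
      have hil := (hasColour_snoc_last i).1 hi
      rw [if_pos hil, Fin.last_le_iff.1 hβ, Fin.snoc_last, norm_mul]
      exact mul_lt_mul_of_pos_left (hlow i hil).1 hP
    | cast γ =>
      have hc := (hasColour_rotate_succ hκ h i γ).2 hi
      have hil : ¬(i : ℕ) < l := by
        have := ((hasColour_snoc_castSucc i γ).1 hi).1
        omega
      rw [if_neg hil]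
      induction β using Fin.lastCases with
      | last => simpa using hr.lower' _ _ hc 0 (Fin.succ_pos _)
      | cast β =>
        simpa using hr.lower _ _ hc β.succ
          (Fin.succ_le_succ_iff.2 (Fin.castSucc_le_castSucc_iff.1 hβ))
  · induction γ using Fin.lastCases with
    | last =>
      have hil := (hasColour_snoc_last i).1 hi
      rw [if_pos hil]
      induction β using Fin.lastCases with
      | last => exact absurd hβ (lt_irrefl _)
      | cast β =>
        rw [Fin.snoc_castSucc, norm_mul]
        exact mul_lt_mul_of_pos_left ((hlow i hil).2.1 β) hP
    | cast γ =>
      have hc := (hasColour_rotate_succ hκ h i γ).2 hi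
      have hil : ¬(i : ℕ) < l := by
        have := ((hasColour_snoc_castSucc i γ).1 hi).1
        omega
      rw [if_neg hil]
      induction β using Fin.lastCases with
      | last => exact absurd hβ (Fin.le_last _).not_gt
      | cast β =>
        simpa using hr.lower' _ _ hc β.succ
          (Fin.succ_lt_succ_iff.2 (Fin.castSucc_lt_castSucc_iff.1 hβ))
  · induction γ using Fin.lastCases with
    | last =>
      have hil := (hasColour_snoc_last i).1 hi
      rw [if_pos hil]
      induction β using Fin.lastCases with
      | last =>
        rw [Fin.snoc_last, Fin.snoc_last, hpU]
        exact mul_lt_mul_of_pos_left (hlow i hil).2.2.1 hP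
      | cast β =>
        rw [Fin.snoc_castSucc, Fin.snoc_castSucc]
        exact (hlow i hil).2.2.2 β
    | cast γ =>
      have hc := (hasColour_rotate_succ hκ h i γ).2 hi
      have hil : ¬(i : ℕ) < l := by
        have := ((hasColour_snoc_castSucc i γ).1 hi).1
        omega
      rw [if_neg hil]
      induction β using Fin.lastCases with
      | last => exact absurd hβ (Fin.castSucc_lt_last _).not_ge
      | cast β =>
        simpa using hr.upper _ _ hc β.succ
          (Fin.succ_le_succ_iff.2 (Fin.castSucc_le_castSucc_iff.1 hβ))
  · induction γ using Fin.lastCases with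
    | last => exact absurd hβ (Fin.le_last _).not_gt
    | cast γ =>
      have hc := (hasColour_rotate_succ hκ h i γ).2 hi
      have hil : ¬(i : ℕ) < l := by
        have := ((hasColour_snoc_castSucc i γ).1 hi).1
        omega
      rw [if_neg hil]
      induction β using Fin.lastCases with
      | last =>
        rw [Fin.snoc_last, Fin.snoc_last, hpU]
        have := hr.upper _ _ hc 0 (Fin.zero_le _)
        rw [Fin.cons_zero, Fin.cons_zero] at this
        exact mul_lt_mul_of_pos_left this hP
      | cast β =>
        simpa using hr.upper' _ _ hc β.succ
          (Fin.succ_lt_succ_iff.2 (Fin.castSucc_lt_castSucc_iff.1 hβ))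

/-- The integrals for the two orders agree on corresponding tori. Multiplication of variables by `p`
changes their radii by `|p|` and rotates their circles by the argument of `p`; the Haar measure is
invariant under this rotation. -/
lemma blockIntegral_rotate (hp : p ≠ 0) (hq₁ : q₁ ≠ 0) (hκ : l + ∑ γ, κ γ = k) (h : l ≤ k)
    (hzero : K₀ * ∏ γ, K γ = q₁ ^ (2 * k)) (r : Fin k → ℝ) :
    blockIntegral q₁ q₂ p (Fin.snoc K K₀ : Fin (m + 1) → ℂ)
        (Fin.snoc a (p * a₀) : Fin (m + 1) → ℂ) (z * (K₀ * q₁ ^ (-2 * (l : ℤ))))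
        (Fin.snoc κ l : Fin (m + 1) → ℕ)
        (fun i => if (i : ℕ) < l then ‖p‖ * r (rotatePositions h i)
          else r (rotatePositions h i)) =
      blockIntegral q₁ q₂ p (Fin.cons K₀ K : Fin (m + 1) → ℂ) (Fin.cons a₀ a : Fin (m + 1) → ℂ) z
        (Fin.cons l κ : Fin (m + 1) → ℕ) r := by
  let v : Fin k → UnitAddCircle := fun i =>
    if (i : ℕ) < l then ((p.arg / (2 * Real.pi) : ℝ) : UnitAddCircle) else 0
  have hv : ∀ i : Fin k, (i : ℕ) < l → (‖p‖ : ℂ) * (AddCircle.toCircle (v i) : ℂ) = p := by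
    intro i hi
    have hpi : Real.pi ≠ 0 := Real.pi_ne_zero
    simp only [v, if_pos hi, AddCircle.toCircle_apply_mk, Circle.coe_exp]
    rw [show 2 * Real.pi / 1 * (p.arg / (2 * Real.pi)) = p.arg by field_simp]
    exact Complex.norm_mul_exp_arg_mul_I p
  rw [blockIntegral, blockIntegral,
    ← integral_torus_comp_perm (fun u => regIntegrand q₁ q₂ p (Fin.cons K₀ K : Fin (m + 1) → ℂ)
      (Fin.cons a₀ a : Fin (m + 1) → ℂ) z (Fin.cons l κ : Fin (m + 1) → ℕ) (torusPt r u))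
      (rotatePositions h).symm,
    ← MeasureTheory.integral_add_right_eq_self (μ := torusMeasure k) _ v]
  refine MeasureTheory.integral_congr_ae (.of_forall fun u => ?_)
  dsimp only
  rw [← regIntegrand_rotate hp hq₁ hκ h hzero]
  refine congrArg _ (funext fun i => ?_)
  have hu : torusPt r (u ∘ (rotatePositions h).symm) (rotatePositions h i) =
      r (rotatePositions h i) * (AddCircle.toCircle (u i) : ℂ) := by
    rw [torusPt, Function.comp_apply, Equiv.symm_apply_apply]
  rw [hu, torusPt, Pi.add_apply, AddCircle.toCircle_add, Circle.coe_mul]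
  by_cases hi : (i : ℕ) < l
  · rw [if_pos hi, if_pos hi]
    push_cast
    linear_combination (r (rotatePositions h i) * (AddCircle.toCircle (u i) : ℂ)) * hv i hi
  · rw [if_neg hi, if_neg hi]
    simp [v, hi]

end Cyclic


/-! ### Moving one site through the order -/

section Move

variable {m k : ℕ} {q₁ q₂ p z : ℂ} {K a : Fin (m + 1) → ℂ} {α : Fin (m + 1)}

/-- The order in which the site `α` has been moved to the position `b`, while the other sites keep
their relative order: the position `b` is taken by `α`, the position `b.succAbove j` by
`α.succAbove j`. -/
def moveSite (α b : Fin (m + 1)) : Equiv.Perm (Fin (m + 1)) :=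
  (finSuccEquiv' b).trans (finSuccEquiv' α).symm

@[simp] lemma moveSite_apply_self (α b : Fin (m + 1)) : moveSite α b b = α := by
  simp [moveSite]

@[simp] lemma moveSite_succAbove (α b : Fin (m + 1)) (j : Fin m) :
    moveSite α b (b.succAbove j) = α.succAbove j := by
  simp [moveSite]

lemma moveSite_self (α : Fin (m + 1)) : moveSite α α = 1 := by
  ext γ
  simp [moveSite]

lemma comp_moveSite {M : Type*} (f : Fin (m + 1) → M) (α b : Fin (m + 1)) :
    f ∘ moveSite α b = b.insertNth (f α) (f ∘ α.succAbove) := by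
  ext γ
  induction γ using b.succAboveCases with
  | x => simp
  | p j => simp

lemma moveSite_mul_swap (α : Fin (m + 1)) (i : Fin m) :
    moveSite α i.castSucc * Equiv.swap i.castSucc i.succ = moveSite α i.succ := by
  have h0 : i.castSucc.succAbove i = i.succ := Fin.succAbove_castSucc_self i
  have h1 : i.succ.succAbove i = i.castSucc := Fin.succAbove_succ_self i
  refine Equiv.ext fun γ => ?_
  rw [Equiv.Perm.mul_apply]
  by_cases hγ : γ = i.succ
  · rw [hγ, Equiv.swap_apply_right, moveSite_apply_self, moveSite_apply_self]
  obtain ⟨j, rfl⟩ := Fin.exists_succAbove_eq hγ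
  by_cases hj : j = i
  · rw [hj, moveSite_succAbove, h1, Equiv.swap_apply_left, ← h0, moveSite_succAbove]
  · have h2 : i.succ.succAbove j = i.castSucc.succAbove j := by
      rcases lt_or_gt_of_ne hj with hlt | hgt
      · rw [Fin.succAbove_of_castSucc_lt i.succ j ((Fin.castSucc_lt_castSucc_iff.2 hlt).trans
            Fin.castSucc_lt_succ), Fin.succAbove_of_castSucc_lt i.castSucc j
            (Fin.castSucc_lt_castSucc_iff.2 hlt)]
      · rw [Fin.succAbove_of_le_castSucc i.succ j (Fin.succ_le_castSucc_iff.2 hgt),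
          Fin.succAbove_of_le_castSucc i.castSucc j (Fin.castSucc_le_castSucc_iff.2 hgt.le)]
    have h3 : i.succ.succAbove j ≠ i.castSucc := fun h => hj
      (Fin.succAbove_right_injective (h.trans h1.symm))
    rw [Equiv.swap_apply_of_ne_of_ne h3 (Fin.succAbove_ne _ _), moveSite_succAbove, h2,
      moveSite_succAbove]

lemma moveSite_succ_of_lt {i : Fin m} (h : i.castSucc < α) :
    moveSite α i.castSucc i.succ = i.castSucc := by
  rw [← Fin.succAbove_castSucc_self i, moveSite_succAbove, Fin.succAbove_of_castSucc_lt _ _ h]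

lemma moveSite_succ_of_le {i : Fin m} (h : α ≤ i.castSucc) :
    moveSite α i.castSucc i.succ = i.succ := by
  conv_lhs => rw [← Fin.succAbove_castSucc_self i]
  rw [moveSite_succAbove, Fin.succAbove_of_le_castSucc _ _ h]

/-- The only sites that are out of order are `α` and those that it has passed. -/
lemma moveSite_eq_of_lt_of_lt (α b : Fin (m + 1)) {γ δ : Fin (m + 1)} (h : δ < γ)
    (h' : moveSite α b γ < moveSite α b δ) : δ = b ∧ b < α ∨ γ = b ∧ α < b := by
  induction δ using b.succAboveCases with
  | x =>
    induction γ using b.succAboveCases with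
    | x => exact absurd h (lt_irrefl _)
    | p j =>
      rw [moveSite_apply_self, moveSite_succAbove, Fin.succAbove_lt_iff_castSucc_lt] at h'
      rw [Fin.lt_succAbove_iff_le_castSucc] at h
      exact Or.inl ⟨rfl, h.trans_lt h'⟩
  | p i =>
    induction γ using b.succAboveCases with
    | x =>
      rw [moveSite_apply_self, moveSite_succAbove, Fin.lt_succAbove_iff_le_castSucc] at h'
      rw [Fin.succAbove_lt_iff_castSucc_lt] at h
      exact Or.inr ⟨rfl, h'.trans_lt h⟩
    | p j =>
      rw [moveSite_succAbove, moveSite_succAbove, Fin.succAbove_lt_succAbove_iff] at h'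
      rw [Fin.succAbove_lt_succAbove_iff] at h
      exact absurd h h'.not_gt

lemma moveSite_of_lt {b γ : Fin (m + 1)} (hb : b ≤ α) (h : γ < b) : moveSite α b γ = γ := by
  obtain ⟨j, rfl⟩ := Fin.exists_succAbove_eq h.ne
  rw [moveSite_succAbove]
  rw [Fin.succAbove_lt_iff_castSucc_lt] at h
  rw [Fin.succAbove_of_castSucc_lt _ _ h, Fin.succAbove_of_castSucc_lt _ _ (h.trans_le hb)]

lemma moveSite_of_gt {b γ : Fin (m + 1)} (hb : α ≤ b) (h : b < γ) : moveSite α b γ = γ := by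
  obtain ⟨j, rfl⟩ := Fin.exists_succAbove_eq h.ne'
  rw [moveSite_succAbove]
  rw [Fin.lt_succAbove_iff_le_castSucc] at h
  rw [Fin.succAbove_of_le_castSucc _ _ h, Fin.succAbove_of_le_castSucc _ _ (hb.trans h)]

lemma prod_Iic_moveSite {M : Type*} [CommMonoid M] {b : Fin (m + 1)} (hb : α ≤ b)
    (f : Fin (m + 1) → M) :
    ∏ γ ∈ Finset.Iic b, f (moveSite α b γ) = ∏ γ ∈ Finset.Iic b, f γ := by
  have h : ∀ γ, b < moveSite α b γ ↔ b < γ := by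
    intro γ
    constructor
    · intro h
      have h1 := moveSite_of_gt hb h
      have h2 := (moveSite α b).injective h1
      rwa [h2] at h
    · intro h
      rwa [moveSite_of_gt hb h]
  refine Finset.prod_equiv (moveSite α b) (fun γ => ?_) fun γ _ => rfl
  rw [Finset.mem_Iic, Finset.mem_Iic, ← not_lt, ← not_lt, h]

end Move

section Bounds

variable {n k : ℕ} {q₁ q₂ p z : ℂ} {K a : Fin n → ℂ}

lemma kappaC_eq_prod_Iio [NeZero n] (κ : Fin n → ℕ) (β : Fin n) :
    kappaC q₁ K κ β = ∏ γ ∈ Finset.Iio β, kappa q₁ K κ γ := by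
  rw [kappaC]
  symm
  refine Finset.prod_bij (fun γ _ => (γ : ℕ)) (fun γ hγ => ?_) (fun _ _ _ _ h => Fin.ext h)
    (fun j hj => ?_) (fun γ _ => ?_)
  · exact Finset.mem_range.2 (Fin.lt_def.1 (Finset.mem_Iio.1 hγ))
  · have := Finset.mem_range.1 hj
    exact ⟨⟨j, this.trans β.2⟩, Finset.mem_Iio.2 (Fin.lt_def.2 this), rfl⟩
  · rw [Fin.ofNat_val_eq_self]

lemma prod_kappa (hq₁ : q₁ ≠ 0) (hzero : ∏ α, K α = q₁ ^ (2 * k)) (κ : Comp n k) :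
    ∏ γ, kappa q₁ K κ.1 γ = 1 := by
  simp only [kappa]
  rw [Finset.prod_mul_distrib, hzero, ← zpow_natCast]
  have h : ∏ γ, q₁ ^ (-2 * (κ.1 γ : ℤ)) = q₁ ^ (∑ γ, -2 * (κ.1 γ : ℤ)) := by
    generalize κ.1 = l
    induction (Finset.univ : Finset (Fin n)) using Finset.induction_on with
    | empty => simp
    | insert γ s hγ ih => rw [Finset.prod_insert hγ, Finset.sum_insert hγ, zpow_add₀ hq₁, ih]
  rw [h, ← zpow_add₀ hq₁, ← Finset.mul_sum, ← Nat.cast_sum, κ.2]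
  simp

lemma kappaC_add_period [NeZero n] (hq₁ : q₁ ≠ 0) (hzero : ∏ α, K α = q₁ ^ (2 * k))
    (κ : Comp n k) (m : ℕ) : kappaC q₁ K κ.1 (m + n) = kappaC q₁ K κ.1 m := by
  have hper : ∀ j, Fin.ofNat n (n + j) = Fin.ofNat n j := fun j => Fin.ext (by simp)
  have h0 : ∏ j ∈ Finset.range n, kappa q₁ K κ.1 (Fin.ofNat n j) = 1 := by
    rw [← prod_kappa hq₁ hzero κ, Finset.prod_range]
    exact Finset.prod_congr rfl fun γ _ => by rw [Fin.ofNat_val_eq_self]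
  rw [kappaC, add_comm, Finset.prod_range_add, h0, one_mul]
  exact Finset.prod_congr rfl fun j _ => by rw [hper]

lemma OrderAdmissible.of_isEmpty (hk : k = 0) (o : Equiv.Perm (Fin n)) :
    OrderAdmissible q₁ q₂ p K a o (fun _ : Comp n k => fun _ => 1) := by
  subst hk
  exact fun κ => ⟨fun i => i.elim0, fun i => i.elim0, fun i => i.elim0, fun i => i.elim0,
    fun i => i.elim0, fun i => i.elim0⟩

lemma exists_orderAdmissible [NeZero n] {o : Equiv.Perm (Fin n)} (hp : p ≠ 0)
    (hp1 : ‖p‖ < 1) (ha : ∀ β, a β ≠ 0) (h : 0 < k → RadiiBounds k q₁ q₂ p (K ∘ o) (a ∘ o)) :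
    ∃ r : Comp n k → Fin k → ℝ, OrderAdmissible q₁ q₂ p K a o r := by
  rcases Nat.eq_zero_or_pos k with hk | hk
  · exact ⟨_, OrderAdmissible.of_isEmpty hk o⟩
  · have : ∀ κ : Comp n k, ∃ r : Fin k → ℝ, Admissible q₁ q₂ p (K ∘ o) (a ∘ o) (κ.1 ∘ o) r :=
      fun κ => (h hk).exists_admissible hp hp1 (fun _ => ha _)
        ((Equiv.sum_comp o κ.1).trans κ.2)
    choose r hr using this
    exact ⟨r, hr⟩

lemma RadiiBounds.comp (h : RadiiBounds k q₁ q₂ p K a) (o : Equiv.Perm (Fin n))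
    (ho : ∀ β δ, δ < β → o β < o δ →
      max ‖q₁‖ 1 ^ (k - 1) * ‖a (o β)‖ < ‖q₂ * K (o δ) * a (o δ)‖) :
    RadiiBounds k q₁ q₂ p (K ∘ o) (a ∘ o) := by
  refine ⟨fun β δ hle => ?_, fun β δ => h.all _ _, h.pow⟩
  rcases le_or_gt (o δ) (o β) with h1 | h1
  · exact h.le _ _ h1
  · exact ho β δ (lt_of_le_of_ne hle fun e => by rw [e] at h1; exact lt_irrefl _ h1) h1

end Bounds

section Move

variable {m k : ℕ} {q₁ q₂ p z : ℂ} {K a : Fin (m + 1) → ℂ} {α : Fin (m + 1)}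

/-- In the unshifted block the site `α` can be moved to the front. -/
lemma RadiiBounds.moveSite_of_le (h : RadiiBounds k q₁ q₂ p K a)
    (h' : RadiiBounds k q₁ q₂ p K (pShift p α a)) {b : Fin (m + 1)} (hb : b ≤ α) :
    RadiiBounds k q₁ q₂ p (K ∘ moveSite α b) (a ∘ moveSite α b) := by
  refine h.comp _ fun β δ hlt hgt => ?_
  rcases moveSite_eq_of_lt_of_lt α b hlt hgt with ⟨rfl, hbα⟩ | ⟨-, hbα⟩
  · rw [moveSite_apply_self] at hgt ⊢
    have h1 := h'.all (moveSite α δ β) α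
    rw [pShift, Function.update_self, Function.update_of_ne hgt.ne,
      mul_left_comm (q₂ * K α), norm_mul p, mul_left_comm] at h1
    exact lt_of_mul_lt_mul_left h1 (norm_nonneg p)
  · exact absurd hbα hb.not_gt

/-- In the shifted block the site `α` can be moved to the end. -/
lemma RadiiBounds.moveSite_of_ge (h : RadiiBounds k q₁ q₂ p K a)
    (h' : RadiiBounds k q₁ q₂ p K (pShift p α a)) {b : Fin (m + 1)} (hb : α ≤ b) :
    RadiiBounds k q₁ q₂ p (K ∘ moveSite α b) (pShift p α a ∘ moveSite α b) := by
  refine h'.comp _ fun β δ hlt hgt => ?_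
  rcases moveSite_eq_of_lt_of_lt α b hlt hgt with ⟨-, hbα⟩ | ⟨rfl, hbα⟩
  · exact absurd hbα hb.not_gt
  · rw [moveSite_apply_self] at hgt ⊢
    rw [pShift, Function.update_self, Function.update_of_ne hgt.ne', norm_mul]
    exact h.all α _

/-- The cyclicity of the trace: the block with `α` in the last place at `p a_α` is the block with
`α` in the first place at `a_α`. -/
theorem orderedBlock_pShift_last (hq₁ : q₁ ≠ 0) (hq₂ : 1 < ‖q₂‖) (hp : p ≠ 0) (hp1 : ‖p‖ < 1)
    (hz : z ≠ 0) (hK : ∀ β, K β ≠ 0) (ha : ∀ β, a β ≠ 0) (hzero : ∏ α, K α = q₁ ^ (2 * k))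
    (α : Fin (m + 1)) {r r' : Comp (m + 1) k → Fin k → ℝ}
    (hr : OrderAdmissible q₁ q₂ p K a (moveSite α 0) r)
    (hr' : OrderAdmissible q₁ q₂ p K (pShift p α a) (moveSite α (Fin.last m)) r')
    (κ : Comp (m + 1) k) :
    orderedBlock q₁ q₂ p K (pShift p α a) (moveSite α (Fin.last m)) r' (z * kappa q₁ K κ.1 α) κ =
      orderedBlock q₁ q₂ p K a (moveSite α 0) r z κ := by
  have hs : pShift p α a ∘ α.succAbove = a ∘ α.succAbove := by
    ext j
    simp [pShift, Fin.succAbove_ne]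
  have hs' : pShift p α a α = p * a α := by simp [pShift]
  have hlast : ∀ {M : Type} (f : Fin (m + 1) → M), f ∘ moveSite α (Fin.last m) =
      (Fin.snoc (f ∘ α.succAbove) (f α) : Fin (m + 1) → M) := fun f => by
    rw [comp_moveSite, Fin.insertNth_last']
  have hzer : ∀ {M : Type} (f : Fin (m + 1) → M), f ∘ moveSite α 0 =
      (Fin.cons (f α) (f ∘ α.succAbove) : Fin (m + 1) → M) := fun f => by
    rw [comp_moveSite, Fin.insertNth_zero']
  have h1 := hr κ
  have h2 := hr' κ
  rw [hzer, hzer, hzer] at h1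
  rw [hlast, hlast, hlast, hs, hs'] at h2
  have hκ : κ.1 α + ∑ γ, (κ.1 ∘ α.succAbove) γ = k := by
    exact (Fin.sum_univ_succAbove κ.1 α).symm.trans κ.2
  have hz' : K α * ∏ γ, (K ∘ α.succAbove) γ = q₁ ^ (2 * k) := by
    rw [← hzero, Fin.prod_univ_succAbove _ α]
    rfl
  have hk : κ.1 α ≤ k := by omega
  rw [orderedBlock, orderedBlock, hlast, hlast, hlast, hzer, hzer, hzer, hs, hs', kappa,
    stabConst_rotate hq₁ hκ hz', ← blockIntegral_rotate hp hq₁ hκ hk hz']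
  congr 1
  refine blockIntegral_eq_of_admissible hq₁ hq₂ hp hp1
    (mul_ne_zero hz (mul_ne_zero (hK α) (zpow_ne_zero _ hq₁))) (fun β => ?_) (fun β => ?_)
    (h1.rotate hp hκ hk) h2
  · rw [← hlast]
    exact hK _
  · rw [← hs, ← hs', ← hlast]
    simp only [Function.comp_apply, pShift, Function.update_apply]
    split_ifs
    · exact mul_ne_zero hp (ha α)
    · exact ha _

end Move


/-! ### The difference equation -/

section Chain

variable {m k : ℕ} {q₁ q₂ p z : ℂ} {K a : Fin (m + 1) → ℂ} {α : Fin (m + 1)}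

/-- If `P` holds at `x` and otherwise exactly where `Q` holds, which is only above `x`, then the
ordered list of the elements satisfying `P` starts with `x` and continues with those satisfying `Q`.
-/
lemma filter_finRange_eq_cons {n : ℕ} {P Q : Fin n → Prop} [DecidablePred P] [DecidablePred Q]
    {x : Fin n} (hP : ∀ y, P y ↔ y = x ∨ Q y) (hQ : ∀ y, Q y → x < y) :
    (List.finRange n).filter P = x :: (List.finRange n).filter Q := by
  refine List.Pairwise.eq_of_mem_iff (r := (· < ·)) ?_ ?_ fun y => ?_
  · exact (List.pairwise_lt_finRange n).filter _
  · refine List.pairwise_cons.2 ⟨fun y hy => hQ y ?_, (List.pairwise_lt_finRange n).filter _⟩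
    simpa using hy
  · simp [hP]

lemma GenericDyn.mul_kappa (h : GenericDyn q₁ q₂ K z) (hq₁ : q₁ ≠ 0) (hK : ∀ β, K β ≠ 0)
    (κ : Fin (m + 1) → ℕ) (α : Fin (m + 1)) : GenericDyn q₁ q₂ K (z * kappa q₁ K κ α) := by
  have h1 := (h.mul_prod hK (Pi.single α 1)).mul_zpow hq₁ (-2 * (κ α : ℤ))
  rwa [Finset.prod_eq_single α (fun β _ hβ => by rw [Pi.single_eq_of_ne hβ, zpow_zero])
    (fun hn => absurd (Finset.mem_univ α) hn), Pi.single_eq_same, zpow_one, mul_assoc] at h1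

lemma kappa_ne_zero (hq₁ : q₁ ≠ 0) (hK : ∀ β, K β ≠ 0) (κ : Fin (m + 1) → ℕ) (α : Fin (m + 1)) :
    kappa q₁ K κ α ≠ 0 :=
  mul_ne_zero (hK α) (zpow_ne_zero _ hq₁)

/-- The ratio of two values of `κ_α` is a power of `q₁`. -/
lemma GenericDyn.mul_kappa_div_kappa (h : GenericDyn q₁ q₂ K z) (hq₁ : q₁ ≠ 0)
    (hK : ∀ β, K β ≠ 0) (κ κ' : Fin (m + 1) → ℕ) (α : Fin (m + 1)) :
    GenericDyn q₁ q₂ K (z * kappa q₁ K κ α / kappa q₁ K κ' α) := by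
  have h1 := h.mul_zpow hq₁ (-2 * (κ α : ℤ) - -2 * (κ' α : ℤ))
  have h2 : z * kappa q₁ K κ α / kappa q₁ K κ' α =
      z * q₁ ^ (-2 * (κ α : ℤ) - -2 * (κ' α : ℤ)) := by
    rw [zpow_sub₀ hq₁, kappa, kappa, mul_div_assoc, mul_div_mul_left _ _ (hK α)]
  rwa [h2]

/-- The exchange of `α` with a site `β = i.castSucc` that stands before `α` in the original order is
the operator `R_{β,α}(z κ^c_β)`. -/
lemma orderedBlock_moveSite_of_lt (h : GenericSites q₁ q₂ K a) (hz : GenericDyn q₁ q₂ K z)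
    (hp : p ≠ 0) (hp1 : ‖p‖ < 1) [NeZero (m + 1)] {i : Fin m} (hi : i.castSucc < α)
    {r r' : Comp (m + 1) k → Fin k → ℝ}
    (hr : OrderAdmissible q₁ q₂ p K a (moveSite α i.castSucc) r)
    (hr' : OrderAdmissible q₁ q₂ p K a (moveSite α i.succ) r') (κ : Comp (m + 1) k) :
    orderedBlock q₁ q₂ p K a (moveSite α i.castSucc) r z κ =
      RBefore q₁ q₂ K a i.castSucc α (orderedBlock q₁ q₂ p K a (moveSite α i.succ) r') z κ := by
  rw [← moveSite_mul_swap] at hr'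
  rw [orderedBlock_exchange h hz hp hp1 _ (by simp) hr hr', RBefore, moveSite_mul_swap,
    moveSite_succ_of_lt hi, moveSite_apply_self, kappaC_eq_prod_Iio]
  have h1 : ∏ γ ∈ Finset.Iio i.castSucc, kappa q₁ K κ.1 (moveSite α i.castSucc γ) =
      ∏ γ ∈ Finset.Iio i.castSucc, kappa q₁ K κ.1 γ :=
    Finset.prod_congr rfl fun γ hγ => by rw [moveSite_of_lt hi.le (Finset.mem_Iio.1 hγ)]
  rw [h1]

/-- The exchange of `α` with a site `β = i.succ` that stands behind `α` in the original order is the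
operator `R_{β,α}(z κ^c_β)`: since `α` stands before `β`, the factor `κ_α` of `κ^c_β` comes from the
substitution `z ↦ z κ_α`. -/
lemma orderedBlock_moveSite_of_le (h : GenericSites q₁ q₂ K a) (hz : GenericDyn q₁ q₂ K z)
    (hp : p ≠ 0) (hp1 : ‖p‖ < 1) [NeZero (m + 1)] {i : Fin m} (hi : α ≤ i.castSucc)
    {r r' : Comp (m + 1) k → Fin k → ℝ}
    (hr : OrderAdmissible q₁ q₂ p K a (moveSite α i.castSucc) r)
    (hr' : OrderAdmissible q₁ q₂ p K a (moveSite α i.succ) r') (κ : Comp (m + 1) k) :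
    orderedBlock q₁ q₂ p K a (moveSite α i.castSucc) r (z * kappa q₁ K κ.1 α) κ =
      RAfter q₁ q₂ K a i.succ α (fun z κ =>
        orderedBlock q₁ q₂ p K a (moveSite α i.succ) r' (z * kappa q₁ K κ.1 α) κ) z κ := by
  rw [← moveSite_mul_swap] at hr'
  rw [orderedBlock_exchange h (hz.mul_kappa h.q₁_ne h.K_ne κ.1 α) hp hp1 _ (by simp) hr hr', RAfter,
    moveSite_mul_swap, moveSite_succ_of_le hi, moveSite_apply_self, kappaC_eq_prod_Iio]
  have h1 : kappa q₁ K κ.1 α *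
      ∏ γ ∈ Finset.Iio i.castSucc, kappa q₁ K κ.1 (moveSite α i.castSucc γ) =
      ∏ γ ∈ Finset.Iio i.succ, kappa q₁ K κ.1 γ := by
    have h2 : Finset.Iio i.succ = Finset.Iic i.castSucc := by
      ext γ
      rw [Finset.mem_Iio, Finset.mem_Iic, Fin.le_castSucc_iff]
    rw [h2, ← prod_Iic_moveSite hi, ← Finset.Iio_insert, Finset.prod_insert (by simp),
      moveSite_apply_self]
  rw [mul_assoc, h1]
  refine Finset.sum_congr rfl fun κ' _ => ?_
  rw [div_mul_cancel₀ _ (kappa_ne_zero h.q₁_ne h.K_ne _ _)]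

/-- Moving `α` from the position `b` back to its own one. The function `f` is the block for the
original order, which does not depend on the radii. -/
lemma orderedBlock_eq_foldr_RBefore (h : GenericSites q₁ q₂ K a) (hp : p ≠ 0) (hp1 : ‖p‖ < 1)
    [NeZero (m + 1)] {f : ℂ → Comp (m + 1) k → ℂ}
    (hex : ∀ b ≤ α, ∃ r : Comp (m + 1) k → Fin k → ℝ,
      OrderAdmissible q₁ q₂ p K a (moveSite α b) r)
    (hf : ∀ r, OrderAdmissible q₁ q₂ p K a (moveSite α α) r → ∀ z, GenericDyn q₁ q₂ K z →
      ∀ κ, orderedBlock q₁ q₂ p K a (moveSite α α) r z κ = f z κ)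
    (b : Fin (m + 1)) (hb : b ≤ α) {r : Comp (m + 1) k → Fin k → ℝ}
    (hr : OrderAdmissible q₁ q₂ p K a (moveSite α b) r) (hz : GenericDyn q₁ q₂ K z)
    (κ : Comp (m + 1) k) :
    orderedBlock q₁ q₂ p K a (moveSite α b) r z κ =
      ((List.finRange (m + 1)).filter (fun β => b ≤ β ∧ β < α)).foldr
        (fun β g => RBefore q₁ q₂ K a β α g) f z κ := by
  have hnil : ∀ b : Fin (m + 1), α ≤ b →
      (List.finRange (m + 1)).filter (fun β => b ≤ β ∧ β < α) = [] := fun b hb => by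
    rw [List.filter_eq_nil_iff]
    intro β _
    simp only [decide_eq_true_eq, not_and, not_lt]
    exact hb.trans
  induction b using Fin.reverseInduction generalizing r κ with
  | last =>
    obtain rfl := Fin.last_le_iff.1 hb
    rw [hnil _ le_rfl]
    exact hf r hr z hz κ
  | cast i ih =>
    rcases hb.eq_or_lt with rfl | hlt
    · rw [hnil _ le_rfl]
      exact hf r hr z hz κ
    · have hs : i.succ ≤ α := Fin.castSucc_lt_iff_succ_le.1 hlt
      obtain ⟨r', hr'⟩ := hex _ hs
      rw [filter_finRange_eq_cons (x := i.castSucc) (Q := fun β => i.succ ≤ β ∧ β < α),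
        List.foldr_cons, orderedBlock_moveSite_of_lt h hz hp hp1 hlt hr hr', RBefore, RBefore]
      · exact Finset.sum_congr rfl fun κ' _ => by rw [ih hs hr']
      · intro y
        rw [le_iff_eq_or_lt, Fin.castSucc_lt_iff_succ_le, or_and_right]
        refine or_congr ⟨fun e => e.1.symm, fun e => ⟨e.symm, e ▸ hlt⟩⟩ Iff.rfl
      · exact fun y hy => Fin.castSucc_lt_iff_succ_le.2 hy.1

/-- Moving `α` from the position `b` to the last one. The function `g` is the block for the order
with `α` in the last place, after the substitution `z ↦ z κ_α`. -/
lemma orderedBlock_eq_foldr_RAfter (h : GenericSites q₁ q₂ K a) (hp : p ≠ 0) (hp1 : ‖p‖ < 1)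
    [NeZero (m + 1)] {g : ℂ → Comp (m + 1) k → ℂ}
    (hex : ∀ b, α ≤ b → ∃ r : Comp (m + 1) k → Fin k → ℝ,
      OrderAdmissible q₁ q₂ p K a (moveSite α b) r)
    (hg : ∀ r, OrderAdmissible q₁ q₂ p K a (moveSite α (Fin.last m)) r →
      ∀ z, GenericDyn q₁ q₂ K z → ∀ κ,
        orderedBlock q₁ q₂ p K a (moveSite α (Fin.last m)) r (z * kappa q₁ K κ.1 α) κ = g z κ)
    (b : Fin (m + 1)) (hb : α ≤ b) {r : Comp (m + 1) k → Fin k → ℝ}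
    (hr : OrderAdmissible q₁ q₂ p K a (moveSite α b) r) (hz : GenericDyn q₁ q₂ K z)
    (κ : Comp (m + 1) k) :
    orderedBlock q₁ q₂ p K a (moveSite α b) r (z * kappa q₁ K κ.1 α) κ =
      ((List.finRange (m + 1)).filter (fun β => b < β)).foldr
        (fun β g => RAfter q₁ q₂ K a β α g) g z κ := by
  induction b using Fin.reverseInduction generalizing r κ z with
  | last =>
    have hnil : (List.finRange (m + 1)).filter (fun β => Fin.last m < β) = [] := by
      rw [List.filter_eq_nil_iff]
      intro β _
      simpa using Fin.le_last β
    rw [hnil]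
    exact hg r hr z hz κ
  | cast i ih =>
    have hs : α ≤ i.succ := hb.trans Fin.castSucc_lt_succ.le
    obtain ⟨r', hr'⟩ := hex _ hs
    rw [filter_finRange_eq_cons (x := i.succ) (Q := fun β => i.succ < β),
      List.foldr_cons, orderedBlock_moveSite_of_le h hz hp hp1 hb hr hr', RAfter, RAfter]
    · exact Finset.sum_congr rfl fun κ' _ => by
        rw [ih hs hr' (hz.mul_kappa_div_kappa h.q₁_ne h.K_ne κ.1 κ'.1 α)]
    · intro y
      rw [Fin.castSucc_lt_iff_succ_le, le_iff_eq_or_lt, eq_comm]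
    · exact fun y hy => hy

/-- The equation for the block, in terms of the genericity structures. -/
theorem ellipticBlock_pShift (h : GenericSites q₁ q₂ K a)
    (h' : GenericSites q₁ q₂ K (pShift p α a)) (hz : GenericDyn q₁ q₂ K z)
    (hp : p ≠ 0) (hp1 : ‖p‖ < 1) [NeZero (m + 1)] (hzero : ∏ α, K α = q₁ ^ (2 * k))
    {r r' : Comp (m + 1) k → Fin k → ℝ}
    (hr : ∀ κ : Comp (m + 1) k, Admissible q₁ q₂ p K a κ.1 (r κ))
    (hr' : ∀ κ : Comp (m + 1) k, Admissible q₁ q₂ p K (pShift p α a) κ.1 (r' κ))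
    (κ : Comp (m + 1) k) :
    ellipticBlock q₁ q₂ p K (pShift p α a) r' (z * kappa q₁ K κ.1 α) κ =
      RAfterProd q₁ q₂ K (pShift p α a) α
        (RBeforeProd q₁ q₂ K a α (ellipticBlock q₁ q₂ p K a r)) z κ := by
  have hq₁ := h.q₁_ne
  have hblock : ∀ {a : Fin (m + 1) → ℂ} {r : Comp (m + 1) k → Fin k → ℝ} (z : ℂ)
      (κ : Comp (m + 1) k), (∀ β, a β ≠ 0) → (∀ i, 0 < r κ i) →
      ellipticBlock q₁ q₂ p K a r z κ = orderedBlock q₁ q₂ p K a (moveSite α α) r z κ := by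
    intro a r z κ ha hr
    rw [ellipticBlock_eq hq₁ h.one_lt hp hp1 h.K_ne ha κ hr, moveSite_self]
    rfl
  have hbounds : 0 < k → RadiiBounds k q₁ q₂ p K a := fun hk =>
    radiiBounds_of_admissible hk hp1 fun γ => ⟨_, hr ⟨Pi.single γ k, by simp⟩⟩
  have hbounds' : 0 < k → RadiiBounds k q₁ q₂ p K (pShift p α a) := fun hk =>
    radiiBounds_of_admissible hk hp1 fun γ => ⟨_, hr' ⟨Pi.single γ k, by simp⟩⟩
  have hex : ∀ b ≤ α, ∃ r : Comp (m + 1) k → Fin k → ℝ,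
      OrderAdmissible q₁ q₂ p K a (moveSite α b) r := fun b hb =>
    exists_orderAdmissible hp hp1 h.a_ne fun hk =>
      (hbounds hk).moveSite_of_le (hbounds' hk) hb
  have hex' : ∀ b, α ≤ b → ∃ r : Comp (m + 1) k → Fin k → ℝ,
      OrderAdmissible q₁ q₂ p K (pShift p α a) (moveSite α b) r := fun b hb =>
    exists_orderAdmissible hp hp1 h'.a_ne fun hk =>
      (hbounds hk).moveSite_of_ge (hbounds' hk) hb
  have hadm : ∀ {a : Fin (m + 1) → ℂ} {r : Comp (m + 1) k → Fin k → ℝ},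
      (∀ κ : Comp (m + 1) k, Admissible q₁ q₂ p K a κ.1 (r κ)) →
        OrderAdmissible q₁ q₂ p K a (moveSite α α) r := by
    intro a r hr
    rw [moveSite_self]
    exact hr
  rw [hblock _ _ h'.a_ne (hr' κ).pos, RAfterProd]
  refine orderedBlock_eq_foldr_RAfter h' hp hp1 hex' (fun r₁ hr₁ z hz κ => ?_) α le_rfl (hadm hr')
    hz κ
  obtain ⟨r₀, hr₀⟩ := hex 0 (Fin.zero_le _)
  rw [orderedBlock_pShift_last hq₁ h.one_lt hp hp1 hz.ne_zero h.K_ne h.a_ne hzero α hr₀ hr₁,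
    orderedBlock_eq_foldr_RBefore (f := ellipticBlock q₁ q₂ p K a r) h hp hp1 hex
      (fun r₁ hr₁ z hz κ => ?_) 0 (Fin.zero_le _) hr₀ hz κ, RBeforeProd]
  · simp only [Fin.zero_le, true_and]
  · rw [hblock _ _ h.a_ne (hr κ).pos, orderedBlock, orderedBlock,
      blockIntegral_eq_of_admissible (K := K ∘ moveSite α α) (a := a ∘ moveSite α α)
        hq₁ h.one_lt hp hp1 hz.ne_zero (fun _ => h.K_ne _) (fun _ => h.a_ne _) (hadm hr κ) (hr₁ κ)]

end Chain

/-- The genericity conditions modulo powers of `p` make the shifted sites generic too. -/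
lemma GenericSites.pShift {n : ℕ} {q₁ q₂ p : ℂ} {K a : Fin n → ℂ} (hq₁ : q₁ ≠ 0) (hq₂ : 1 < ‖q₂‖)
    (hp : p ≠ 0) (hK : ∀ α, K α ≠ 0) (ha : ∀ α, a α ≠ 0)
    (hq₁_gen : ∀ s t : ℤ, s ≠ 0 → q₁ ^ s ≠ q₂ ^ t)
    (hK_gen : ∀ (α : Fin n) (t : ℤ), K α ≠ q₂ ^ t)
    (ha_gen : ∀ α β : Fin n, α ≠ β → ∀ s t u : ℤ, a α / a β ≠ q₁ ^ s * q₂ ^ t * p ^ u)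
    (hKa_gen : ∀ α β : Fin n, α ≠ β → ∀ s t u : ℤ,
      K α * a α / a β ≠ q₁ ^ s * q₂ ^ t * p ^ u) (α : Fin n) :
    GenericSites q₁ q₂ K (pShift p α a) := by
  have hex : ∀ β, ∃ u : ℤ, EllipticQKZ.pShift p α a β = p ^ u * a β := by
    intro β
    by_cases h : β = α
    · exact ⟨1, by rw [h, EllipticQKZ.pShift, Function.update_self, zpow_one]⟩
    · exact ⟨0, by rw [EllipticQKZ.pShift, Function.update_of_ne h, zpow_zero, one_mul]⟩
  choose u hu using hex
  have hp' : ∀ u : ℤ, p ^ u ≠ 0 := fun u => zpow_ne_zero u hp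
  refine ⟨hq₂, hq₁, hK, fun β => ?_, hq₁_gen, hK_gen, fun β γ hne s t e => ?_,
    fun β γ hne s t e => ?_⟩
  · rw [hu]
    exact mul_ne_zero (hp' _) (ha β)
  · refine ha_gen β γ hne s t (u γ - u β) ?_
    rw [hu, hu, div_eq_iff (mul_ne_zero (hp' _) (ha γ))] at e
    have := hp' (u β)
    have := ha γ
    rw [zpow_sub₀ hp]
    field_simp
    linear_combination e
  · refine hKa_gen β γ hne s t (u γ - u β) ?_
    rw [hu, hu, div_eq_iff (mul_ne_zero (hp' _) (ha γ))] at e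
    have := hp' (u β)
    have := ha γ
    rw [zpow_sub₀ hp]
    field_simp
    linear_combination e

end EllipticQKZ

theorem mainTheorem1 {n : ℕ} [NeZero n] (k : ℕ) (q₁ q₂ p z : ℂ) (K a : Fin n → ℂ)
    (hq₁ : q₁ ≠ 0) (hq₂ : 1 < ‖q₂‖) (hp : p ≠ 0) (hp1 : ‖p‖ < 1)
    (hz : z ≠ 0) (hK : ∀ α, K α ≠ 0) (ha : ∀ α, a α ≠ 0)
    -- generic position
    (hq₁_gen : ∀ s t : ℤ, s ≠ 0 → q₁ ^ s ≠ q₂ ^ t)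
    (hK_gen : ∀ (α : Fin n) (t : ℤ), K α ≠ q₂ ^ t)
    (ha_gen : ∀ α β : Fin n, α ≠ β → ∀ s t u : ℤ, a α / a β ≠ q₁ ^ s * q₂ ^ t * p ^ u)
    (hKa_gen : ∀ α β : Fin n, α ≠ β → ∀ s t u : ℤ,
      K α * a α / a β ≠ q₁ ^ s * q₂ ^ t * p ^ u)
    (hz_gen : ∀ (s t : ℤ) (e : Fin n → ℤ), z ≠ q₁ ^ s * q₂ ^ t * ∏ α, K α ^ e α)
    -- the zero weight condition
    (hzero : ∏ α, K α = q₁ ^ (2 * k))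
    (α : Fin n)
    -- admissible contours for the block and for the shifted block
    (r r' : Comp n k → Fin k → ℝ)
    (hr : ∀ κ : Comp n k, Admissible q₁ q₂ p K a κ.1 (r κ))
    (hr' : ∀ κ : Comp n k, Admissible q₁ q₂ p K (pShift p α a) κ.1 (r' κ)) :
    (∀ κ : Comp n k,
      ellipticBlock q₁ q₂ p K (pShift p α a) r' (z * kappa q₁ K κ.1 α) κ =
        RAfterProd q₁ q₂ K (pShift p α a) α
          (RBeforeProd q₁ q₂ K a α (ellipticBlock q₁ q₂ p K a r)) z κ) ∧
      ∀ (κ : Comp n k) (m : ℕ), kappaC q₁ K κ.1 (m + n) = kappaC q₁ K κ.1 m := by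
  have h : GenericSites q₁ q₂ K a :=
    ⟨hq₂, hq₁, hK, ha, hq₁_gen, hK_gen,
      fun α β hne s t => by simpa using ha_gen α β hne s t 0,
      fun α β hne s t => by simpa using hKa_gen α β hne s t 0⟩
  have h' : GenericSites q₁ q₂ K (pShift p α a) :=
    .pShift hq₁ hq₂ hp hK ha hq₁_gen hK_gen ha_gen hKa_gen α
  obtain ⟨m, rfl⟩ := Nat.exists_eq_succ_of_ne_zero (NeZero.ne n)
  exact ⟨ellipticBlock_pShift h h' ⟨hz, hz_gen⟩ hp hp1 hzero hr hr',
    kappaC_add_period hq₁ hzero⟩
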